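/- Let $X$ be a Hausdorff space with the structure of a finite regular cell complex of dimension $d\ge 0$ (a finite CW complex, with at least one $d$-cell and no cell of higher dimension, whose characteristic maps are injective on the closed balls). Write $X^n$ for its $n$-skeleton; all homology has real coefficients. A point of $X$ is a $d$-manifold point if it has a neighbourhood homeomorphic to an open subset of $\mathbb{R}^d$. Let $X_{d-1}$ be the set of points that are not $d$-manifold points, let the $d$-strata of $X$ be the connected components of $X\setminus X_{d-1}$, and put $C_d = H_d(X, X_{d-1})$. An element $c\in C_d$ is not supported on a $d$-stratum $S$ if its restriction to $H_d(X, X\setminus\{x\})$ is zero for every $x\in S$; let $H_S\subseteq C_d$ be the subspace of these elements. Let $E(X)$ be the set of $d$-strata $S$ with $H_S\neq C_d$, and let the support of $c\in C_d$ be $\{S\in E(X) : c\notin H_S\}$. The cellular $d$-cycles in $C_d$ are the elements of $C_d$ whose image in the group of cellular chains $H_d(X^d,X^{d-1})$ is annihilated by the cellular boundary map $H_d(X^d,X^{d-1})\to H_{d-1}(X^{d-1},X^{d-2})$ (every element, if $d=0$). Then: 1. For each $S\in E(X)$ the subspace $H_S$ has codimension one in $C_d$, so that there is a linear functional $\varphi_S: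 C_d\to\mathbb{R}$ with kernel $H_S$. 2. The set $E(X)$ is finite and, for every choice of functionals $\varphi=(\varphi_S)_{S\in E(X)}$ with $\ker\varphi_S=H_S$, the sign vectors $(\operatorname{sign}\varphi_S(c))_{S\in E(X)}$ of the cellular $d$-cycles $c$ in $C_d$ of minimal nonempty support are the signed circuits of an oriented matroid $M(X,\varphi)$ on $E(X)$. 3. This oriented matroid is determined, up to reorientation, by the topological space: if $Y$ is a Hausdorff space with the structure of a finite regular cell complex of dimension $d'$, and $f:X\to Y$ is a homeomorphism (in particular, if $Y$ is $X$ with another regular cell structure and $f$ is the identity), then $S\mapsto f(S)$ is a bijection from $E(X)$ to $E(Y)$, and for all choices of functionals $\varphi$ for $X$ and $\psi$ for $Y$ as above, $M(Y,\psi)$ is, under this bijection, a reorientation of $M(X,\varphi)$. -/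

import Mathlib

open Topology

noncomputable section

namespace ReidMatroid

universe u v

/-! ## Oriented matroids -/

/-- An oriented matroid on a finite ground set `E`, given by its signed circuits. A signed subset
of `E` is a map `σ : E → SignType`; its support is the set where `σ` is nonzero. -/
structure OrientedMatroid (E : Type*) where
  /-- The set of signed circuits. -/
  circuits : Set (E → SignType)
  finite_ground : Finite E
  zero_notMem : (fun _ => 0) ∉ circuits
  neg_mem : ∀ σ ∈ circuits, (fun e => -σ e) ∈ circuits
  incomparable : ∀ σ ∈ circuits, ∀ τ ∈ circuits,
    (∀ e, σ e ≠ 0 → τ e ≠ 0) → σ = τ ∨ σ = fun e => -τ e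
  /-- Weak circuit elimination. -/
  elimination : ∀ σ ∈ circuits, ∀ τ ∈ circuits, (σ ≠ fun e => -τ e) →
    ∀ e, σ e = 1 → τ e = -1 →
      ∃ ρ ∈ circuits, ρ e = 0 ∧
        (∀ f, ρ f = 1 → σ f = 1 ∨ τ f = 1) ∧ (∀ f, ρ f = -1 → σ f = -1 ∨ τ f = -1)

/-- `N` is, under the identification `g` of the ground sets, a reorientation of `M`: for some set
`A` of elements, the signed circuits of `N` are those of `M` with the signs on `A` reversed. -/
def IsReorientationAlong {E F : Type*} (g : E ≃ F) (M : OrientedMatroid E)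
    (N : OrientedMatroid F) : Prop :=
  ∃ A : Set E, ∀ τ : F → SignType, τ ∈ N.circuits ↔
    ∃ σ ∈ M.circuits, ∀ e, (e ∈ A → τ (g e) = -σ e) ∧ (e ∉ A → τ (g e) = σ e)

/-! ## Relative singular homology with real coefficients

All the pairs `(A, B)` considered consist of subsets `B ⊆ A` of one ambient space `X`. The singular
chains of `A` are regarded as a subspace of those of `X`. -/

section Homology

variable (X : Type u) [TopologicalSpace X]

/-- The singular chain complex of `X` with real coefficients. -/
abbrev singularChains : ChainComplex (ModuleCat.{u} ℝ) ℕ :=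
  ((AlgebraicTopology.singularChainComplexFunctor (ModuleCat.{u} ℝ)).obj
    (ModuleCat.of ℝ (ULift.{u} ℝ))).obj (TopCat.of X)

variable {X}

/-- The boundary map `S_m(X) → S_n(X)`; it is zero unless `n + 1 = m`. -/
abbrev bdry (m n : ℕ) : (singularChains X).X m →ₗ[ℝ] (singularChains X).X n :=
  ((singularChains X).d m n).hom

/-- The map of singular chain complexes induced by the inclusion of a subset `A` of `X`. -/
abbrev chainInclusion (A : Set X) : singularChains A ⟶ singularChains X :=
  ((AlgebraicTopology.singularChainComplexFunctor (ModuleCat.{u} ℝ)).obj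
    (ModuleCat.of ℝ (ULift.{u} ℝ))).map (TopCat.ofHom ⟨Subtype.val, continuous_subtype_val⟩)

/-- The singular `n`-chains of the subspace `A`, as a subspace of those of `X`. -/
def chainsIn (A : Set X) (n : ℕ) : Submodule ℝ ((singularChains X).X n) :=
  LinearMap.range ((chainInclusion A).f n).hom

lemma chainsIn_mono {A A' : Set X} (h : A ⊆ A') (n : ℕ) : chainsIn A n ≤ chainsIn A' n := by
  have hfac : chainInclusion A = CategoryTheory.CategoryStruct.comp
      (((AlgebraicTopology.singularChainComplexFunctor (ModuleCat.{u} ℝ)).obj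
        (ModuleCat.of ℝ (ULift.{u} ℝ))).map
          (TopCat.ofHom ⟨Set.inclusion h, continuous_inclusion h⟩)) (chainInclusion A') := by
    rw [← CategoryTheory.Functor.map_comp]
    rfl
  unfold chainsIn
  rw [hfac]
  rintro _ ⟨c, rfl⟩
  exact ⟨_, rfl⟩

lemma bdry_bdry (l m n : ℕ) (c : (singularChains X).X l) : bdry m n (bdry l m c) = 0 := by
  have h := (singularChains X).d_comp_d l m n
  exact congrArg (fun f => f.hom c) h

/-- The relative `n`-cycles of `(A, B)`: chains of `A` with boundary in `B`. For `n = 0` every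
chain of `A` is a cycle. -/
def relCycles (A B : Set X) (n : ℕ) : Submodule ℝ ((singularChains X).X n) :=
  chainsIn A n ⊓ (chainsIn B (n - 1)).comap (bdry n (n - 1))

/-- The relative `n`-boundaries of `(A, B)`. -/
def relBoundaries (A B : Set X) (n : ℕ) : Submodule ℝ ((singularChains X).X n) :=
  (chainsIn A (n + 1)).map (bdry (n + 1) n) ⊔ chainsIn B n

/-- The relative singular homology `H_n(A, B; ℝ)`. -/
abbrev RelHomology (A B : Set X) (n : ℕ) : Type u :=
  relCycles A B n ⧸ (relBoundaries A B n).submoduleOf (relCycles A B n)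

lemma relCycles_mono {A B A' B' : Set X} (hA : A ⊆ A') (hB : B ⊆ B') (n : ℕ) :
    relCycles A B n ≤ relCycles A' B' n :=
  inf_le_inf (chainsIn_mono hA n) (Submodule.comap_mono (chainsIn_mono hB _))

lemma relBoundaries_mono {A B A' B' : Set X} (hA : A ⊆ A') (hB : B ⊆ B') (n : ℕ) :
    relBoundaries A B n ≤ relBoundaries A' B' n :=
  sup_le_sup (Submodule.map_mono (chainsIn_mono hA _)) (chainsIn_mono hB n)

/-- The map `H_n(A, B) → H_n(A', B')` induced by an inclusion of pairs. -/
def inclusionMap {A B A' B' : Set X} (hA : A ⊆ A') (hB : B ⊆ B') (n : ℕ) :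
    RelHomology A B n →ₗ[ℝ] RelHomology A' B' n :=
  Submodule.mapQ _ _ (Submodule.inclusion (relCycles_mono hA hB n))
    (fun _ hc => relBoundaries_mono hA hB n hc)

lemma bdry_mem_relCycles {A B D : Set X} {n : ℕ} {c : (singularChains X).X n}
    (hc : c ∈ relCycles A B n) : bdry n (n - 1) c ∈ relCycles B D (n - 1) := by
  refine ⟨hc.2, ?_⟩
  change bdry (n - 1) (n - 1 - 1) (bdry n (n - 1) c) ∈ chainsIn D (n - 1 - 1)
  rw [bdry_bdry]
  exact Submodule.zero_mem _

/-- For `n = 0` the boundary map `bdry 0 0` is zero, so the statement also holds there. -/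
lemma bdry_mem_relBoundaries {A B D : Set X} {n : ℕ} {c : (singularChains X).X n}
    (hc : c ∈ relBoundaries A B n) : bdry n (n - 1) c ∈ relBoundaries B D (n - 1) := by
  obtain ⟨_, ⟨e, _, rfl⟩, b, hb, rfl⟩ := Submodule.mem_sup.mp hc
  rw [map_add, bdry_bdry, zero_add]
  cases n with
  | zero =>
    have h0 : (singularChains X).d 0 (0 - 1) = 0 := (singularChains X).shape _ _ (by simp)
    have h1 : bdry 0 (0 - 1) b = 0 := by
      change ((singularChains X).d 0 (0 - 1)).hom b = 0
      rw [h0]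
      rfl
    rw [h1]
    exact Submodule.zero_mem _
  | succ k => exact Submodule.mem_sup_left ⟨b, hb, rfl⟩

/-- The connecting map `H_n(A, B) → H_{n-1}(B, D)`, `[c] ↦ [∂c]`, of a triple. It is the composite
of `H_n(A, B) → H_{n-1}(B)` and `H_{n-1}(B) → H_{n-1}(B, D)`, and it is zero for `n = 0`. -/
def connectingMap (A B D : Set X) (n : ℕ) : RelHomology A B n →ₗ[ℝ] RelHomology B D (n - 1) :=
  Submodule.mapQ _ _
    ((bdry n (n - 1)).restrict (fun _ hc => bdry_mem_relCycles hc))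
    (fun _ hc => bdry_mem_relBoundaries hc)

end Homology

/-! ## Manifold points and strata -/

section Strata

variable (X : Type u) [TopologicalSpace X] (d : ℕ)

/-- The points of `X` that have a neighbourhood homeomorphic to an open subset of `ℝᵈ`. -/
def manifoldPoints : Set X :=
  {x | ∃ e : OpenPartialHomeomorph X (EuclideanSpace ℝ (Fin d)), x ∈ e.source}

/-- The part `X_{d-1}` of the intrinsic filtration of a `d`-dimensional space `X = X_d`. -/
def singularPart : Set X := (manifoldPoints X d)ᶜ

/-- The `d`-strata of `X`: the connected components of the set of `d`-manifold points. -/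
def Stratum : Type u :=
  {S : Set X // ∃ x ∈ manifoldPoints X d, S = connectedComponentIn (manifoldPoints X d) x}

/-- The group `C_d = H_d(X_d, X_{d-1}; ℝ)`. -/
abbrev TopChains : Type u := RelHomology (Set.univ : Set X) (singularPart X d) d

variable {X d}

lemma Stratum.singularPart_subset (S : Stratum X d) {x : X} (hx : x ∈ S.1) :
    singularPart X d ⊆ {x}ᶜ := by
  obtain ⟨S, y, _, rfl⟩ := S
  rintro z hz rfl
  exact hz (connectedComponentIn_subset _ _ hx)

/-- The subspace of the elements of `C_d` not supported on the stratum `S`: those whose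
restriction to the local homology `H_d(X, X ∖ {x}; ℝ)` vanishes for all `x ∈ S`. -/
def Stratum.hyperplane (S : Stratum X d) : Submodule ℝ (TopChains X d) :=
  ⨅ x : S.1, LinearMap.ker
    (inclusionMap (subset_refl (Set.univ : Set X)) (S.singularPart_subset x.2) d)

variable (X d) in
/-- The `d`-strata on which some element of `C_d` is supported; they index the coordinate
hyperplanes of `C_d`. -/
def CoordStratum : Type u := {S : Stratum X d // S.hyperplane ≠ ⊤}

/-- A choice of coordinates on `C_d`: for each coordinate hyperplane, a linear functional that
has it as its kernel. -/
def IsCoordinateSystem (φ : CoordStratum X d → (TopChains X d →ₗ[ℝ] ℝ)) : Prop :=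
  ∀ S : CoordStratum X d, LinearMap.ker (φ S) = S.1.hyperplane

/-- The support of an element of `C_d`: the strata on which it is supported. -/
def support (c : TopChains X d) : Set (CoordStratum X d) := {S | c ∉ S.1.hyperplane}

end Strata

/-! ## Regular cell complexes and their cellular cycles -/

section Cells

open CWComplex

/-- The CW structure on the space `X` is a finite regular cell complex of dimension `d`: the
characteristic maps are injective on the closed balls. -/
class IsRegularComplex (X : Type u) [TopologicalSpace X] [CWComplex (Set.univ : Set X)]
    (d : ℕ) : Prop where
  finite_cell : ∀ n, _root_.Finite (cell (Set.univ : Set X) n)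
  injOn_map : ∀ n (i : cell (Set.univ : Set X) n),
    Set.InjOn (map (C := (Set.univ : Set X)) n i) (Metric.closedBall 0 1)
  nonempty_cell : Nonempty (cell (Set.univ : Set X) d)
  isEmpty_cell : ∀ n, d < n → IsEmpty (cell (Set.univ : Set X) n)

variable (X : Type u) [TopologicalSpace X] [T2Space X] [CWComplex (Set.univ : Set X)]

/-- The union of the cells of dimension less than `n`, that is, the `(n-1)`-skeleton. -/
abbrev skelLT (n : ℕ) : Set X := (skeletonLT (Set.univ : Set X) n : Set X)

/-- The group of real cellular `n`-chains, `H_n(Xⁿ, Xⁿ⁻¹; ℝ)` for the skeleta `Xⁿ`. -/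
abbrev CellularChains (n : ℕ) : Type u := RelHomology (skelLT X (n + 1)) (skelLT X n) n

/-- The cellular boundary map from `n`-chains to `(n-1)`-chains (zero for `n = 0`).
For `n = m + 1` the target is by definition `CellularChains X m`. -/
def cellularBoundary (n : ℕ) :
    CellularChains X n →ₗ[ℝ] RelHomology (skelLT X n) (skelLT X (n - 1)) (n - 1) :=
  connectingMap (skelLT X (n + 1)) (skelLT X n) (skelLT X (n - 1)) n

variable {X} {d : ℕ}

lemma univ_subset_skelLT [IsRegularComplex X d] : Set.univ ⊆ skelLT X (d + 1) := by
  intro x _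
  have hx : x ∈ ⋃ (n : ℕ) (j : cell (Set.univ : Set X) n), openCell n j := by
    rw [CWComplex.iUnion_openCell_eq_complex]
    trivial
  simp only [Set.mem_iUnion] at hx
  obtain ⟨n, j, hj⟩ := hx
  have hn : n ≤ d := by
    by_contra h
    exact (IsRegularComplex.isEmpty_cell (X := X) (d := d) n (not_le.mp h)).false j
  refine CWComplex.mem_skeletonLT_iff.mpr ⟨n, ?_, j, hj⟩
  exact_mod_cast Nat.lt_succ_of_le hn

lemma isOpen_openCell [IsRegularComplex X d] (i : cell (Set.univ : Set X) d) :
    IsOpen (openCell d i) := by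
  have hfin := IsRegularComplex.finite_cell (X := X) (d := d) d
  have hclosed : IsClosed
      (skelLT X d ∪ ⋃ j : {j : cell (Set.univ : Set X) d // j ≠ i}, closedCell d j.1) :=
    (skeletonLT (Set.univ : Set X) d).closed.union
      (isClosed_iUnion_of_finite fun j => RelCWComplex.isClosed_closedCell)
  have hdisj : Disjoint (openCell d i) (skelLT X d) := by
    rw [Set.disjoint_left]
    intro x hx hx'
    obtain ⟨m, hm, j, hj⟩ := CWComplex.mem_skeletonLT_iff.mp hx'
    have hm' : m < d := by exact_mod_cast hm
    refine Set.disjoint_left.mp (RelCWComplex.disjoint_openCell_of_ne (i := i) (j := j) ?_) hx hj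
    intro h
    exact hm'.ne' (congrArg Sigma.fst h)
  convert hclosed.isOpen_compl using 1
  ext x
  simp only [Set.mem_compl_iff, Set.mem_union, Set.mem_iUnion, not_or, not_exists]
  constructor
  · refine fun hx => ⟨Set.disjoint_left.mp hdisj hx, ?_⟩
    rintro ⟨j, hj⟩ hxj
    rw [← RelCWComplex.cellFrontier_union_openCell_eq_closedCell] at hxj
    rcases hxj with hxj | hxj
    · exact Set.disjoint_left.mp hdisj hx (RelCWComplex.cellFrontier_subset_skeletonLT _ _ hxj)
    · refine Set.disjoint_left.mp (RelCWComplex.disjoint_openCell_of_ne (i := i) (j := j) ?_) hx hxj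
      intro h
      exact hj (by simpa using h.symm)
  · rintro ⟨h1, h2⟩
    obtain ⟨m, hm, j, hj⟩ := CWComplex.mem_skeletonLT_iff.mp
      (univ_subset_skelLT (d := d) (Set.mem_univ x))
    have hm' : m < d + 1 := by exact_mod_cast hm
    rcases Nat.lt_succ_iff_lt_or_eq.mp hm' with hlt | rfl
    · exact absurd (CWComplex.mem_skeletonLT_iff.mpr ⟨m, by exact_mod_cast hlt, j, hj⟩) h1
    · by_cases hji : j = i
      · exact hji ▸ hj
      · exact absurd (RelCWComplex.openCell_subset_closedCell _ _ hj) (h2 ⟨j, hji⟩)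

/-- The points of the open `d`-cells are `d`-manifold points. -/
lemma singularPart_subset_skelLT [IsRegularComplex X d] :
    singularPart X d ⊆ skelLT X d := by
  intro x hx
  obtain ⟨m, hm, j, hj⟩ := CWComplex.mem_skeletonLT_iff.mp
    (univ_subset_skelLT (d := d) (Set.mem_univ x))
  have hm' : m < d + 1 := by exact_mod_cast hm
  rcases Nat.lt_succ_iff_lt_or_eq.mp hm' with hlt | rfl
  · exact CWComplex.mem_skeletonLT_iff.mpr ⟨m, by exact_mod_cast hlt, j, hj⟩
  · have hs : (map (C := (Set.univ : Set X)) m j).source = Metric.ball 0 1 := source_eq m j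
    have ht : (map (C := (Set.univ : Set X)) m j).target = openCell m j := by
      rw [← PartialEquiv.image_source_eq_target, hs]
      rfl
    let e : OpenPartialHomeomorph (Fin m → ℝ) X :=
      { toPartialEquiv := map (C := (Set.univ : Set X)) m j
        open_source := by rw [hs]; exact Metric.isOpen_ball
        open_target := by rw [ht]; exact isOpen_openCell j
        continuousOn_toFun := by
          rw [hs]
          exact (continuousOn m j).mono Metric.ball_subset_closedBall
        continuousOn_invFun := continuousOn_symm m j }
    refine absurd ⟨e.symm.transHomeomorph (PiLp.homeomorph 2 (fun _ : Fin m => ℝ)).symm, ?_⟩ hx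
    change x ∈ (map (C := (Set.univ : Set X)) m j).target
    rw [ht]
    exact hj

variable (X d) in
/-- The natural map from `C_d = H_d(X, X_{d-1})` to the cellular chains `H_d(Xᵈ, Xᵈ⁻¹)`. -/
def toCellular [IsRegularComplex X d] : TopChains X d →ₗ[ℝ] CellularChains X d :=
  inclusionMap univ_subset_skelLT singularPart_subset_skelLT d

variable (X d) in
/-- The real cellular `d`-cycles in `C_d`. -/
def cellularCycles [IsRegularComplex X d] : Submodule ℝ (TopChains X d) :=
  LinearMap.ker (cellularBoundary X d ∘ₗ toCellular X d)

/-- `c` is a cellular `d`-cycle in `C_d` of minimal nonempty support. -/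
def IsMinimalCycle [IsRegularComplex X d] (c : TopChains X d) : Prop :=
  c ∈ cellularCycles X d ∧ (support c).Nonempty ∧
    ∀ z ∈ cellularCycles X d, (support z).Nonempty → support z ⊆ support c → support z = support c

/-- The sign vectors, in the coordinates `φ`, of the cellular `d`-cycles of minimal support. -/
def signedCircuits [IsRegularComplex X d]
    (φ : CoordStratum X d → (TopChains X d →ₗ[ℝ] ℝ)) : Set (CoordStratum X d → SignType) :=
  {σ | ∃ c, IsMinimalCycle c ∧ σ = fun S => SignType.sign (φ S c)}

end Cells

end ReidMatroid

end

noncomputable section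

namespace ReidMatroid

universe u v w

open CategoryTheory

/-! ## A concrete model of the singular chains -/

section ConcreteChains

/-! Let `S` be a `d`-stratum. Excision in a chart gives `H_d(X, X ∖ x) ≅ ℝ` for `x ∈ S`, and whether
a class restricts to zero there is locally constant in `x`; as `S` is connected, a single point
decides it (`topClass_mem_hyperplane_iff`). So `H_S` is the kernel of one functional, which is
nonzero when `S ∈ E(X)`. Every stratum is open and meets an open `d`-cell, and an open `d`-cell lies
in one stratum, so there are finitely many strata.

The functionals map the cellular cycles onto a subspace `W` of `ℝ^E`, and cycles of minimal support
correspond to vectors of minimal support. For any real subspace the signs of these elementary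
vectors are the circuits of an oriented matroid; elimination holds because every nonzero vector of
`W` has an elementary vector conforming to it (`exists_isElementary_conformal`).

Invariance rests on `mem_map_cellularCycles_iff`: `W` is also the image of the absolute singular
`d`-cycles, which do not see the cells. For `d > 0` a cellular cycle `c` satisfies `∂c = ∂a + b`
with `a` in `X^{d-1}` and `b` a cycle of `X^{d-2}`. Since `H_{d-1}(X^{d-2}) = 0`
(`cycles_skelLT_le`), `c` differs from an absolute cycle by a chain of `X^{d-1}`, which is invisible
at a point of `S` inside an open `d`-cell. A homeomorphism carries absolute cycles, strata and
hyperplanes along. On absolute cycles corresponding functionals have equal kernels, hence are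
nonzero multiples of each other, and the negative multiples give the reorientation. The dimension is
an invariant because local homology distinguishes the dimensions of charts
(`le_of_mem_manifoldPoints`).

The homology behind this (excision, deformations, local homology of `ℝᵐ`, attaching a cell) is
developed for chains that are finitely supported functions on singular simplices. -/

/-- Singular `n`-chains, as finitely supported functions on the singular simplices. -/
abbrev Chain (X : Type u) [TopologicalSpace X] (n : ℕ) : Type u :=
  C(stdSimplex ℝ (Fin (n + 1)), X) →₀ ℝ

/-- The inclusion of the `i`-th face of the standard simplex. -/
def face {n : ℕ} (i : Fin (n + 2)) :
    C(stdSimplex ℝ (Fin (n + 1)), stdSimplex ℝ (Fin (n + 2))) :=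
  ⟨stdSimplex.map i.succAbove, stdSimplex.continuous_map _⟩

variable {X : Type u} [TopologicalSpace X] {Y : Type v} [TopologicalSpace Y]

/-- The boundary map on singular chains of positive degree. -/
def bds (n : ℕ) : Chain X (n + 1) →ₗ[ℝ] Chain X n :=
  Finsupp.linearCombination ℝ fun σ =>
    ∑ i : Fin (n + 2), (-1 : ℝ) ^ (i : ℕ) • Finsupp.single (σ.comp (face i)) (1 : ℝ)

/-- The boundary map on singular chains; it is zero on `0`-chains. -/
def bd : (n : ℕ) → Chain X n →ₗ[ℝ] Chain X (n - 1)
  | 0 => 0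
  | n + 1 => bds n

@[simp] lemma bd_zero (c : Chain X 0) : bd 0 c = 0 := rfl

@[simp] lemma bd_succ (n : ℕ) (c : Chain X (n + 1)) : bd (n + 1) c = bds n c := rfl

lemma bds_single (n : ℕ) (σ : C(stdSimplex ℝ (Fin (n + 2)), X)) (r : ℝ) :
    bds n (Finsupp.single σ r) =
      r • ∑ i : Fin (n + 2), (-1 : ℝ) ^ (i : ℕ) • Finsupp.single (σ.comp (face i)) (1 : ℝ) := by
  simp [bds]

/-- The map on chains induced by a continuous map. -/
def chainMap (f : C(X, Y)) (n : ℕ) : Chain X n →ₗ[ℝ] Chain Y n :=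
  Finsupp.lmapDomain ℝ ℝ f.comp

@[simp] lemma chainMap_single (f : C(X, Y)) (n : ℕ) (σ : C(stdSimplex ℝ (Fin (n + 1)), X))
    (r : ℝ) : chainMap f n (Finsupp.single σ r) = Finsupp.single (f.comp σ) r := by
  simp [chainMap]

lemma bds_chainMap (f : C(X, Y)) (n : ℕ) (c : Chain X (n + 1)) :
    bds n (chainMap f (n + 1) c) = chainMap f n (bds n c) := by
  induction c using Finsupp.induction_linear with
  | zero => simp
  | add a b ha hb => simp only [map_add, ha, hb]
  | single σ r =>
    rw [chainMap_single, bds_single, bds_single]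
    simp only [map_smul, map_sum, ContinuousMap.comp_assoc, chainMap_single]

/-- The singular simplex of `X` as a simplex of the singular simplicial set. -/
def toSing (n : ℕ) (σ : C(stdSimplex ℝ (Fin (n + 1)), X)) :
    (TopCat.toSSet.obj (TopCat.of X)).obj (Opposite.op (SimplexCategory.mk n)) :=
  (TopCat.toSSetObjEquiv (TopCat.of X) (Opposite.op (SimplexCategory.mk n))).symm σ

/-- The singular simplicial set simplex as a continuous map. -/
def ofSing (n : ℕ)
    (s : (TopCat.toSSet.obj (TopCat.of X)).obj (Opposite.op (SimplexCategory.mk n))) :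
    C(stdSimplex ℝ (Fin (n + 1)), X) :=
  TopCat.toSSetObjEquiv (TopCat.of X) (Opposite.op (SimplexCategory.mk n)) s

@[simp] lemma ofSing_toSing (n : ℕ) (σ : C(stdSimplex ℝ (Fin (n + 1)), X)) :
    ofSing n (toSing n σ) = σ := Equiv.apply_symm_apply _ _

@[simp] lemma toSing_ofSing (n : ℕ)
    (s : (TopCat.toSSet.obj (TopCat.of X)).obj (Opposite.op (SimplexCategory.mk n))) :
    toSing n (ofSing n s) = s := Equiv.symm_apply_apply _ _

/-- The generator of the singular chains given by a singular simplex. -/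
def gen (n : ℕ) (σ : C(stdSimplex ℝ (Fin (n + 1)), X)) : (singularChains X).X n :=
  ((TopCat.toSSet.obj (TopCat.of X)).ιChainComplex (R := ModuleCat.of ℝ (ULift.{u} ℝ))
    (toSing n σ)).hom ⟨1⟩

/-- From the concrete chains to the singular chains. -/
def fromChain (X : Type u) [TopologicalSpace X] (n : ℕ) :
    Chain X n →ₗ[ℝ] (singularChains X).X n :=
  Finsupp.linearCombination ℝ (gen n)

/-- From the singular chains to the concrete chains. -/
def toChain (X : Type u) [TopologicalSpace X] (n : ℕ) :
    (singularChains X).X n →ₗ[ℝ] Chain X n :=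
  (((TopCat.toSSet.obj (TopCat.of X)).isColimitChainComplexXCofan
    (ModuleCat.of ℝ (ULift.{u} ℝ)) n).desc
      (Limits.Cofan.mk (ModuleCat.of ℝ (Chain X n)) fun s =>
        ModuleCat.ofHom (Finsupp.lsingle (ofSing n s) ∘ₗ
          (ULift.moduleEquiv : ULift.{u} ℝ ≃ₗ[ℝ] ℝ).toLinearMap))).hom

lemma toChain_iota (n : ℕ)
    (s : (TopCat.toSSet.obj (TopCat.of X)).obj (Opposite.op (SimplexCategory.mk n)))
    (r : ULift.{u} ℝ) :
    toChain X n (((TopCat.toSSet.obj (TopCat.of X)).ιChainComplex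
      (R := ModuleCat.of ℝ (ULift.{u} ℝ)) s).hom r) = Finsupp.single (ofSing n s) r.down := by
  have h := ((TopCat.toSSet.obj (TopCat.of X)).isColimitChainComplexXCofan
    (ModuleCat.of ℝ (ULift.{u} ℝ)) n).fac
      (Limits.Cofan.mk (ModuleCat.of ℝ (Chain X n)) fun s =>
        ModuleCat.ofHom (Finsupp.lsingle (ofSing n s) ∘ₗ
          (ULift.moduleEquiv : ULift.{u} ℝ ≃ₗ[ℝ] ℝ).toLinearMap)) ⟨s⟩
  exact congrArg (fun f => f.hom r) h

@[simp] lemma toChain_gen (n : ℕ) (σ : C(stdSimplex ℝ (Fin (n + 1)), X)) :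
    toChain X n (gen n σ) = Finsupp.single σ 1 := by
  rw [gen, toChain_iota, ofSing_toSing]

lemma toChain_fromChain (n : ℕ) (c : Chain X n) : toChain X n (fromChain X n c) = c := by
  induction c using Finsupp.induction_linear with
  | zero => simp
  | add a b ha hb => simp only [map_add, ha, hb]
  | single σ r => simp [fromChain]

/-- Two linear maps from the singular chains agree if they do so on the generators. -/
lemma singularChains_hom_ext {M : ModuleCat.{u} ℝ} {n : ℕ}
    {f g : (singularChains X).X n →ₗ[ℝ] M} (h : ∀ σ, f (gen n σ) = g (gen n σ)) : f = g := by
  have : ModuleCat.ofHom f = ModuleCat.ofHom g := by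
    refine SSet.chainComplex_hom_ext (X := TopCat.toSSet.obj (TopCat.of X))
      (R := ModuleCat.of ℝ (ULift.{u} ℝ)) fun s => ?_
    ext r
    have hr : (r : ULift.{u} ℝ) = r.down • (⟨1⟩ : ULift.{u} ℝ) := by
      ext; simp
    have h1 := h (ofSing n s)
    rw [gen, toSing_ofSing] at h1
    rw [hr]
    erw [map_smul, map_smul]
    exact congrArg (r.down • ·) h1
  exact congrArg ModuleCat.Hom.hom this

lemma fromChain_toChain (n : ℕ) (c : (singularChains X).X n) :
    fromChain X n (toChain X n c) = c := by
  have : fromChain X n ∘ₗ toChain X n = LinearMap.id :=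
    singularChains_hom_ext (M := (singularChains X).X n) fun σ => by simp [fromChain]
  exact congrArg (fun f => f c) this

/-- The singular chains are the free module on the singular simplices. -/
def chainEquiv (X : Type u) [TopologicalSpace X] (n : ℕ) :
    (singularChains X).X n ≃ₗ[ℝ] Chain X n :=
  { toChain X n with
    invFun := fromChain X n
    left_inv := fromChain_toChain n
    right_inv := toChain_fromChain n }

lemma chainEquiv_gen (n : ℕ) (σ : C(stdSimplex ℝ (Fin (n + 1)), X)) :
    chainEquiv X n (gen n σ) = Finsupp.single σ 1 := toChain_gen n σ

lemma bdry_gen (n : ℕ) (σ : C(stdSimplex ℝ (Fin (n + 2)), X)) :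
    bdry (n + 1) n (gen (n + 1) σ) = ∑ i : Fin (n + 2), (-1 : ℝ) ^ (i : ℕ) • gen n (σ.comp (face i)) := by
  have h := (TopCat.toSSet.obj (TopCat.of X)).ιChainComplex_d
    (R := ModuleCat.of ℝ (ULift.{u} ℝ)) (toSing (n + 1) σ)
  have h2 := congrArg (fun f => f.hom ⟨1⟩) h
  refine h2.trans ?_
  simp only [ModuleCat.hom_sum, LinearMap.sum_apply, ModuleCat.hom_zsmul, LinearMap.smul_apply]
  refine Finset.sum_congr rfl fun i _ => ?_
  rw [← Int.cast_smul_eq_zsmul ℝ]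
  push_cast
  rfl

lemma chainEquiv_bdry (n : ℕ) (c : (singularChains X).X n) :
    chainEquiv X (n - 1) (bdry n (n - 1) c) = bd n (chainEquiv X n c) := by
  cases n with
  | zero =>
    -- Truncated subtraction makes this `bdry 0 0`, which vanishes because differentials of the
    -- complex only go from degree `n + 1` to `n`.
    have h0 : (singularChains X).d 0 (0 - 1) = 0 := (singularChains X).shape _ _ (by simp)
    have h1 : bdry 0 (0 - 1) c = 0 := by
      change ((singularChains X).d 0 (0 - 1)).hom c = 0
      rw [h0]
      rfl
    rw [h1, map_zero, bd_zero]
  | succ n =>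
    have : (chainEquiv X n).toLinearMap ∘ₗ bdry (n + 1) n =
        bds n ∘ₗ (chainEquiv X (n + 1)).toLinearMap := by
      refine singularChains_hom_ext (M := ModuleCat.of ℝ (Chain X n)) fun σ => ?_
      simp only [LinearMap.comp_apply, LinearEquiv.coe_coe]
      rw [bdry_gen, map_sum, chainEquiv_gen, bds_single]
      simp [chainEquiv_gen]
    exact congrArg (fun f => f c) this

/-- The map on the singular chain complexes induced by a continuous map. -/
abbrev singMap {Y : Type u} [TopologicalSpace Y] (f : C(X, Y)) :
    singularChains X ⟶ singularChains Y :=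
  ((AlgebraicTopology.singularChainComplexFunctor (ModuleCat.{u} ℝ)).obj
    (ModuleCat.of ℝ (ULift.{u} ℝ))).map (TopCat.ofHom f)

lemma chainEquiv_singMap {Y : Type u} [TopologicalSpace Y] (f : C(X, Y)) (n : ℕ)
    (c : (singularChains X).X n) :
    chainEquiv Y n (((singMap f).f n).hom c) = chainMap f n (chainEquiv X n c) := by
  have : (chainEquiv Y n).toLinearMap ∘ₗ ((singMap f).f n).hom =
      chainMap f n ∘ₗ (chainEquiv X n).toLinearMap := by
    refine singularChains_hom_ext (M := ModuleCat.of ℝ (Chain Y n)) fun σ => ?_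
    simp only [LinearMap.comp_apply, LinearEquiv.coe_coe]
    rw [chainEquiv_gen, chainMap_single, ← chainEquiv_gen]
    congr 1
    have h := SSet.ι_chainComplexMap_f _ _ (TopCat.toSSet.map (TopCat.ofHom f))
      (ModuleCat.of ℝ (ULift.{u} ℝ)) (toSing n σ)
    exact congrArg (fun f => f.hom ⟨1⟩) h
  exact congrArg (fun f => f c) this

lemma chainEquiv_bdry_succ (n : ℕ) (c : (singularChains X).X (n + 1)) :
    chainEquiv X n (bdry (n + 1) n c) = bds n (chainEquiv X (n + 1) c) :=
  chainEquiv_bdry (n + 1) c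

/-- Homotopic maps induce chain homotopic maps. -/
lemma exists_chainHomotopy {Y : Type u} [TopologicalSpace Y] {f g : C(X, Y)}
    (h : f.Homotopy g) : ∃ P : ∀ n, Chain X n →ₗ[ℝ] Chain Y (n + 1),
      (∀ c, bds 0 (P 0 c) = chainMap f 0 c - chainMap g 0 c) ∧
      ∀ n c, bds (n + 1) (P (n + 1) c) + P n (bds n c) =
        chainMap f (n + 1) c - chainMap g (n + 1) c := by
  have H : Homotopy (singMap f) (singMap g) :=
    TopCat.Homotopy.singularChainComplexFunctorObjMap
      (f := TopCat.ofHom f) (g := TopCat.ofHom g) h (ModuleCat.of ℝ (ULift.{u} ℝ))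
  refine ⟨fun n => (chainEquiv Y (n + 1)).toLinearMap ∘ₗ (H.hom n (n + 1)).hom ∘ₗ
    (chainEquiv X n).symm.toLinearMap, fun c => ?_, fun n c => ?_⟩
  · obtain ⟨c, rfl⟩ := (chainEquiv X 0).surjective c
    have h := H.comm 0
    rw [Homotopy.dNext_zero_chainComplex, Homotopy.prevD_chainComplex, zero_add] at h
    have h' := congrArg (fun f => chainEquiv Y 0 (f.hom c)) h
    simp only [ModuleCat.hom_add, LinearMap.add_apply, map_add, ModuleCat.hom_comp,
      LinearMap.comp_apply, chainEquiv_singMap] at h'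
    rw [h', add_sub_cancel_right]
    simp only [LinearMap.comp_apply, LinearEquiv.coe_coe, LinearEquiv.symm_apply_apply]
    exact (chainEquiv_bdry_succ 0 _).symm
  · obtain ⟨c, rfl⟩ := (chainEquiv X (n + 1)).surjective c
    have h := H.comm (n + 1)
    rw [Homotopy.dNext_succ_chainComplex, Homotopy.prevD_chainComplex] at h
    have h' := congrArg (fun f => chainEquiv Y (n + 1) (f.hom c)) h
    simp only [ModuleCat.hom_add, LinearMap.add_apply, map_add, ModuleCat.hom_comp,
      LinearMap.comp_apply, chainEquiv_singMap] at h'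
    rw [h', add_sub_cancel_right]
    simp only [LinearMap.comp_apply, LinearEquiv.coe_coe, LinearEquiv.symm_apply_apply]
    refine (add_comm _ _).trans (congrArg₂ (· + ·) ?_ ?_)
    · have h1 : bds n (chainEquiv X (n + 1) c) =
          chainEquiv X n (bdry (n + 1) n c) := (chainEquiv_bdry_succ n c).symm
      rw [h1, LinearEquiv.symm_apply_apply]
    · exact (chainEquiv_bdry_succ (n + 1) _).symm

/-- Read off from the singular chain complex through `chainEquiv`, so that no identities between
iterated faces are needed. -/
lemma bds_bds (n : ℕ) (c : Chain X (n + 2)) : bds n (bds (n + 1) c) = 0 := by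
  obtain ⟨c, rfl⟩ := (chainEquiv X (n + 2)).surjective c
  have h1 : bds (n + 1) (chainEquiv X (n + 2) c) =
      chainEquiv X (n + 1) (bdry (n + 2) (n + 1) c) := (chainEquiv_bdry_succ (n + 1) c).symm
  rw [h1, ← chainEquiv_bdry_succ, bdry_bdry, map_zero]

lemma bd_bd (n : ℕ) (c : Chain X n) : bd (n - 1) (bd n c) = 0 := by
  rcases n with _ | _ | n
  · rfl
  · rfl
  · exact bds_bds n c

lemma bd_bds (n : ℕ) (c : Chain X (n + 1)) : bd n (bds n c) = 0 := bd_bd (n + 1) c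

/-- The concrete singular chains of a subset `A`. -/
def chainsOn (A : Set X) (n : ℕ) : Submodule ℝ (Chain X n) :=
  Finsupp.supported ℝ ℝ {σ : C(stdSimplex ℝ (Fin (n + 1)), X) | ∀ p, σ p ∈ A}

lemma single_mem_chainsOn {A : Set X} {n : ℕ} {σ : C(stdSimplex ℝ (Fin (n + 1)), X)}
    (h : ∀ p, σ p ∈ A) (r : ℝ) : Finsupp.single σ r ∈ chainsOn A n :=
  Finsupp.single_mem_supported ℝ r h

lemma chainsOn_mono {A B : Set X} (h : A ⊆ B) (n : ℕ) : chainsOn A n ≤ chainsOn B n :=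
  fun _ hc _ hσ p => h (hc hσ p)

@[simp] lemma chainsOn_univ (n : ℕ) : chainsOn (Set.univ : Set X) n = ⊤ :=
  eq_top_iff.mpr fun _ _ _ _ _ => Set.mem_univ _

lemma chainsOn_empty (n : ℕ) : chainsOn (∅ : Set X) n = ⊥ := by
  refine eq_bot_iff.mpr fun c hc => ?_
  rw [Submodule.mem_bot, ← Finsupp.support_eq_empty, Finset.eq_empty_iff_forall_notMem]
  -- The standard simplex is nonempty, so no singular simplex has its image in `∅`.
  exact fun σ hσ => hc hσ (Classical.arbitrary _)

/-- Holds because membership is a condition on each simplex of the support. Excision uses it to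
recognise chains of `U ∩ V`. -/
lemma mem_chainsOn_inter {A B : Set X} {n : ℕ} {c : Chain X n} (hA : c ∈ chainsOn A n)
    (hB : c ∈ chainsOn B n) : c ∈ chainsOn (A ∩ B) n :=
  fun _ hσ p => ⟨hA hσ p, hB hσ p⟩

/-- To prove a property of the chains of `A` it suffices to do so for the simplices in `A`. -/
lemma chainsOn_induction {A : Set X} {n : ℕ} {p : Chain X n → Prop} (h0 : p 0)
    (hadd : ∀ a b, p a → p b → p (a + b))
    (hs : ∀ σ : C(stdSimplex ℝ (Fin (n + 1)), X), (∀ q, σ q ∈ A) → ∀ r, p (Finsupp.single σ r))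
    {c : Chain X n} (hc : c ∈ chainsOn A n) : p c := by
  classical
  rw [← Finsupp.sum_single c, Finsupp.sum]
  exact Finset.sum_induction _ p hadd h0 fun σ hσ => hs σ (hc hσ) _

lemma bds_mem_chainsOn {A : Set X} {n : ℕ} {c : Chain X (n + 1)} (hc : c ∈ chainsOn A (n + 1)) :
    bds n c ∈ chainsOn A n := by
  refine chainsOn_induction (p := fun c => bds n c ∈ chainsOn A n) (by simp)
    (fun a b ha hb => by rw [map_add]; exact add_mem ha hb) (fun σ hσ r => ?_) hc
  · rw [bds_single]
    exact Submodule.smul_mem _ _ (Submodule.sum_mem _ fun i _ => Submodule.smul_mem _ _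
      (single_mem_chainsOn (fun p => hσ (face i p)) _))

lemma bd_mem_chainsOn {A : Set X} {n : ℕ} {c : Chain X n} (hc : c ∈ chainsOn A n) :
    bd n c ∈ chainsOn A (n - 1) := by
  cases n with
  | zero => simp
  | succ n => exact bds_mem_chainsOn hc

/-- The inclusion of a subset as a continuous map. -/
abbrev incl (A : Set X) : C(A, X) := ⟨Subtype.val, continuous_subtype_val⟩

lemma chainMap_mem_chainsOn (f : C(X, Y)) {A : Set X} {B : Set Y} (h : Set.MapsTo f A B) {n : ℕ}
    {c : Chain X n} (hc : c ∈ chainsOn A n) : chainMap f n c ∈ chainsOn B n := by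
  refine chainsOn_induction (p := fun c => chainMap f n c ∈ chainsOn B n) (by simp)
    (fun a b ha hb => by rw [map_add]; exact add_mem ha hb) (fun σ hσ r => ?_) hc
  · rw [chainMap_single]
    exact single_mem_chainsOn (fun p => h (hσ p)) _

lemma mem_chainsOn_iff_exists {A : Set X} {n : ℕ} {c : Chain X n} :
    c ∈ chainsOn A n ↔ ∃ a : Chain A n, chainMap (incl A) n a = c := by
  constructor
  · intro hc
    refine chainsOn_induction (p := fun c => ∃ a : Chain A n, chainMap (incl A) n a = c)
      ⟨0, map_zero _⟩ ?_ (fun σ hσ r => ?_) hc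
    · rintro _ _ ⟨a, rfl⟩ ⟨b, rfl⟩
      exact ⟨a + b, map_add _ _ _⟩
    · exact ⟨Finsupp.single ⟨fun p => ⟨σ p, hσ p⟩, by fun_prop⟩ r, by rw [chainMap_single]; rfl⟩
  · rintro ⟨a, rfl⟩
    exact chainMap_mem_chainsOn (A := Set.univ) _ (fun x _ => x.2) (by simp)

lemma mem_chainsIn_iff {A : Set X} {n : ℕ} {c : (singularChains X).X n} :
    c ∈ chainsIn A n ↔ chainEquiv X n c ∈ chainsOn A n := by
  rw [mem_chainsOn_iff_exists]
  constructor
  · rintro ⟨a, rfl⟩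
    exact ⟨chainEquiv A n a, (chainEquiv_singMap (incl A) n a).symm⟩
  · rintro ⟨a, ha⟩
    refine ⟨(chainEquiv A n).symm a, (chainEquiv X n).injective ?_⟩
    rw [← ha]
    refine (chainEquiv_singMap (incl A) n _).trans ?_
    rw [LinearEquiv.apply_symm_apply]

/-- The relative cycles of `(A, B)` in the concrete model. -/
def cycles (A B : Set X) (n : ℕ) : Submodule ℝ (Chain X n) :=
  chainsOn A n ⊓ (chainsOn B (n - 1)).comap (bd n)

/-- The relative boundaries of `(A, B)` in the concrete model. -/
def bounds (A B : Set X) (n : ℕ) : Submodule ℝ (Chain X n) :=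
  (chainsOn A (n + 1)).map (bds n) ⊔ chainsOn B n

lemma mem_cycles {A B : Set X} {n : ℕ} {c : Chain X n} :
    c ∈ cycles A B n ↔ c ∈ chainsOn A n ∧ bd n c ∈ chainsOn B (n - 1) := Iff.rfl

lemma mem_cycles_succ {A B : Set X} {n : ℕ} {c : Chain X (n + 1)} :
    c ∈ cycles A B (n + 1) ↔ c ∈ chainsOn A (n + 1) ∧ bds n c ∈ chainsOn B n := Iff.rfl

lemma mem_bounds {A B : Set X} {n : ℕ} {c : Chain X n} :
    c ∈ bounds A B n ↔ ∃ a ∈ chainsOn A (n + 1), ∃ b ∈ chainsOn B n, bds n a + b = c := by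
  simp [bounds, Submodule.mem_sup]

lemma mem_relCycles_iff {A B : Set X} {n : ℕ} {c : (singularChains X).X n} :
    c ∈ relCycles A B n ↔ chainEquiv X n c ∈ cycles A B n := by
  rw [mem_cycles, ← chainEquiv_bdry, ← mem_chainsIn_iff, ← mem_chainsIn_iff]
  rfl

lemma mem_relBoundaries_iff {A B : Set X} {n : ℕ} {c : (singularChains X).X n} :
    c ∈ relBoundaries A B n ↔ chainEquiv X n c ∈ bounds A B n := by
  rw [mem_bounds, relBoundaries, Submodule.mem_sup]
  constructor
  · rintro ⟨_, ⟨a, ha, rfl⟩, b, hb, rfl⟩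
    exact ⟨chainEquiv X (n + 1) a, mem_chainsIn_iff.mp ha, chainEquiv X n b,
      mem_chainsIn_iff.mp hb, by rw [map_add, chainEquiv_bdry_succ]⟩
  · rintro ⟨a, ha, b, hb, h⟩
    obtain ⟨a, rfl⟩ := (chainEquiv X (n + 1)).surjective a
    obtain ⟨b, rfl⟩ := (chainEquiv X n).surjective b
    refine ⟨_, ⟨a, mem_chainsIn_iff.mpr ha, rfl⟩, b, mem_chainsIn_iff.mpr hb,
      (chainEquiv X n).injective ?_⟩
    rw [← h, map_add, chainEquiv_bdry_succ]

end ConcreteChains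

/-! ## Barycentric subdivision -/

section VertexChains

variable {V : Type v} {W : Type w}

/-- Formal linear combinations of `m`-tuples of vertices. -/
abbrev VertexChain (V : Type v) (m : ℕ) : Type v := (Fin m → V) →₀ ℝ

/-- The (augmented) boundary map on vertex chains. -/
def vbd (m : ℕ) : VertexChain V (m + 1) →ₗ[ℝ] VertexChain V m :=
  Finsupp.linearCombination ℝ fun v =>
    ∑ i : Fin (m + 1), (-1 : ℝ) ^ (i : ℕ) • Finsupp.single (v ∘ i.succAbove) (1 : ℝ)

lemma vbd_single (m : ℕ) (v : Fin (m + 1) → V) (r : ℝ) : vbd m (Finsupp.single v r) =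
    r • ∑ i : Fin (m + 1), (-1 : ℝ) ^ (i : ℕ) • Finsupp.single (v ∘ i.succAbove) (1 : ℝ) := by
  simp [vbd]

/-- Joining an apex to a vertex chain. -/
def cone (b : V) (m : ℕ) : VertexChain V m →ₗ[ℝ] VertexChain V (m + 1) :=
  Finsupp.lmapDomain ℝ ℝ fun v => (Fin.cons b v : Fin (m + 1) → V)

lemma cone_single (b : V) (m : ℕ) (v : Fin m → V) (r : ℝ) :
    cone b m (Finsupp.single v r) = Finsupp.single (Fin.cons b v : Fin (m + 1) → V) r := by
  simp [cone]

lemma single_eq_cone {m : ℕ} (v : Fin (m + 1) → V) (r : ℝ) :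
    Finsupp.single v r = cone (v 0) m (Finsupp.single (Fin.tail v) r) := by
  rw [cone_single, Fin.cons_self_tail]

lemma vbd_cone_zero (b : V) (c : VertexChain V 0) : vbd 0 (cone b 0 c) = c := by
  induction c using Finsupp.induction_linear with
  | zero => simp
  | add x y hx hy => simp only [map_add, hx, hy]
  | single v r =>
    rw [cone_single, vbd_single]
    simp [Subsingleton.elim _ v]

/-- The face opposite the apex returns `c`. Every other face is a cone over a face of `c`, with
index shifted by one, hence the minus sign. -/
lemma vbd_cone_succ (b : V) (m : ℕ) (c : VertexChain V (m + 1)) :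
    vbd (m + 1) (cone b (m + 1) c) = c - cone b m (vbd m c) := by
  induction c using Finsupp.induction_linear with
  | zero => simp
  | add x y hx hy => simp only [map_add, hx, hy]; abel
  | single v r =>
    rw [cone_single, vbd_single, vbd_single, Fin.sum_univ_succ, smul_add, sub_eq_add_neg]
    congr 1
    · have : (Fin.cons b v : Fin (m + 2) → V) ∘ (Fin.succAbove 0) = v := by
        ext i; simp
      rw [this]
      simp
    · rw [map_smul, map_sum, ← smul_neg, ← Finset.sum_neg_distrib]
      congr 1
      refine Finset.sum_congr rfl fun i _ => ?_
      have : (Fin.cons b v : Fin (m + 2) → V) ∘ i.succ.succAbove =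
          Fin.cons b (v ∘ i.succAbove) := by
        ext j
        refine Fin.cases ?_ (fun j => ?_) j <;> simp
      rw [this, map_smul, cone_single, Fin.val_succ, pow_succ]
      simp

/-- Every tuple is the cone from its head over its tail, so the cone formula gives the induction. -/
lemma vbd_vbd (m : ℕ) (c : VertexChain V (m + 2)) : vbd m (vbd (m + 1) c) = 0 := by
  induction m with
  | zero =>
    induction c using Finsupp.induction_linear with
    | zero => simp
    | add x y hx hy => simp only [map_add, hx, hy, add_zero]
    | single v r => rw [single_eq_cone, vbd_cone_succ, map_sub, vbd_cone_zero, sub_self]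
  | succ m ih =>
    induction c using Finsupp.induction_linear with
    | zero => simp
    | add x y hx hy => simp only [map_add, hx, hy, add_zero]
    | single v r =>
      rw [single_eq_cone, vbd_cone_succ, map_sub, vbd_cone_succ, ih, map_zero, sub_zero, sub_self]

variable (β : ∀ m, (Fin (m + 1) → V) → V) (β' : ∀ m, (Fin (m + 1) → W) → W)

/-- Subdivision of vertex chains, with respect to a choice `β` of barycenters. -/
def vsd : (m : ℕ) → VertexChain V m →ₗ[ℝ] VertexChain V m
  | 0 => LinearMap.id
  | m + 1 => Finsupp.linearCombination ℝ fun v =>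
      cone (β m v) m (vsd m (vbd m (Finsupp.single v 1)))

/-- The chain homotopy between the identity and the subdivision of vertex chains. -/
def vsdHomotopy : (m : ℕ) → VertexChain V m →ₗ[ℝ] VertexChain V (m + 1)
  | 0 => 0
  | m + 1 => Finsupp.linearCombination ℝ fun v =>
      cone (β m v) (m + 1) (Finsupp.single v 1 - vsdHomotopy m (vbd m (Finsupp.single v 1)))

lemma vsd_single (m : ℕ) (v : Fin (m + 1) → V) : vsd β (m + 1) (Finsupp.single v 1) =
    cone (β m v) m (vsd β m (vbd m (Finsupp.single v 1))) := by
  simp [vsd]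

lemma vsdHomotopy_single (m : ℕ) (v : Fin (m + 1) → V) :
    vsdHomotopy β (m + 1) (Finsupp.single v 1) =
      cone (β m v) (m + 1)
        (Finsupp.single v 1 - vsdHomotopy β m (vbd m (Finsupp.single v 1))) := by
  simp [vsdHomotopy]

/-- With barycenter `b`, `∂(b * sd ∂v) = sd ∂v - b * ∂ sd ∂v`, and by induction `∂ sd ∂v = sd ∂∂v =
0`. -/
lemma vbd_vsd (m : ℕ) (c : VertexChain V (m + 1)) :
    vbd m (vsd β (m + 1) c) = vsd β m (vbd m c) := by
  suffices h : vbd m ∘ₗ vsd β (m + 1) = vsd β m ∘ₗ vbd m from congrArg (fun f => f c) h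
  clear c
  induction m with
  | zero =>
    refine Finsupp.lhom_ext' fun v => LinearMap.ext_ring ?_
    simp only [LinearMap.comp_apply, Finsupp.lsingle_apply]
    rw [vsd_single, vbd_cone_zero]
  | succ m ih =>
    refine Finsupp.lhom_ext' fun v => LinearMap.ext_ring ?_
    simp only [LinearMap.comp_apply, Finsupp.lsingle_apply]
    have h := congrArg (fun f => f (vbd (m + 1) (Finsupp.single v 1))) ih
    simp only [LinearMap.comp_apply, vbd_vbd, map_zero] at h
    rw [vsd_single, vbd_cone_succ, h, map_zero, sub_zero]

/-- Writing `T` for the homotopy, `∂(b * (v - T∂v)) = v - T∂v - b * (∂v - ∂T∂v)`. By induction `∂v -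
∂T∂v = sd ∂v`, and `b * sd ∂v = sd v`. -/
lemma vbd_vsdHomotopy (m : ℕ) (c : VertexChain V (m + 1)) :
    vbd (m + 1) (vsdHomotopy β (m + 1) c) =
      c - vsd β (m + 1) c - vsdHomotopy β m (vbd m c) := by
  suffices h : vbd (m + 1) ∘ₗ vsdHomotopy β (m + 1) =
      LinearMap.id - vsd β (m + 1) - vsdHomotopy β m ∘ₗ vbd m from congrArg (fun f => f c) h
  clear c
  induction m with
  | zero =>
    refine Finsupp.lhom_ext' fun v => LinearMap.ext_ring ?_
    simp only [LinearMap.comp_apply, Finsupp.lsingle_apply, LinearMap.sub_apply,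
      LinearMap.id_apply]
    rw [vsdHomotopy_single, vbd_cone_succ, vsd_single]
    simp [vsdHomotopy, vsd]
  | succ m ih =>
    refine Finsupp.lhom_ext' fun v => LinearMap.ext_ring ?_
    simp only [LinearMap.comp_apply, Finsupp.lsingle_apply, LinearMap.sub_apply,
      LinearMap.id_apply]
    have h := congrArg (fun f => f (vbd (m + 1) (Finsupp.single v 1))) ih
    simp only [LinearMap.comp_apply, LinearMap.sub_apply, LinearMap.id_apply, vbd_vbd,
      map_zero, sub_zero] at h
    rw [vsdHomotopy_single, vbd_cone_succ, vsd_single, map_sub, h]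
    simp only [sub_sub_cancel]
    abel

/-- The map on vertex chains induced by a map of vertices. -/
def vmap (φ : V → W) (m : ℕ) : VertexChain V m →ₗ[ℝ] VertexChain W m :=
  Finsupp.lmapDomain ℝ ℝ (φ ∘ ·)

@[simp] lemma vmap_single (φ : V → W) (m : ℕ) (v : Fin m → V) (r : ℝ) :
    vmap φ m (Finsupp.single v r) = Finsupp.single (φ ∘ v) r := by
  simp [vmap]

lemma vmap_vbd (φ : V → W) (m : ℕ) (c : VertexChain V (m + 1)) :
    vmap φ m (vbd m c) = vbd m (vmap φ (m + 1) c) := by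
  induction c using Finsupp.induction_linear with
  | zero => simp
  | add x y hx hy => simp only [map_add, hx, hy]
  | single v r =>
    rw [vbd_single, vmap_single, vbd_single]
    simp only [map_smul, map_sum, vmap_single, Function.comp_assoc]

lemma vmap_cone (φ : V → W) (b : V) (m : ℕ) (c : VertexChain V m) :
    vmap φ (m + 1) (cone b m c) = cone (φ b) m (vmap φ m c) := by
  induction c using Finsupp.induction_linear with
  | zero => simp
  | add x y hx hy => simp only [map_add, hx, hy]
  | single v r =>
    rw [cone_single, vmap_single, vmap_single, cone_single]
    congr 1
    ext i
    refine Fin.cases ?_ (fun j => ?_) i <;> simp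

variable {β β'}

/-- Subdivision uses only faces, cones and barycenters, so it commutes with every vertex map
respecting barycenters. Affine maps do, and this makes subdivision of singular simplices natural. -/
lemma vmap_vsd {φ : V → W} (h : ∀ m v, φ (β m v) = β' m (φ ∘ v)) (m : ℕ)
    (c : VertexChain V m) : vmap φ m (vsd β m c) = vsd β' m (vmap φ m c) := by
  induction m with
  | zero => rfl
  | succ m ih =>
    suffices h : vmap φ (m + 1) ∘ₗ vsd β (m + 1) = vsd β' (m + 1) ∘ₗ vmap φ (m + 1) from
      congrArg (fun f => f c) h
    refine Finsupp.lhom_ext' fun v => LinearMap.ext_ring ?_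
    simp only [LinearMap.comp_apply, Finsupp.lsingle_apply]
    rw [vsd_single, vmap_single, vsd_single, vmap_cone, ih, vmap_vbd, h, vmap_single]

lemma vmap_vsdHomotopy {φ : V → W} (h : ∀ m v, φ (β m v) = β' m (φ ∘ v)) (m : ℕ)
    (c : VertexChain V m) :
    vmap φ (m + 1) (vsdHomotopy β m c) = vsdHomotopy β' m (vmap φ m c) := by
  induction m with
  | zero => simp [vsdHomotopy]
  | succ m ih =>
    suffices h : vmap φ (m + 2) ∘ₗ vsdHomotopy β (m + 1) =
        vsdHomotopy β' (m + 1) ∘ₗ vmap φ (m + 1) from congrArg (fun f => f c) h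
    refine Finsupp.lhom_ext' fun v => LinearMap.ext_ring ?_
    simp only [LinearMap.comp_apply, Finsupp.lsingle_apply]
    rw [vsdHomotopy_single, vmap_single, vsdHomotopy_single, vmap_cone, map_sub, ih, vmap_vbd, h,
      vmap_single]

/-- The tuples of vertices whose mutual distances are at most `δ`. -/
def smallTuples (V : Type v) [PseudoMetricSpace V] (m : ℕ) (δ : ℝ) : Set (Fin m → V) :=
  {v | ∀ i j, dist (v i) (v j) ≤ δ}

variable [PseudoMetricSpace V]

/-- Two properties must be carried through the induction together: the new vertices stay in each
closed ball containing the old ones, and mutual distances shrink. The first bounds the distance from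
the new apex to the vertices of the subdivided faces. A tuple of `m` points spans dimension `m - 1`,
whence the factor `(m - 1) / m`. -/
lemma vsd_single_mem
    (h1 : ∀ m (v : Fin (m + 1) → V) p r, (∀ j, dist p (v j) ≤ r) → dist p (β m v) ≤ r)
    (h2 : ∀ m (v : Fin (m + 1) → V) δ, v ∈ smallTuples V (m + 1) δ →
      ∀ j, dist (β m v) (v j) ≤ (m / (m + 1) : ℝ) * δ) (m : ℕ) (v : Fin m → V) :
    vsd β m (Finsupp.single v 1) ∈ Finsupp.supported ℝ ℝ {w : Fin m → V |
      (∀ p r, (∀ j, dist p (v j) ≤ r) → ∀ i, dist p (w i) ≤ r) ∧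
      ∀ δ, v ∈ smallTuples V m δ → w ∈ smallTuples V m (((m - 1 : ℝ) / m) * δ)} := by
  induction m with
  | zero =>
    refine Finsupp.single_mem_supported ℝ _ ⟨fun p r _ i => i.elim0, fun δ _ i => i.elim0⟩
  | succ m ih =>
    rw [vsd_single, vbd_single, one_smul]
    simp only [map_sum, map_smul]
    refine Submodule.sum_mem _ fun i _ => Submodule.smul_mem _ _ ?_
    have hi := ih (v ∘ i.succAbove)
    generalize vsd β m (Finsupp.single (v ∘ i.succAbove) 1) = c at hi
    have hle : Finsupp.supported ℝ ℝ {w : Fin m → V |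
      (∀ p r, (∀ j, dist p ((v ∘ i.succAbove) j) ≤ r) → ∀ i, dist p (w i) ≤ r) ∧
      ∀ δ, v ∘ i.succAbove ∈ smallTuples V m δ → w ∈ smallTuples V m (((m - 1 : ℝ) / m) * δ)} ≤
      (Finsupp.supported ℝ ℝ {w : Fin (m + 1) → V |
      (∀ p r, (∀ j, dist p (v j) ≤ r) → ∀ i, dist p (w i) ≤ r) ∧
      ∀ δ, v ∈ smallTuples V (m + 1) δ → w ∈ smallTuples V (m + 1)
        ((((m + 1 : ℕ) - 1 : ℝ) / (m + 1 : ℕ)) * δ)}).comap (cone (β m v) m) := by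
      rw [Finsupp.supported_eq_span_single, Submodule.span_le]
      rintro _ ⟨w, ⟨hw1, hw2⟩, rfl⟩
      rw [SetLike.mem_coe, Submodule.mem_comap, cone_single]
      refine Finsupp.single_mem_supported ℝ _ ⟨fun p r hp => ?_, fun δ hδ => ?_⟩
      · refine Fin.cases ?_ fun j => ?_
        · simpa using h1 m v p r hp
        · simpa using hw1 p r (fun j => hp _) j
      · have hb : ∀ j, dist (β m v) (w j) ≤ (m / (m + 1) : ℝ) * δ :=
          fun j => hw1 _ _ (fun k => h2 m v δ hδ _) j
        have hδ0 : 0 ≤ δ := dist_nonneg.trans (hδ i i)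
        have hm : ((m + 1 : ℕ) - 1 : ℝ) / (m + 1 : ℕ) = m / (m + 1) := by push_cast; ring
        rw [hm]
        refine Fin.cases (Fin.cases ?_ fun j => ?_) fun j => Fin.cases ?_ fun k => ?_
        · simpa using by positivity
        · simpa using hb j
        · simpa [dist_comm] using hb j
        · simp only [Fin.cons_succ]
          -- The factor `(m - 1) / m` coming from a face is at most `m / (m + 1)`.
          refine (hw2 δ (fun a b => hδ _ _) j k).trans (mul_le_mul_of_nonneg_right ?_ hδ0)
          have hm0 : (0 : ℝ) < m := by exact_mod_cast j.pos
          rw [div_le_div_iff₀ hm0 (by positivity)]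
          nlinarith
    exact hle hi

lemma vsd_mem_small
    (h1 : ∀ m (v : Fin (m + 1) → V) p r, (∀ j, dist p (v j) ≤ r) → dist p (β m v) ≤ r)
    (h2 : ∀ m (v : Fin (m + 1) → V) δ, v ∈ smallTuples V (m + 1) δ →
      ∀ j, dist (β m v) (v j) ≤ (m / (m + 1) : ℝ) * δ) (m : ℕ) (δ : ℝ) {c : VertexChain V m}
    (hc : c ∈ Finsupp.supported ℝ ℝ (smallTuples V m δ)) :
    vsd β m c ∈ Finsupp.supported ℝ ℝ (smallTuples V m (((m - 1 : ℝ) / m) * δ)) := by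
  have hle : Finsupp.supported ℝ ℝ (smallTuples V m δ) ≤ (Finsupp.supported ℝ ℝ
      (smallTuples V m (((m - 1 : ℝ) / m) * δ))).comap (vsd β m) := by
    rw [Finsupp.supported_eq_span_single, Submodule.span_le]
    rintro _ ⟨v, hv, rfl⟩
    exact Finsupp.supported_mono (fun w hw => hw.2 δ hv) (vsd_single_mem h1 h2 m v)
  exact hle hc

lemma vsd_iterate_mem_small
    (h1 : ∀ m (v : Fin (m + 1) → V) p r, (∀ j, dist p (v j) ≤ r) → dist p (β m v) ≤ r)
    (h2 : ∀ m (v : Fin (m + 1) → V) δ, v ∈ smallTuples V (m + 1) δ →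
      ∀ j, dist (β m v) (v j) ≤ (m / (m + 1) : ℝ) * δ) (m : ℕ) (δ : ℝ) {c : VertexChain V m}
    (hc : c ∈ Finsupp.supported ℝ ℝ (smallTuples V m δ)) (N : ℕ) :
    (vsd β m)^[N] c ∈ Finsupp.supported ℝ ℝ (smallTuples V m (((m - 1 : ℝ) / m) ^ N * δ)) := by
  induction N with
  | zero => simpa using hc
  | succ N ih =>
    rw [Function.iterate_succ_apply', pow_succ', mul_assoc]
    exact vsd_mem_small h1 h2 m _ ih

end VertexChains


/-! ### Subdivision of singular chains and chains subordinate to a cover by two sets. -/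

section Subdivision

variable {k n : ℕ}

/-- The barycenter of a tuple of points of a standard simplex. -/
def bary (k m : ℕ) (v : Fin (m + 1) → stdSimplex ℝ (Fin (k + 1))) :
    stdSimplex ℝ (Fin (k + 1)) :=
  ⟨∑ i, ((m : ℝ) + 1)⁻¹ • (v i : Fin (k + 1) → ℝ),
    (convex_stdSimplex ℝ _).sum_mem (fun _ _ => by positivity)
      (by simp [Finset.sum_const]; field_simp) fun i _ => (v i).2⟩

lemma dist_bary_le (k m : ℕ) (v : Fin (m + 1) → stdSimplex ℝ (Fin (k + 1)))
    (p : stdSimplex ℝ (Fin (k + 1))) (r : ℝ) (h : ∀ j, dist p (v j) ≤ r) :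
    dist p (bary k m v) ≤ r := by
  have := (convex_closedBall (p : Fin (k + 1) → ℝ) r).sum_mem (t := Finset.univ)
    (w := fun _ : Fin (m + 1) => ((m : ℝ) + 1)⁻¹) (z := fun i => (v i : Fin (k + 1) → ℝ))
    (fun _ _ => by positivity) (by simp [Finset.sum_const]; field_simp)
    (fun i _ => by rw [Metric.mem_closedBall, dist_comm]; exact h i)
  rw [Metric.mem_closedBall, dist_comm] at this
  exact this

/-- The difference is the average of the `m + 1` vectors `v i - v j`. The one with `i = j` vanishes,
leaving `m` vectors of norm at most `δ`. -/
lemma dist_bary_vertex_le (k m : ℕ) (v : Fin (m + 1) → stdSimplex ℝ (Fin (k + 1))) (δ : ℝ)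
    (h : v ∈ smallTuples _ (m + 1) δ) (j : Fin (m + 1)) :
    dist (bary k m v) (v j) ≤ (m / (m + 1) : ℝ) * δ := by
  have h1 : ((bary k m v : Fin (k + 1) → ℝ) - v j) =
      ∑ i ∈ Finset.univ.erase j, ((m : ℝ) + 1)⁻¹ • ((v i : Fin (k + 1) → ℝ) - v j) := by
    rw [Finset.sum_erase _ (by simp)]
    simp only [smul_sub, Finset.sum_sub_distrib]
    rw [Finset.sum_const, ← Nat.cast_smul_eq_nsmul ℝ, smul_smul]
    simp only [Finset.card_univ, Fintype.card_fin]
    push_cast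
    rw [mul_inv_cancel₀ (by positivity), one_smul]
    rfl
  change dist (bary k m v : Fin (k + 1) → ℝ) (v j) ≤ _
  rw [dist_eq_norm, h1]
  refine (norm_sum_le _ _).trans ?_
  have h2 : ∀ i ∈ Finset.univ.erase j,
      ‖((m : ℝ) + 1)⁻¹ • ((v i : Fin (k + 1) → ℝ) - v j)‖ ≤ ((m : ℝ) + 1)⁻¹ * δ := by
    intro i _
    rw [norm_smul, Real.norm_of_nonneg (by positivity), ← dist_eq_norm]
    exact mul_le_mul_of_nonneg_left (h i j) (by positivity)
  refine (Finset.sum_le_sum h2).trans_eq ?_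
  rw [Finset.sum_const, Finset.card_erase_of_mem (Finset.mem_univ j)]
  simp
  ring

/-- The affine map of standard simplices with given values on the vertices. -/
def aff (v : Fin (n + 1) → stdSimplex ℝ (Fin (k + 1))) :
    C(stdSimplex ℝ (Fin (n + 1)), stdSimplex ℝ (Fin (k + 1))) :=
  ⟨fun t => ⟨∑ i, (t : Fin (n + 1) → ℝ) i • (v i : Fin (k + 1) → ℝ),
    (convex_stdSimplex ℝ _).sum_mem (fun i _ => t.2.1 i) t.2.2 fun i _ => (v i).2⟩,
    Continuous.subtype_mk (continuous_finsetSum _ fun i _ =>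
      (((continuous_apply i).comp continuous_subtype_val).smul continuous_const)) _⟩

lemma aff_coe (v : Fin (n + 1) → stdSimplex ℝ (Fin (k + 1))) (t) :
    (aff v t : Fin (k + 1) → ℝ) = ∑ i, (t : Fin (n + 1) → ℝ) i • (v i : Fin (k + 1) → ℝ) := rfl

lemma aff_apply (v : Fin (n + 1) → stdSimplex ℝ (Fin (k + 1))) (t) (i : Fin (k + 1)) :
    aff v t i = ∑ j, t j * v j i := by
  rw [aff_coe]
  simp only [Finset.sum_apply, Pi.smul_apply, smul_eq_mul]

lemma bary_apply (k m : ℕ) (v : Fin (m + 1) → stdSimplex ℝ (Fin (k + 1))) (i : Fin (k + 1)) :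
    bary k m v i = ∑ j, ((m : ℝ) + 1)⁻¹ * v j i := by
  change (∑ j, ((m : ℝ) + 1)⁻¹ • (v j : Fin (k + 1) → ℝ)) i = _
  simp only [Finset.sum_apply, Pi.smul_apply, smul_eq_mul]

/-- The vertices of the standard simplex. -/
def vertices (n : ℕ) : Fin (n + 1) → stdSimplex ℝ (Fin (n + 1)) := stdSimplex.vertex

lemma aff_vertices : aff (vertices n) = ContinuousMap.id _ := by
  ext t i
  simp [aff_apply, vertices, Pi.single_apply]

lemma aff_comp_aff {l : ℕ} (w : Fin (k + 1) → stdSimplex ℝ (Fin (l + 1)))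
    (v : Fin (n + 1) → stdSimplex ℝ (Fin (k + 1))) : (aff w).comp (aff v) = aff (aff w ∘ v) := by
  ext t i
  simp only [ContinuousMap.comp_apply, aff_apply, Function.comp_apply, Finset.sum_mul,
    Finset.mul_sum]
  rw [Finset.sum_comm]
  simp only [mul_assoc]

lemma aff_vertex (v : Fin (n + 1) → stdSimplex ℝ (Fin (k + 1))) :
    aff v ∘ vertices n = v := by
  ext j i
  simp [aff_apply, vertices, Pi.single_apply]

lemma aff_bary {l : ℕ} (w : Fin (k + 1) → stdSimplex ℝ (Fin (l + 1))) (m : ℕ)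
    (v : Fin (m + 1) → stdSimplex ℝ (Fin (k + 1))) :
    aff w (bary k m v) = bary l m (aff w ∘ v) := by
  ext i
  simp only [aff_apply, bary_apply, Function.comp_apply, Finset.sum_mul, Finset.mul_sum]
  rw [Finset.sum_comm]
  simp only [mul_assoc]

lemma face_eq_aff (i : Fin (n + 2)) : face i = aff (vertices (n + 1) ∘ i.succAbove) := by
  ext t j
  simp only [face, ContinuousMap.coe_mk, stdSimplex.map_coe, aff_coe, vertices,
    Function.comp_apply, Finset.sum_apply, Pi.smul_apply, smul_eq_mul, stdSimplex.vertex_coe,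
    FunOnFinite.linearMap_apply_apply, Pi.single_apply, mul_ite, mul_one, mul_zero]
  rw [Finset.sum_filter]
  simp only [eq_comm]

variable {X : Type u} [TopologicalSpace X]

/-- The singular chain given by a vertex chain in the domain of a singular simplex. -/
def realize (σ : C(stdSimplex ℝ (Fin (k + 1)), X)) (n : ℕ) :
    VertexChain (stdSimplex ℝ (Fin (k + 1))) (n + 1) →ₗ[ℝ] Chain X n :=
  Finsupp.lmapDomain ℝ ℝ fun v => σ.comp (aff v)

@[simp] lemma realize_single (σ : C(stdSimplex ℝ (Fin (k + 1)), X))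
    (v : Fin (n + 1) → stdSimplex ℝ (Fin (k + 1))) (r : ℝ) :
    realize σ n (Finsupp.single v r) = Finsupp.single (σ.comp (aff v)) r := by
  simp [realize]

lemma realize_vertices (σ : C(stdSimplex ℝ (Fin (n + 1)), X)) (r : ℝ) :
    realize σ n (Finsupp.single (vertices n) r) = Finsupp.single σ r := by
  rw [realize_single, aff_vertices, ContinuousMap.comp_id]

/-- A tuple of `n + 1` points is an `n`-simplex, so `realize` shifts the degree by one and forgets
the augmentation. -/
lemma bds_realize (σ : C(stdSimplex ℝ (Fin (k + 1)), X))
    (c : VertexChain (stdSimplex ℝ (Fin (k + 1))) (n + 2)) :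
    bds n (realize σ (n + 1) c) = realize σ n (vbd (n + 1) c) := by
  induction c using Finsupp.induction_linear with
  | zero => simp
  | add x y hx hy => simp only [map_add, hx, hy]
  | single v r =>
    rw [realize_single, bds_single, vbd_single]
    simp only [map_smul, map_sum, realize_single, ContinuousMap.comp_assoc]
    simp only [face_eq_aff, aff_comp_aff, ← Function.comp_assoc, aff_vertex]

lemma realize_mem_chainsOn {A : Set X} {σ : C(stdSimplex ℝ (Fin (k + 1)), X)} (h : ∀ p, σ p ∈ A)
    (c : VertexChain (stdSimplex ℝ (Fin (k + 1))) (n + 1)) : realize σ n c ∈ chainsOn A n := by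
  induction c using Finsupp.induction_linear with
  | zero => simp
  | add x y hx hy => rw [map_add]; exact add_mem hx hy
  | single v r => rw [realize_single]; exact single_mem_chainsOn (fun p => h (aff v p)) _

lemma realize_comp_aff (σ : C(stdSimplex ℝ (Fin (k + 1)), X)) {l : ℕ}
    (w : Fin (l + 1) → stdSimplex ℝ (Fin (k + 1)))
    (c : VertexChain (stdSimplex ℝ (Fin (l + 1))) (n + 1)) :
    realize (σ.comp (aff w)) n c = realize σ n (vmap (aff w) (n + 1) c) := by
  induction c using Finsupp.induction_linear with
  | zero => simp
  | add x y hx hy => simp only [map_add, hx, hy]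
  | single v r =>
    rw [realize_single, vmap_single, realize_single, ContinuousMap.comp_assoc, aff_comp_aff]

/-- Barycentric subdivision of singular chains. -/
def sd (n : ℕ) : Chain X n →ₗ[ℝ] Chain X n :=
  Finsupp.linearCombination ℝ fun σ =>
    realize σ n (vsd (bary n) (n + 1) (Finsupp.single (vertices n) 1))

/-- The chain homotopy between the identity and the barycentric subdivision. -/
def sdHomotopy (n : ℕ) : Chain X n →ₗ[ℝ] Chain X (n + 1) :=
  Finsupp.linearCombination ℝ fun σ =>
    realize σ (n + 1) (vsdHomotopy (bary n) (n + 1) (Finsupp.single (vertices n) 1))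

lemma sd_single (σ : C(stdSimplex ℝ (Fin (n + 1)), X)) :
    sd n (Finsupp.single σ 1) =
      realize σ n (vsd (bary n) (n + 1) (Finsupp.single (vertices n) 1)) := by
  simp [sd]

lemma sdHomotopy_single (σ : C(stdSimplex ℝ (Fin (n + 1)), X)) :
    sdHomotopy n (Finsupp.single σ 1) =
      realize σ (n + 1) (vsdHomotopy (bary n) (n + 1) (Finsupp.single (vertices n) 1)) := by
  simp [sdHomotopy]

/-- Affine maps preserve barycenters, so subdividing the simplex `σ ∘ aff v` amounts to subdividing
the tuple `v` in the domain of `σ`. Iterated subdivision thereby becomes a computation with points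
of one standard simplex. -/
lemma sd_realize (σ : C(stdSimplex ℝ (Fin (k + 1)), X))
    (c : VertexChain (stdSimplex ℝ (Fin (k + 1))) (n + 1)) :
    sd n (realize σ n c) = realize σ n (vsd (bary k) (n + 1) c) := by
  suffices h : sd n ∘ₗ realize σ n = realize σ n ∘ₗ vsd (bary k) (n + 1) from
    congrArg (fun f => f c) h
  refine Finsupp.lhom_ext' fun v => LinearMap.ext_ring ?_
  simp only [LinearMap.comp_apply, Finsupp.lsingle_apply]
  rw [realize_single, sd_single, realize_comp_aff, vmap_vsd (aff_bary v), vmap_single, aff_vertex]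

lemma sdHomotopy_realize (σ : C(stdSimplex ℝ (Fin (k + 1)), X))
    (c : VertexChain (stdSimplex ℝ (Fin (k + 1))) (n + 1)) :
    sdHomotopy n (realize σ n c) = realize σ (n + 1) (vsdHomotopy (bary k) (n + 1) c) := by
  suffices h : sdHomotopy n ∘ₗ realize σ n = realize σ (n + 1) ∘ₗ vsdHomotopy (bary k) (n + 1) from
    congrArg (fun f => f c) h
  refine Finsupp.lhom_ext' fun v => LinearMap.ext_ring ?_
  simp only [LinearMap.comp_apply, Finsupp.lsingle_apply]
  rw [realize_single, sdHomotopy_single, realize_comp_aff, vmap_vsdHomotopy (aff_bary v),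
    vmap_single, aff_vertex]

/-- A singular simplex is `realize` of the tuple of vertices of its domain, so the identity for
vertex chains transfers. -/
lemma bds_sd (c : Chain X (n + 1)) : bds n (sd (n + 1) c) = sd n (bds n c) := by
  suffices h : bds n ∘ₗ sd (n + 1) = (sd n ∘ₗ bds n : Chain X (n + 1) →ₗ[ℝ] Chain X n) from
    congrArg (fun f => f c) h
  refine Finsupp.lhom_ext' fun σ => LinearMap.ext_ring ?_
  simp only [LinearMap.comp_apply, Finsupp.lsingle_apply]
  rw [sd_single, bds_realize, vbd_vsd, ← sd_realize, ← bds_realize, realize_vertices]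

lemma bds_sdHomotopy (c : Chain X (n + 1)) :
    bds (n + 1) (sdHomotopy (n + 1) c) = c - sd (n + 1) c - sdHomotopy n (bds n c) := by
  suffices h : bds (n + 1) ∘ₗ sdHomotopy (n + 1) = (LinearMap.id - sd (n + 1) -
      sdHomotopy n ∘ₗ bds n : Chain X (n + 1) →ₗ[ℝ] Chain X (n + 1)) from
    congrArg (fun f => f c) h
  refine Finsupp.lhom_ext' fun σ => LinearMap.ext_ring ?_
  simp only [LinearMap.comp_apply, Finsupp.lsingle_apply, LinearMap.sub_apply, LinearMap.id_apply]
  rw [sdHomotopy_single, bds_realize, vbd_vsdHomotopy, map_sub, map_sub, realize_vertices,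
    ← sd_single, ← sdHomotopy_realize, ← bds_realize, realize_vertices]

lemma bds_sdHomotopy_zero (c : Chain X 0) : bds 0 (sdHomotopy 0 c) = c - sd 0 c := by
  suffices h : bds 0 ∘ₗ sdHomotopy 0 = (LinearMap.id - sd 0 : Chain X 0 →ₗ[ℝ] Chain X 0) from
    congrArg (fun f => f c) h
  refine Finsupp.lhom_ext' fun σ => LinearMap.ext_ring ?_
  simp only [LinearMap.comp_apply, Finsupp.lsingle_apply, LinearMap.sub_apply, LinearMap.id_apply]
  rw [sdHomotopy_single, bds_realize, vbd_vsdHomotopy, map_sub, map_sub, realize_vertices,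
    ← sd_single]
  simp [vsdHomotopy]

lemma sd_mem_chainsOn {A : Set X} {c : Chain X n} (hc : c ∈ chainsOn A n) :
    sd n c ∈ chainsOn A n := by
  refine chainsOn_induction (p := fun c => sd n c ∈ chainsOn A n) (by simp)
    (fun a b ha hb => by rw [map_add]; exact add_mem ha hb) (fun σ hσ r => ?_) hc
  rw [← mul_one r, ← smul_eq_mul, ← Finsupp.smul_single, map_smul, sd_single]
  exact Submodule.smul_mem _ _ (realize_mem_chainsOn hσ _)

lemma sdHomotopy_mem_chainsOn {A : Set X} {c : Chain X n} (hc : c ∈ chainsOn A n) :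
    sdHomotopy n c ∈ chainsOn A (n + 1) := by
  refine chainsOn_induction (p := fun c => sdHomotopy n c ∈ chainsOn A (n + 1)) (by simp)
    (fun a b ha hb => by rw [map_add]; exact add_mem ha hb) (fun σ hσ r => ?_) hc
  rw [← mul_one r, ← smul_eq_mul, ← Finsupp.smul_single, map_smul, sdHomotopy_single]
  exact Submodule.smul_mem _ _ (realize_mem_chainsOn hσ _)

/-- The sum of the chains of `U` and the chains of `V`. -/
def smallChains (U V : Set X) (n : ℕ) : Submodule ℝ (Chain X n) := chainsOn U n ⊔ chainsOn V n

variable {U V : Set X}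

lemma sd_mem_smallChains {c : Chain X n} (hc : c ∈ smallChains U V n) :
    sd n c ∈ smallChains U V n := by
  obtain ⟨a, ha, b, hb, rfl⟩ := Submodule.mem_sup.mp hc
  rw [map_add]
  exact Submodule.add_mem_sup (sd_mem_chainsOn ha) (sd_mem_chainsOn hb)

lemma sdHomotopy_mem_smallChains {c : Chain X n} (hc : c ∈ smallChains U V n) :
    sdHomotopy n c ∈ smallChains U V (n + 1) := by
  obtain ⟨a, ha, b, hb, rfl⟩ := Submodule.mem_sup.mp hc
  rw [map_add]
  exact Submodule.add_mem_sup (sdHomotopy_mem_chainsOn ha) (sdHomotopy_mem_chainsOn hb)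

lemma sd_iterate_mem_smallChains {c : Chain X n} (hc : c ∈ smallChains U V n) (N : ℕ) :
    (sd n)^[N] c ∈ smallChains U V n := by
  induction N with
  | zero => exact hc
  | succ N ih => rw [Function.iterate_succ_apply']; exact sd_mem_smallChains ih

lemma sd_iterate_realize (σ : C(stdSimplex ℝ (Fin (k + 1)), X)) (N : ℕ)
    (c : VertexChain (stdSimplex ℝ (Fin (k + 1))) (n + 1)) :
    (sd n)^[N] (realize σ n c) = realize σ n ((vsd (bary k) (n + 1))^[N] c) := by
  induction N with
  | zero => rfl
  | succ N ih => rw [Function.iterate_succ_apply', ih, sd_realize, Function.iterate_succ_apply']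

lemma dist_aff_le {v : Fin (n + 1) → stdSimplex ℝ (Fin (k + 1))} {δ : ℝ}
    (hv : v ∈ smallTuples _ (n + 1) δ) (t) : dist (aff v t) (v 0) ≤ δ := by
  have := (convex_closedBall (v 0 : Fin (k + 1) → ℝ) δ).sum_mem (t := Finset.univ)
    (w := (t : Fin (n + 1) → ℝ)) (z := fun i => (v i : Fin (k + 1) → ℝ))
    (fun i _ => t.2.1 i) t.2.2 (fun i _ => hv i 0)
  exact this

/-- The equations say that `U` and `V` are open relative to `U ∪ V`, which need not be open in `X`;
`nonempty_equiv_attach` needs this generality. The preimages of `O` and `P` cover the simplex, and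
the mesh `(n / (n + 1)) ^ N * D` falls below a Lebesgue number of this cover. -/
lemma exists_sd_iterate_single_mem {O P : Set X} (hO : IsOpen O) (hP : IsOpen P)
    (hU : U = O ∩ (U ∪ V)) (hV : V = P ∩ (U ∪ V)) (σ : C(stdSimplex ℝ (Fin (n + 1)), X))
    (hσ : ∀ p, σ p ∈ U ∪ V) : ∃ N, (sd n)^[N] (Finsupp.single σ 1) ∈ smallChains U V n := by
  obtain ⟨δ, hδ, h⟩ := lebesgue_number_lemma_of_metric (s := Set.univ)
    (c := fun b : Bool => if b then σ ⁻¹' O else σ ⁻¹' P) isCompact_univ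
    (by rintro (_ | _); exacts [hP.preimage σ.continuous, hO.preimage σ.continuous])
    (by
      intro p _
      rcases hσ p with h | h
      · rw [hU] at h
        exact Set.mem_iUnion.mpr ⟨true, h.1⟩
      · rw [hV] at h
        exact Set.mem_iUnion.mpr ⟨false, h.1⟩)
  obtain ⟨D, hD⟩ : ∃ D, vertices n ∈ smallTuples _ (n + 1) D := by
    obtain ⟨D, hD⟩ := (Metric.isBounded_iff.mp (isCompact_univ
      (X := stdSimplex ℝ (Fin (n + 1)))).isBounded)
    exact ⟨D, fun i j => hD (Set.mem_univ _) (Set.mem_univ _)⟩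
  have hq : Filter.Tendsto (fun N : ℕ => ((((n + 1 : ℕ) : ℝ) - 1) / (n + 1 : ℕ)) ^ N * D)
      Filter.atTop (𝓝 0) := by
    rw [← zero_mul D]
    refine (tendsto_pow_atTop_nhds_zero_of_lt_one ?_ ?_).mul_const D
    · push_cast
      rw [add_sub_cancel_right]
      positivity
    · rw [div_lt_one (by positivity)]
      linarith
  obtain ⟨N, hN⟩ := (hq.eventually (gt_mem_nhds hδ)).exists
  refine ⟨N, ?_⟩
  rw [← realize_vertices, sd_iterate_realize]
  have hmem := vsd_iterate_mem_small (dist_bary_le n) (dist_bary_vertex_le n) (n + 1) D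
    (Finsupp.single_mem_supported ℝ 1 hD) N
  have hle : Finsupp.supported ℝ ℝ (smallTuples (stdSimplex ℝ (Fin (n + 1))) (n + 1)
      (((((n + 1 : ℕ) : ℝ) - 1) / (n + 1 : ℕ)) ^ N * D)) ≤
      (smallChains U V n).comap (realize σ n) := by
    rw [Finsupp.supported_eq_span_single, Submodule.span_le]
    rintro _ ⟨w, hw, rfl⟩
    rw [SetLike.mem_coe, Submodule.mem_comap, realize_single]
    obtain ⟨b, hb⟩ := h (w 0) (Set.mem_univ _)
    have hball : ∀ t, aff w t ∈ Metric.ball (w 0) δ := fun t => (dist_aff_le hw t).trans_lt hN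
    cases b with
    | true =>
      refine Submodule.mem_sup_left (single_mem_chainsOn (fun t => ?_) _)
      rw [hU]
      exact ⟨hb (hball t), hσ _⟩
    | false =>
      refine Submodule.mem_sup_right (single_mem_chainsOn (fun t => ?_) _)
      rw [hV]
      exact ⟨hb (hball t), hσ _⟩
  exact hle hmem

lemma exists_sd_iterate_mem {O P : Set X} (hO : IsOpen O) (hP : IsOpen P)
    (hU : U = O ∩ (U ∪ V)) (hV : V = P ∩ (U ∪ V)) {c : Chain X n}
    (hc : c ∈ chainsOn (U ∪ V) n) : ∃ N, (sd n)^[N] c ∈ smallChains U V n := by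
  have hit : ∀ N, ⇑((sd n : Chain X n →ₗ[ℝ] Chain X n) ^ N) = (sd n)^[N] :=
    fun N => by ext; simp [Module.End.pow_apply]
  refine chainsOn_induction (p := fun c => ∃ N, (sd n)^[N] c ∈ smallChains U V n)
    ⟨0, zero_mem _⟩ ?_ ?_ hc
  · rintro a b ⟨M, hM⟩ ⟨N, hN⟩
    refine ⟨M + N, ?_⟩
    rw [← hit, map_add, hit]
    refine add_mem ?_ ?_
    · rw [add_comm M N, Function.iterate_add_apply]
      exact sd_iterate_mem_smallChains hM N
    · rw [Function.iterate_add_apply]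
      exact sd_iterate_mem_smallChains hN M
  · intro σ hσ r
    obtain ⟨N, hN⟩ := exists_sd_iterate_single_mem hO hP hU hV σ hσ
    refine ⟨N, ?_⟩
    rw [← mul_one r, ← smul_eq_mul, ← Finsupp.smul_single, ← hit, map_smul, hit]
    exact Submodule.smul_mem _ _ hN

/-- A chain whose boundary is small differs from a small chain by a boundary. -/
lemma exists_sub_bds_mem_smallChains {O P : Set X} (hO : IsOpen O) (hP : IsOpen P)
    (hU : U = O ∩ (U ∪ V)) (hV : V = P ∩ (U ∪ V)) {c : Chain X n}
    (hc : c ∈ chainsOn (U ∪ V) n) (hbd : bd n c ∈ smallChains U V (n - 1)) :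
    ∃ b ∈ chainsOn (U ∪ V) (n + 1), c - bds n b ∈ smallChains U V n := by
  obtain ⟨N, hN⟩ := exists_sd_iterate_mem hO hP hU hV hc
  clear hU hV
  induction N generalizing c with
  | zero => exact ⟨0, zero_mem _, by simpa using hN⟩
  | succ N ih =>
    rw [Function.iterate_succ_apply] at hN
    -- With `T` the homotopy, `c - ∂Tc - sd c` equals `T∂c`, which is small because `∂c` is. Thus
    -- `c` may be replaced by `sd c`, which needs one subdivision fewer.
    have h1 : bd n (sd n c) ∈ smallChains U V (n - 1) ∧
        c - bds n (sdHomotopy n c) - sd n c ∈ smallChains U V n := by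
      cases n with
      | zero => exact ⟨zero_mem _, by rw [bds_sdHomotopy_zero]; simp⟩
      | succ n =>
        refine ⟨?_, ?_⟩
        · rw [bd_succ, bds_sd]
          exact sd_mem_smallChains hbd
        · rw [bds_sdHomotopy]
          have : c - (c - sd (n + 1) c - sdHomotopy n (bds n c)) - sd (n + 1) c =
            sdHomotopy n (bds n c) := by abel
          rw [this]
          exact sdHomotopy_mem_smallChains hbd
    obtain ⟨b, hb, hb'⟩ := ih (sd_mem_chainsOn hc) h1.1 hN
    refine ⟨sdHomotopy n c + b, add_mem (sdHomotopy_mem_chainsOn hc) hb, ?_⟩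
    have : c - bds n (sdHomotopy n c + b) =
        (c - bds n (sdHomotopy n c) - sd n c) + (sd n c - bds n b) := by rw [map_add]; abel
    rw [this]
    exact add_mem h1.2 hb'

end Subdivision

/-! ## Relative homology in the concrete model -/

section RelativeHomology

/-- The group structure on a subspace of a space of finitely supported functions. -/
@[reducible] instance addCommGroupSubmoduleFinsupp {ι : Type w} (S : Submodule ℝ (ι →₀ ℝ)) :
    AddCommGroup S :=
  @Submodule.addCommGroup ℝ (ι →₀ ℝ) _ Finsupp.instAddCommGroup _ S


variable {X : Type u} [TopologicalSpace X] {Y : Type v} [TopologicalSpace Y]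

/-- The relative homology in the concrete model. -/
abbrev relH (A B : Set X) (n : ℕ) : Type u :=
  cycles A B n ⧸ (bounds A B n).submoduleOf (cycles A B n)

/-- The common source of the homology isomorphisms: reflecting `q` gives injectivity, and reaching
everything modulo `q` gives surjectivity. Only the existence of an isomorphism is ever used. -/
lemma nonempty_quotient_equiv {M N : Type*} [AddCommGroup M] [Module ℝ M] [AddCommGroup N]
    [Module ℝ N] (p : Submodule ℝ M) (q : Submodule ℝ N) (f : M →ₗ[ℝ] N)
    (hf : ∀ c, c ∈ p ↔ f c ∈ q) (hs : ∀ c', ∃ c, c' - f c ∈ q) :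
    Nonempty ((M ⧸ p) ≃ₗ[ℝ] (N ⧸ q)) := by
  refine ⟨LinearEquiv.ofBijective (Submodule.mapQ p q f fun c hc => (hf c).mp hc) ⟨?_, ?_⟩⟩
  · rw [← LinearMap.ker_eq_bot, eq_bot_iff]
    intro x hx
    obtain ⟨c, rfl⟩ := Submodule.Quotient.mk_surjective _ x
    rw [LinearMap.mem_ker, Submodule.mapQ_apply, Submodule.Quotient.mk_eq_zero] at hx
    rw [Submodule.mem_bot, Submodule.Quotient.mk_eq_zero]
    exact (hf c).mpr hx
  · intro y
    obtain ⟨c', rfl⟩ := Submodule.Quotient.mk_surjective _ y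
    obtain ⟨c, hc⟩ := hs c'
    refine ⟨Submodule.Quotient.mk c, ?_⟩
    rw [Submodule.mapQ_apply, eq_comm, Submodule.Quotient.eq]
    exact hc

/-- A linear map on relative cycles that respects and reflects boundaries and is surjective up to
boundaries induces an isomorphism in homology. -/
lemma nonempty_relH_equiv {A B : Set X} {A' B' : Set Y} {n n' : ℕ}
    (f : cycles A B n →ₗ[ℝ] cycles A' B' n')
    (hf : ∀ c : cycles A B n, (c : Chain X n) ∈ bounds A B n ↔
      (f c : Chain Y n') ∈ bounds A' B' n')
    (hs : ∀ c' : cycles A' B' n', ∃ c, (c' : Chain Y n') - f c ∈ bounds A' B' n') :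
    Nonempty (relH A B n ≃ₗ[ℝ] relH A' B' n') :=
  nonempty_quotient_equiv _ _ f hf hs

lemma subsingleton_relH_iff {A B : Set X} {n : ℕ} :
    Subsingleton (relH A B n) ↔ cycles A B n ≤ bounds A B n := by
  rw [Submodule.Quotient.subsingleton_iff, Submodule.submoduleOf_eq_top]

lemma bounds_mono {A B A' B' : Set X} (hA : A ⊆ A') (hB : B ⊆ B') (n : ℕ) :
    bounds A B n ≤ bounds A' B' n :=
  sup_le_sup (Submodule.map_mono (chainsOn_mono hA _)) (chainsOn_mono hB n)

lemma cycles_mono {A B A' B' : Set X} (hA : A ⊆ A') (hB : B ⊆ B') (n : ℕ) :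
    cycles A B n ≤ cycles A' B' n :=
  inf_le_inf (chainsOn_mono hA n) (Submodule.comap_mono (chainsOn_mono hB _))

/-- A pair all of whose relative homology vanishes. -/
structure IsAcyclicPair (A B : Set X) : Prop where
  subset : B ⊆ A
  le : ∀ n, cycles A B n ≤ bounds A B n

/-- If `c = ∂x + a` with `a` in `A`, then `∂a = ∂c` lies in `B`. So `a` is a relative cycle of `(A,
B)` and bounds modulo `B`. -/
lemma IsAcyclicPair.mem_bounds_of_mem {W A B : Set X} (h : IsAcyclicPair A B) (hA : A ⊆ W) {n : ℕ}
    {c : Chain X n} (hc : c ∈ cycles W B n) (hc' : c ∈ bounds W A n) : c ∈ bounds W B n := by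
  obtain ⟨x, hx, a, ha, rfl⟩ := mem_bounds.mp hc'
  have ha' : a ∈ cycles A B n := ⟨ha, by simpa [bd_bds] using hc.2⟩
  obtain ⟨y, hy, b, hb, rfl⟩ := mem_bounds.mp (h.le n ha')
  exact mem_bounds.mpr ⟨x + y, add_mem hx (chainsOn_mono hA _ hy), b, hb, by
    rw [map_add, add_assoc]⟩

/-- If `(A, B)` is acyclic, then `H_n(W, B)` and `H_n(W, A)` are isomorphic. -/
lemma IsAcyclicPair.nonempty_equiv_right {W A B : Set X} (h : IsAcyclicPair A B) (hA : A ⊆ W)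
    (n : ℕ) : Nonempty (relH W B n ≃ₗ[ℝ] relH W A n) := by
  refine nonempty_relH_equiv (Submodule.inclusion (cycles_mono subset_rfl h.subset n))
    (fun c => ⟨fun hc => bounds_mono subset_rfl h.subset n hc,
      fun hc => h.mem_bounds_of_mem hA c.2 hc⟩) ?_
  rintro ⟨c, hc⟩
  cases n with
  | zero => exact ⟨⟨c, mem_cycles.mpr ⟨hc.1, zero_mem _⟩⟩, by simp⟩
  | succ n =>
    have hc' : bds n c ∈ cycles A B n :=
      mem_cycles.mpr ⟨hc.2, by rw [bd_bds]; exact zero_mem _⟩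
    -- Correcting `c` by the chain `y` of `A` moves its boundary into `B`.
    obtain ⟨y, hy, b, hb, hyb⟩ := mem_bounds.mp (h.le n hc')
    refine ⟨⟨c - y, mem_cycles_succ.mpr ⟨sub_mem hc.1 (chainsOn_mono hA _ hy), ?_⟩⟩, ?_⟩
    · rw [map_sub, ← hyb, add_sub_cancel_left]
      exact hb
    · rw [Submodule.inclusion_apply, sub_sub_cancel]
      exact Submodule.mem_sup_right hy

/-- If `(W, B)` is acyclic, then `H_{n+1}(W, A)` and `H_n(A, B)` are isomorphic. -/
lemma IsAcyclicPair.nonempty_equiv_connecting {W A B : Set X} (h : IsAcyclicPair W B)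
    (hA : A ⊆ W) (hB : B ⊆ A) (n : ℕ) :
    Nonempty (relH W A (n + 1) ≃ₗ[ℝ] relH A B n) := by
  refine nonempty_relH_equiv ((bds n).restrict (p := cycles W A (n + 1)) (q := cycles A B n)
    fun c hc => mem_cycles.mpr ⟨hc.2, by rw [bd_bds]; exact zero_mem _⟩) ?_ ?_
  · rintro ⟨c, hc⟩
    constructor
    · intro h'
      obtain ⟨x, hx, a, ha, rfl⟩ := mem_bounds.mp h'
      refine mem_bounds.mpr ⟨a, ha, 0, zero_mem _, ?_⟩
      simp [LinearMap.restrict_apply, bds_bds]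
    · intro h'
      obtain ⟨a, ha, b, hb, hab⟩ := mem_bounds.mp h'
      have h1 : bds n c = bds n a + b := hab.symm
      -- The boundary of `c - a` is `b`, so `c - a` is a relative cycle of the acyclic pair `(W,
      -- B)`.
      have h2 : c - a ∈ cycles W B (n + 1) := by
        refine mem_cycles_succ.mpr ⟨sub_mem hc.1 (chainsOn_mono hA _ ha), ?_⟩
        rw [map_sub, h1, add_sub_cancel_left]
        exact hb
      obtain ⟨x, hx, b', hb', hxb⟩ := mem_bounds.mp (h.le _ h2)
      exact mem_bounds.mpr ⟨x, hx, b' + a, add_mem (chainsOn_mono hB _ hb') ha, by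
        rw [← add_assoc, hxb, sub_add_cancel]⟩
  · rintro ⟨c, hc⟩
    obtain ⟨x, hx, b, hb, rfl⟩ := mem_bounds.mp (h.le n (cycles_mono hA subset_rfl n hc))
    refine ⟨⟨x, mem_cycles_succ.mpr ⟨hx, ?_⟩⟩, ?_⟩
    · have := sub_mem hc.1 (chainsOn_mono hB _ hb)
      rwa [add_sub_cancel_right] at this
    · rw [LinearMap.coe_restrict_apply, add_sub_cancel_left]
      exact Submodule.mem_sup_right hb

/-- If `(W, A)` is acyclic, then `H_n(A, D)` and `H_n(W, D)` are isomorphic. -/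
lemma IsAcyclicPair.nonempty_equiv_left {W A D : Set X} (h : IsAcyclicPair W A) (hD : D ⊆ A)
    (n : ℕ) : Nonempty (relH A D n ≃ₗ[ℝ] relH W D n) := by
  refine nonempty_relH_equiv (Submodule.inclusion (cycles_mono h.subset subset_rfl n))
    (fun c => ⟨fun hc => bounds_mono h.subset subset_rfl n hc, fun hc => ?_⟩) ?_
  · obtain ⟨x, hx, d, hd, hxd⟩ := mem_bounds.mp hc
    have hxd' : bds n x + d = c := hxd
    have hx' : x ∈ cycles W A (n + 1) := by
      refine mem_cycles_succ.mpr ⟨hx, ?_⟩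
      rw [eq_sub_of_add_eq hxd']
      exact sub_mem c.2.1 (chainsOn_mono hD _ hd)
    obtain ⟨y, hy, a, ha, rfl⟩ := mem_bounds.mp (h.le _ hx')
    refine mem_bounds.mpr ⟨a, ha, d, hd, ?_⟩
    rw [← hxd', map_add, bds_bds, zero_add]
  · rintro ⟨c, hc⟩
    obtain ⟨x, hx, a, ha, rfl⟩ := mem_bounds.mp (h.le n (cycles_mono subset_rfl hD n hc))
    refine ⟨⟨a, mem_cycles.mpr ⟨ha, ?_⟩⟩, ?_⟩
    · have := hc.2
      simpa [bd_bds] using this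
    · rw [Submodule.inclusion_apply, add_sub_cancel_right]
      exact Submodule.mem_sup_left (Submodule.mem_map_of_mem hx)

/-- Excision. -/
lemma nonempty_equiv_excision {U V O P : Set X} (hO : IsOpen O) (hP : IsOpen P)
    (hU : U = O ∩ (U ∪ V)) (hV : V = P ∩ (U ∪ V)) (n : ℕ) :
    Nonempty (relH U (U ∩ V) n ≃ₗ[ℝ] relH (U ∪ V) V n) := by
  refine nonempty_relH_equiv (Submodule.inclusion
    (cycles_mono Set.subset_union_left Set.inter_subset_right n))
    (fun c => ⟨fun hc => bounds_mono Set.subset_union_left Set.inter_subset_right n hc,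
      fun hc => ?_⟩) ?_
  · obtain ⟨x, hx, v, hv, hxv⟩ := mem_bounds.mp hc
    have hxv' : bds n x + v = c := hxv
    -- `∂x = c - v` is small, so `x` may be replaced by a sum of chains of `U` and of `V` with the
    -- same boundary.
    obtain ⟨b, hb, hb'⟩ := exists_sub_bds_mem_smallChains hO hP hU hV hx (by
      change bds n x ∈ _
      rw [eq_sub_of_add_eq hxv']
      exact Submodule.sub_mem _ (Submodule.mem_sup_left c.2.1) (Submodule.mem_sup_right hv))
    obtain ⟨u', hu', v', hv', h⟩ := Submodule.mem_sup.mp hb'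
    have h1 : bds n u' + bds n v' = bds n x := by
      rw [← map_add, h, map_sub, bds_bds, sub_zero]
    have h2 : (c : Chain X n) - bds n u' = bds n v' + v := by
      rw [← hxv', ← h1]; abel
    -- The left side is a chain of `U`, and by `h2` it is also a chain of `V`.
    have h3 : (c : Chain X n) - bds n u' ∈ chainsOn (U ∩ V) n := by
      refine mem_chainsOn_inter (sub_mem c.2.1 (bds_mem_chainsOn hu')) ?_
      rw [h2]
      exact add_mem (bds_mem_chainsOn hv') hv
    exact mem_bounds.mpr ⟨u', hu', _, h3, add_sub_cancel _ _⟩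
  · rintro ⟨c, hc⟩
    obtain ⟨b, hb, hb'⟩ := exists_sub_bds_mem_smallChains hO hP hU hV hc.1
      (Submodule.mem_sup_right hc.2)
    obtain ⟨u, hu, v, hv, h⟩ := Submodule.mem_sup.mp hb'
    have h1 : bd n u = bd n c - bd n v := by
      rw [eq_sub_iff_add_eq, ← map_add, h, map_sub, bd_bds, sub_zero]
    refine ⟨⟨u, mem_cycles.mpr ⟨hu, mem_chainsOn_inter (bd_mem_chainsOn hu) ?_⟩⟩, ?_⟩
    · rw [h1]
      exact sub_mem hc.2 (bd_mem_chainsOn hv)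
    · refine mem_bounds.mpr ⟨b, hb, v, hv, ?_⟩
      change _ = c - u
      rw [← sub_eq_zero, ← sub_eq_zero.mpr h]
      abel

/-- Excision for open sets. -/
lemma nonempty_equiv_excision_of_isOpen {U V : Set X} (hU : IsOpen U) (hV : IsOpen V) (n : ℕ) :
    Nonempty (relH U (U ∩ V) n ≃ₗ[ℝ] relH (U ∪ V) V n) :=
  nonempty_equiv_excision hU hV (Set.inter_eq_left.mpr Set.subset_union_left).symm
    (Set.inter_eq_left.mpr Set.subset_union_right).symm n

/-! ### Maps continuous on a subset, and deformations. -/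

open Classical in
/-- The map on chains induced by a function; simplices with discontinuous image are sent to `0`. -/
def push (f : X → Y) (n : ℕ) : Chain X n →ₗ[ℝ] Chain Y n :=
  Finsupp.linearCombination ℝ fun σ =>
    if h : Continuous (f ∘ σ) then Finsupp.single ⟨f ∘ σ, h⟩ (1 : ℝ) else 0

lemma push_single {f : X → Y} {n : ℕ} {σ : C(stdSimplex ℝ (Fin (n + 1)), X)}
    (h : Continuous (f ∘ σ)) (r : ℝ) :
    push f n (Finsupp.single σ r) = Finsupp.single ⟨f ∘ σ, h⟩ r := by
  simp [push, h]

lemma continuous_comp_of_mem {f : X → Y} {A : Set X} (hf : ContinuousOn f A) {n : ℕ}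
    {σ : C(stdSimplex ℝ (Fin (n + 1)), X)} (hσ : ∀ p, σ p ∈ A) : Continuous (f ∘ σ) :=
  hf.comp_continuous σ.continuous hσ

lemma push_mem_chainsOn {f : X → Y} {A : Set X} {B : Set Y} (hf : ContinuousOn f A)
    (h : Set.MapsTo f A B) {n : ℕ} {c : Chain X n} (hc : c ∈ chainsOn A n) :
    push f n c ∈ chainsOn B n := by
  refine chainsOn_induction (p := fun c => push f n c ∈ chainsOn B n) (by simp)
    (fun a b ha hb => by rw [map_add]; exact add_mem ha hb) (fun σ hσ r => ?_) hc
  rw [push_single (continuous_comp_of_mem hf hσ)]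
  exact single_mem_chainsOn (fun p => h (hσ p)) _

/-- The faces of a simplex in `A` lie in `A`, so the default value `0` of `push` never occurs here.
-/
lemma bds_push {f : X → Y} {A : Set X} (hf : ContinuousOn f A) {n : ℕ} {c : Chain X (n + 1)}
    (hc : c ∈ chainsOn A (n + 1)) : bds n (push f (n + 1) c) = push f n (bds n c) := by
  refine chainsOn_induction (p := fun c => bds n (push f (n + 1) c) = push f n (bds n c))
    (by simp) (fun a b ha hb => by simp only [map_add, ha, hb]) (fun σ hσ r => ?_) hc
  rw [push_single (continuous_comp_of_mem hf hσ), bds_single, bds_single]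
  simp only [map_smul, map_sum]
  congr 1
  refine Finset.sum_congr rfl fun i _ => ?_
  rw [push_single (continuous_comp_of_mem hf (σ := σ.comp (face i)) fun p => hσ (face i p))]
  rfl

lemma bd_push {f : X → Y} {A : Set X} (hf : ContinuousOn f A) {n : ℕ} {c : Chain X n}
    (hc : c ∈ chainsOn A n) : bd n (push f n c) = push f (n - 1) (bd n c) := by
  cases n with
  | zero => simp
  | succ n => exact bds_push hf hc

lemma push_push {f : X → Y} {g : Y → X} {A : Set X} {A' : Set Y} (hf : ContinuousOn f A)
    (hg : ContinuousOn g A') (h : Set.MapsTo f A A') (hgf : Set.LeftInvOn g f A) {n : ℕ}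
    {c : Chain X n} (hc : c ∈ chainsOn A n) : push g n (push f n c) = c := by
  refine chainsOn_induction (p := fun c => push g n (push f n c) = c) (by simp)
    (fun a b ha hb => by simp only [map_add, ha, hb]) (fun σ hσ r => ?_) hc
  have h1 := continuous_comp_of_mem hf hσ
  rw [push_single h1, push_single (σ := ⟨f ∘ σ, h1⟩)
    (continuous_comp_of_mem hg fun p => h (hσ p))]
  congr 1
  ext p
  exact hgf (hσ p)

lemma push_mem_cycles {f : X → Y} {A B : Set X} {A' B' : Set Y} (hf : ContinuousOn f A)
    (hBA : B ⊆ A) (h : Set.MapsTo f A A') (h' : Set.MapsTo f B B') {n : ℕ} {c : Chain X n}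
    (hc : c ∈ cycles A B n) : push f n c ∈ cycles A' B' n := by
  refine mem_cycles.mpr ⟨push_mem_chainsOn hf h hc.1, ?_⟩
  rw [bd_push hf hc.1]
  exact push_mem_chainsOn (hf.mono hBA) h' hc.2

lemma push_mem_bounds {f : X → Y} {A B : Set X} {A' B' : Set Y} (hf : ContinuousOn f A)
    (hBA : B ⊆ A) (h : Set.MapsTo f A A') (h' : Set.MapsTo f B B') {n : ℕ} {c : Chain X n}
    (hc : c ∈ bounds A B n) : push f n c ∈ bounds A' B' n := by
  obtain ⟨x, hx, b, hb, rfl⟩ := mem_bounds.mp hc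
  exact mem_bounds.mpr ⟨_, push_mem_chainsOn hf h hx, _,
    push_mem_chainsOn (hf.mono hBA) h' hb, by rw [map_add, bds_push hf hx]⟩

/-- Relative homology is invariant under homeomorphisms of pairs of subsets. -/
lemma nonempty_equiv_push {f : X → Y} {g : Y → X} {A B : Set X} {A' B' : Set Y}
    (hf : ContinuousOn f A) (hg : ContinuousOn g A') (hBA : B ⊆ A) (hBA' : B' ⊆ A')
    (hfA : Set.MapsTo f A A') (hfB : Set.MapsTo f B B') (hgA : Set.MapsTo g A' A)
    (hgB : Set.MapsTo g B' B) (hgf : Set.LeftInvOn g f A) (hfg : Set.LeftInvOn f g A') (n : ℕ) :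
    Nonempty (relH A B n ≃ₗ[ℝ] relH A' B' n) := by
  refine nonempty_relH_equiv
    ((push f n).restrict fun c hc => push_mem_cycles hf hBA hfA hfB hc)
    (fun c => ⟨fun hc => push_mem_bounds hf hBA hfA hfB hc, fun hc => ?_⟩) fun c => ?_
  · have := push_mem_bounds hg hBA' hgA hgB hc
    rwa [LinearMap.coe_restrict_apply, push_push hf hg hfA hgf c.2.1] at this
  · refine ⟨⟨push g n c, push_mem_cycles hg hBA' hgA hgB c.2⟩, ?_⟩
    rw [LinearMap.coe_restrict_apply, push_push hg hf hgA hfg c.2.1, sub_self]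
    exact zero_mem _

/-- A homotopy from the identity of `A` to `h 1` within `A`: a cycle is homologous to its image. -/
lemma exists_bds_eq_sub_push {h : ℝ → X → X} {A : Set X}
    (hc : ContinuousOn (fun p : ℝ × X => h p.1 p.2) (Set.Icc 0 1 ×ˢ A))
    (hA : ∀ t ∈ Set.Icc (0 : ℝ) 1, Set.MapsTo (h t) A A) (h0 : ∀ x ∈ A, h 0 x = x) {n : ℕ}
    {c : Chain X n} (hcA : c ∈ chainsOn A n) (hcy : bd n c = 0) :
    ∃ x ∈ chainsOn A (n + 1), bds n x = c - push (h 1) n c := by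
  have hcont : Continuous fun p : unitInterval × A => (⟨h p.1 p.2, hA _ p.1.2 p.2.2⟩ : A) :=
    Continuous.subtype_mk (hc.comp_continuous
      (f := fun p : unitInterval × A => ((p.1 : ℝ), (p.2 : X))) (by fun_prop)
      fun p => ⟨p.1.2, p.2.2⟩) _
  let r : C(A, A) := ⟨fun x => ⟨h 1 x, hA 1 ⟨zero_le_one, le_rfl⟩ x.2⟩,
    hcont.comp (f := fun x : A => ((1 : unitInterval), x)) (by fun_prop)⟩
  let F : (ContinuousMap.id A).Homotopy r :=
    { toFun := fun p => ⟨h p.1 p.2, hA _ p.1.2 p.2.2⟩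
      continuous_toFun := hcont
      map_zero_left := fun x => Subtype.ext (h0 x x.2)
      map_one_left := fun x => rfl }
  obtain ⟨P, hP0, hP⟩ := exists_chainHomotopy F
  obtain ⟨a, rfl⟩ := mem_chainsOn_iff_exists.mp hcA
  have hid : chainMap (ContinuousMap.id A) n a = a := by
    clear hcA hcy
    induction a using Finsupp.induction_linear with
    | zero => simp
    | add x y hx hy => rw [map_add, hx, hy]
    | single σ r => simp
  have hr : chainMap (incl A) n (chainMap r n a) = push (h 1) n (chainMap (incl A) n a) := by
    clear hcA hcy hid
    have h1 : ContinuousOn (h 1) A :=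
      hc.comp (f := fun x => ((1 : ℝ), x)) (by fun_prop) fun x hx => ⟨⟨zero_le_one, le_rfl⟩, hx⟩
    induction a using Finsupp.induction_linear with
    | zero => simp
    | add x y hx hy => simp only [map_add, hx, hy]
    | single σ s =>
      rw [chainMap_single, chainMap_single, chainMap_single, push_single
        (continuous_comp_of_mem h1 fun p => (σ p).2)]
      rfl
  refine ⟨chainMap (incl A) (n + 1) (P n a), mem_chainsOn_iff_exists.mpr ⟨_, rfl⟩, ?_⟩
  rw [bds_chainMap, ← hr, ← map_sub]
  congr 1
  cases n with
  | zero => rw [hP0, hid]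
  | succ n =>
    -- Chains of the subspace inject into those of `X`, so `a` is itself a cycle and the term of the
    -- homotopy containing its boundary drops out.
    have ha : bds n a = 0 := by
      have hinj : Function.Injective (chainMap (incl A) n) :=
        Finsupp.mapDomain_injective fun σ τ hστ => by
          ext p
          exact congrArg (fun f => f p) hστ
      apply hinj
      rw [map_zero, ← bds_chainMap]
      exact hcy
    have := hP n a
    rwa [ha, map_zero, add_zero, hid] at this

/-- A deformation of `A` into `B`, preserving `B`, shows that the pair `(A, B)` is acyclic. -/
lemma isAcyclicPair_of_deformation {h : ℝ → X → X} {A B : Set X} (hBA : B ⊆ A)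
    (hc : ContinuousOn (fun p : ℝ × X => h p.1 p.2) (Set.Icc 0 1 ×ˢ A))
    (hA : ∀ t ∈ Set.Icc (0 : ℝ) 1, Set.MapsTo (h t) A A)
    (hB : ∀ t ∈ Set.Icc (0 : ℝ) 1, Set.MapsTo (h t) B B) (h0 : ∀ x ∈ A, h 0 x = x)
    (h1 : Set.MapsTo (h 1) A B) : IsAcyclicPair A B := by
  refine ⟨hBA, fun n e he => ?_⟩
  have hcB : ContinuousOn (fun p : ℝ × X => h p.1 p.2) (Set.Icc 0 1 ×ˢ B) :=
    hc.mono (Set.prod_mono_right hBA)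
  have hc1 : ContinuousOn (h 1) A :=
    hc.comp (f := fun x => ((1 : ℝ), x)) (by fun_prop) fun x hx => ⟨⟨zero_le_one, le_rfl⟩, hx⟩
  have hpe := push_mem_chainsOn hc1 h1 he.1
  -- `e` is only a relative cycle. Its boundary is deformed inside `B`, giving `y` with `∂y = ∂e -
  -- h₁∂e`, so that `e - h₁e - y` is an absolute cycle to which the homotopy applies.
  obtain ⟨y, hy, hy'⟩ : ∃ y ∈ chainsOn B n, bd n (e - (push (h 1) n e + y)) = 0 := by
    cases n with
    | zero => exact ⟨0, zero_mem _, rfl⟩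
    | succ n =>
      obtain ⟨y, hy, hy'⟩ := exists_bds_eq_sub_push hcB hB (fun x hx => h0 x (hBA hx)) he.2
        (bd_bds n e)
      refine ⟨y, hy, ?_⟩
      have hy'' : bds n y = bds n e - push (h 1) n (bds n e) := hy'
      rw [bd_succ, map_sub, map_add, hy'', bds_push hc1 he.1]
      abel
  have hz : e - (push (h 1) n e + y) ∈ chainsOn A n :=
    sub_mem he.1 (chainsOn_mono hBA _ (add_mem hpe hy))
  obtain ⟨x, hx, hx'⟩ := exists_bds_eq_sub_push hc hA h0 hz hy'
  refine mem_bounds.mpr ⟨x, hx, push (h 1) n (e - (push (h 1) n e + y)) + (push (h 1) n e + y),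
    add_mem (push_mem_chainsOn hc1 h1 hz) (add_mem hpe hy), ?_⟩
  rw [hx']
  abel

end RelativeHomology

/-! ## The local homology of Euclidean space -/

section Euclidean

/-! ### Homology of a contractible space. -/

section Contractible

variable {X : Type u} [TopologicalSpace X]

/-- The sum of the coefficients of a chain. -/
def augmentation (n : ℕ) : Chain X n →ₗ[ℝ] ℝ := Finsupp.linearCombination ℝ fun _ => (1 : ℝ)

@[simp] lemma augmentation_single {n : ℕ} (σ : C(stdSimplex ℝ (Fin (n + 1)), X)) (r : ℝ) :
    augmentation n (Finsupp.single σ r) = r := by simp [augmentation]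

lemma augmentation_bds (c : Chain X 1) : augmentation 0 (bds 0 c) = 0 := by
  induction c using Finsupp.induction_linear with
  | zero => simp
  | add x y hx hy => simp only [map_add, hx, hy, add_zero]
  | single σ r => simp [bds_single, Fin.sum_univ_two]

lemma push_const (a : X) (n : ℕ) (c : Chain X n) :
    push (fun _ => a) n c = Finsupp.single (ContinuousMap.const _ a) (augmentation n c) := by
  induction c using Finsupp.induction_linear with
  | zero => simp
  | add x y hx hy => simp only [map_add, hx, hy, Finsupp.single_add]
  | single σ r =>
    rw [push_single (f := fun _ => a) (σ := σ) continuous_const, augmentation_single]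
    rfl

/-- All `n + 2` faces coincide, so the coefficient is an alternating sum of `n + 2` signs. -/
lemma bds_single_const (a : X) (n : ℕ) (r : ℝ) :
    bds n (Finsupp.single (ContinuousMap.const _ a) r) =
      Finsupp.single (ContinuousMap.const _ a) (if Even n then 0 else r) := by
  rw [bds_single]
  have h : ∀ i : Fin (n + 2), (ContinuousMap.const (stdSimplex ℝ (Fin (n + 2))) a).comp (face i) =
    ContinuousMap.const _ a := fun i => rfl
  simp only [h, Finsupp.smul_single, smul_eq_mul, mul_one, ← Finsupp.single_finsetSum]
  rw [Fin.sum_univ_eq_sum_range (fun i => (-1 : ℝ) ^ i), neg_one_geom_sum]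
  congr 1
  by_cases hn : Even n <;> simp [Nat.even_add, hn]

/-- A contraction of the whole space to a point, in the form used for chains. -/
def IsContraction (h : ℝ → X → X) (a : X) : Prop :=
  ContinuousOn (fun p : ℝ × X => h p.1 p.2) (Set.Icc 0 1 ×ˢ Set.univ) ∧ h 0 = id ∧
    h 1 = fun _ => a

lemma IsContraction.exists_bds_eq {h : ℝ → X → X} {a : X} (hh : IsContraction h a) {n : ℕ}
    {c : Chain X n} (hc : bd n c = 0) : ∃ x, bds n x =
      c - Finsupp.single (ContinuousMap.const _ a) (augmentation n c) := by
  obtain ⟨x, -, hx⟩ := exists_bds_eq_sub_push (A := Set.univ) hh.1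
    (fun _ _ _ _ => Set.mem_univ _) (fun x _ => by rw [hh.2.1]; rfl) (c := c) (by simp) hc
  exact ⟨x, by rw [hx, hh.2.2, push_const]⟩

/-- A cycle is homologous to a multiple of the constant simplex. In odd degree that simplex is a
boundary. In positive even degree its own boundary is nonzero, so the multiple is zero. -/
lemma IsContraction.cycles_le {h : ℝ → X → X} {a : X} (hh : IsContraction h a) (n : ℕ) :
    cycles (Set.univ : Set X) ∅ (n + 1) ≤ bounds Set.univ ∅ (n + 1) := by
  intro c hc
  have hc0 : bds n c = 0 := by
    have := hc.2
    simpa [chainsOn_empty] using this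
  suffices h : ∃ y, bds (n + 1) y = c by
    obtain ⟨y, hy⟩ := h
    exact mem_bounds.mpr ⟨y, by simp, 0, zero_mem _, by rw [hy, add_zero]⟩
  obtain ⟨x, hx⟩ := hh.exists_bds_eq (n := n + 1) (c := c) hc0
  by_cases hn : Even n
  · refine ⟨x + Finsupp.single (ContinuousMap.const _ a) (augmentation (n + 1) c), ?_⟩
    rw [map_add, hx, bds_single_const, if_neg (by simpa [Nat.even_add_one] using hn)]
    abel
  · refine ⟨x, ?_⟩
    have h1 := congrArg (bds n) hx
    rw [bds_bds, map_sub, hc0, bds_single_const, if_neg hn, zero_sub, eq_comm, neg_eq_zero,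
      Finsupp.single_eq_zero] at h1
    rw [hx, h1, Finsupp.single_zero, sub_zero]

/-- Induced by the augmentation: it kills boundaries, and every `0`-chain is homologous to its
augmentation times the base point. -/
lemma IsContraction.nonempty_equiv {h : ℝ → X → X} {a : X} (hh : IsContraction h a) :
    Nonempty (relH (Set.univ : Set X) ∅ 0 ≃ₗ[ℝ] ℝ) := by
  let f : cycles (Set.univ : Set X) ∅ 0 →ₗ[ℝ] ℝ := augmentation 0 ∘ₗ Submodule.subtype _
  suffices h : Nonempty (relH (Set.univ : Set X) ∅ 0 ≃ₗ[ℝ] (ℝ ⧸ (⊥ : Submodule ℝ ℝ))) by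
    obtain ⟨e⟩ := h
    exact ⟨e.trans (Submodule.quotEquivOfEqBot _ rfl)⟩
  refine nonempty_quotient_equiv _ _ f ?_ ?_
  · rintro ⟨c, hc⟩
    rw [Submodule.mem_bot]
    constructor
    · intro h'
      obtain ⟨x, -, b, hb, hxb⟩ := mem_bounds.mp h'
      rw [chainsOn_empty, Submodule.mem_bot] at hb
      have h1 : bds 0 x = c := by rw [← add_zero (bds 0 x), ← hb]; exact hxb
      change augmentation 0 c = 0
      rw [← h1, augmentation_bds]
    · intro h'
      have h1 : augmentation 0 c = 0 := h'
      obtain ⟨x, hx⟩ := hh.exists_bds_eq (n := 0) (c := c) rfl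
      rw [h1, Finsupp.single_zero, sub_zero] at hx
      exact mem_bounds.mpr ⟨x, by simp, 0, zero_mem _, by rw [hx, add_zero]; rfl⟩
  · intro r
    refine ⟨⟨Finsupp.single (ContinuousMap.const _ a) r, mem_cycles.mpr ⟨by simp, by simp⟩⟩, ?_⟩
    rw [Submodule.mem_bot, sub_eq_zero, eq_comm]
    exact augmentation_single _ r

end Contractible

/-! ### Complements of coordinate subspaces and induction on the codimension. -/

variable {m : ℕ}

/-- The points of Euclidean space with a nonzero coordinate among the first `j`. -/
def coordCompl (m j : ℕ) : Set (EuclideanSpace ℝ (Fin m)) := {x | ∃ i : Fin m, (i : ℕ) < j ∧ x i ≠ 0}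

/-- The complement of a closed half of a coordinate subspace. -/
def halfCompl (j : Fin m) (s : ℝ) : Set (EuclideanSpace ℝ (Fin m)) :=
  {x | 0 < s * x j} ∪ coordCompl m j

lemma coordCompl_zero : coordCompl m 0 = ∅ := by
  ext x; simp [coordCompl]

lemma coordCompl_self : coordCompl m m = {0}ᶜ := by
  ext x
  simp only [coordCompl, Set.mem_ofPred_eq, Set.mem_compl_iff, Set.mem_singleton_iff]
  constructor
  · rintro ⟨i, -, hi⟩ rfl
    exact hi rfl
  · intro h
    by_contra! h'
    exact h (by ext i; exact h' i i.2)

lemma isOpen_coordCompl (j : ℕ) : IsOpen (coordCompl m j) := by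
  have : coordCompl m j = ⋃ i : Fin m, ⋃ _ : (i : ℕ) < j, {x | x i ≠ 0} := by
    ext x; simp [coordCompl]
  rw [this]
  exact isOpen_iUnion fun i => isOpen_iUnion fun _ => isOpen_ne_fun (by fun_prop) continuous_const

lemma isOpen_halfCompl (j : Fin m) (s : ℝ) : IsOpen (halfCompl j s) :=
  (isOpen_lt continuous_const (by fun_prop)).union (isOpen_coordCompl _)

lemma halfCompl_union (j : Fin m) : halfCompl j (-1) ∪ halfCompl j 1 = coordCompl m (j + 1) := by
  ext x
  simp only [halfCompl, coordCompl, Set.mem_union, Set.mem_ofPred_eq]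
  constructor
  · rintro ((h | ⟨i, hi, h⟩) | (h | ⟨i, hi, h⟩))
    · exact ⟨j, by omega, by rintro h'; simp [h'] at h⟩
    · exact ⟨i, by omega, h⟩
    · exact ⟨j, by omega, by rintro h'; simp [h'] at h⟩
    · exact ⟨i, by omega, h⟩
  · rintro ⟨i, hi, h⟩
    rcases Nat.lt_succ_iff_lt_or_eq.mp hi with hi | hi
    · exact Or.inl (Or.inr ⟨i, hi, h⟩)
    · obtain rfl := Fin.ext hi
      rcases lt_or_gt_of_ne h with h | h
      · exact Or.inl (Or.inl (by linarith))
      · exact Or.inr (Or.inl (by linarith))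

lemma halfCompl_inter (j : Fin m) : halfCompl j (-1) ∩ halfCompl j 1 = coordCompl m j := by
  ext x
  simp only [halfCompl, Set.mem_inter_iff, Set.mem_union, Set.mem_ofPred_eq]
  constructor
  · rintro ⟨h | h, h' | h'⟩
    · linarith
    all_goals assumption
  · exact fun h => ⟨Or.inr h, Or.inr h⟩

/-- Contract linearly to the point with `j`-th coordinate `s` and all others zero. Coordinates of
index below `j` are only scaled by `1 - t`, so they stay nonzero until `t = 1`, when the `j`-th
coordinate takes over. -/
lemma isAcyclicPair_halfCompl (j : Fin m) {s : ℝ} (hs : 0 < s * s) :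
    IsAcyclicPair Set.univ (halfCompl j s) := by
  have key : ∀ (t : ℝ) (x : EuclideanSpace ℝ (Fin m)) (i : Fin m),
      ((1 - t) • x + t • EuclideanSpace.single j s) i = (1 - t) * x i + t * (if i = j then s else 0) := by
    intro t x i
    simp
  refine isAcyclicPair_of_deformation (h := fun t x => (1 - t) • x + t • EuclideanSpace.single j s)
    (Set.subset_univ _) (by fun_prop) (fun _ _ _ _ => Set.mem_univ _) ?_ (fun x _ => by simp) ?_
  · rintro t ⟨h0, h1⟩ x hx
    rcases h1.eq_or_lt with rfl | h1
    · left
      simp only [Set.mem_ofPred_eq, key]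
      simpa using hs
    rcases hx with hx | ⟨i, hi, hx⟩
    · left
      simp only [Set.mem_ofPred_eq, key, if_true] at hx ⊢
      have : s * ((1 - t) * x j + t * s) = (1 - t) * (s * x j) + t * (s * s) := by ring
      rw [this]
      exact add_pos_of_pos_of_nonneg (mul_pos (by linarith) hx) (mul_nonneg h0 hs.le)
    · right
      refine ⟨i, hi, ?_⟩
      have hij : i ≠ j := by rintro rfl; exact lt_irrefl _ hi
      rw [key, if_neg hij, mul_zero, add_zero]
      exact mul_ne_zero (by linarith) hx
  · intro x _
    left
    simp only [Set.mem_ofPred_eq, key]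
    simpa using hs

/-- Let `U_j` be `coordCompl m j` and `U₋`, `U₊` the complements of the two closed halves of the
subspace it omits. Then `U₋ ∪ U₊ = U_{j+1}` and `U₋ ∩ U₊ = U_j`, and `(ℝᵐ, U₋)`, `(ℝᵐ, U₊)` are
acyclic. Hence `H_{n+1}(ℝᵐ, U_{j+1}) ≅ H_n(U_{j+1}, U₊) ≅ H_n(U₋, U_j) ≅ H_n(ℝᵐ, U_j)`, the middle
step being excision. -/
lemma nonempty_equiv_coordCompl_succ (j : Fin m) (n : ℕ) :
    Nonempty (relH Set.univ (coordCompl m (j + 1)) (n + 1) ≃ₗ[ℝ]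
      relH Set.univ (coordCompl m j) n) := by
  obtain ⟨e1⟩ := (isAcyclicPair_halfCompl j (s := 1) (by norm_num)).nonempty_equiv_connecting
    (A := coordCompl m (j + 1)) (Set.subset_univ _)
    (by rw [← halfCompl_union]; exact Set.subset_union_right) n
  obtain ⟨e2⟩ := nonempty_equiv_excision_of_isOpen (isOpen_halfCompl j (-1))
    (isOpen_halfCompl j 1) n
  rw [halfCompl_union, halfCompl_inter] at e2
  obtain ⟨e3⟩ := (isAcyclicPair_halfCompl j (s := -1) (by norm_num)).nonempty_equiv_left
    (D := coordCompl m j) Set.subset_union_right n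
  exact ⟨e1.trans (e2.symm.trans e3)⟩

lemma isContraction_euclidean : IsContraction
    (fun (t : ℝ) (x : EuclideanSpace ℝ (Fin m)) => (1 - t) • x) 0 :=
  ⟨by fun_prop, by ext; simp, by ext; simp⟩

lemma nonempty_equiv_coordCompl (j : ℕ) (hj : j ≤ m) :
    Nonempty (relH Set.univ (coordCompl m j) j ≃ₗ[ℝ] ℝ) := by
  induction j with
  | zero => rw [coordCompl_zero]; exact isContraction_euclidean.nonempty_equiv
  | succ j ih =>
    obtain ⟨e1⟩ := ih (by omega)
    obtain ⟨e2⟩ := nonempty_equiv_coordCompl_succ (⟨j, hj⟩ : Fin m) j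
    exact ⟨e2.trans e1⟩

lemma subsingleton_relH_coordCompl (j : ℕ) (hj : j ≤ m) (n : ℕ) (hn : j < n) :
    Subsingleton (relH Set.univ (coordCompl m j) n) := by
  induction j generalizing n with
  | zero =>
    obtain ⟨n, rfl⟩ := Nat.exists_eq_succ_of_ne_zero hn.ne'
    rw [coordCompl_zero, subsingleton_relH_iff]
    exact isContraction_euclidean.cycles_le n
  | succ j ih =>
    obtain ⟨n, rfl⟩ := Nat.exists_eq_succ_of_ne_zero (Nat.ne_of_gt (Nat.zero_lt_of_lt hn))
    have := ih (by omega) n (by omega)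
    obtain ⟨e⟩ := nonempty_equiv_coordCompl_succ (⟨j, hj⟩ : Fin m) n
    exact e.toEquiv.subsingleton

lemma nonempty_equiv_compl_translate (y : EuclideanSpace ℝ (Fin m)) (n : ℕ) :
    Nonempty (relH Set.univ {y}ᶜ n ≃ₗ[ℝ] relH Set.univ ({0}ᶜ : Set (EuclideanSpace ℝ (Fin m))) n) := by
  refine nonempty_equiv_push (f := fun x => x - y) (g := fun x => x + y) (by fun_prop)
    (by fun_prop) (Set.subset_univ _) (Set.subset_univ _) (Set.mapsTo_univ _ _) ?_
    (Set.mapsTo_univ _ _) ?_ (fun x _ => by simp) (fun x _ => by simp) n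
  · intro x hx h
    exact hx (sub_eq_zero.mp h)
  · intro x hx h
    exact hx (by simpa using h)

/-- The local homology of `ℝᵐ` in degree `m`. -/
lemma nonempty_equiv_local_euclidean (y : EuclideanSpace ℝ (Fin m)) :
    Nonempty (relH Set.univ {y}ᶜ m ≃ₗ[ℝ] ℝ) := by
  obtain ⟨e⟩ := nonempty_equiv_compl_translate y m
  obtain ⟨e'⟩ := nonempty_equiv_coordCompl m le_rfl
  rw [coordCompl_self] at e'
  exact ⟨e.trans e'⟩

/-- The local homology of `ℝᵐ` vanishes in degrees above `m`. -/
lemma subsingleton_local_euclidean (y : EuclideanSpace ℝ (Fin m)) {n : ℕ} (hn : m < n) :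
    Subsingleton (relH Set.univ {y}ᶜ n) := by
  obtain ⟨e⟩ := nonempty_equiv_compl_translate y n
  have := subsingleton_relH_coordCompl m le_rfl n hn
  rw [coordCompl_self] at this
  exact e.toEquiv.subsingleton

end Euclidean

/-! ## Local homology at manifold points and strata -/

section LocalHomology

variable {X : Type u} [TopologicalSpace X] {Y : Type v} [TopologicalSpace Y]

/-- Excision into the source of a chart, for the complements of closed sets in the source. -/
lemma nonempty_equiv_source {U L K : Set X} (hU : IsOpen U) (hLK : L ⊆ K) (hK : K ⊆ U)
    (hL' : IsClosed L) (hK' : IsClosed K) (n : ℕ) :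
    Nonempty (relH (U \ L) (U \ K) n ≃ₗ[ℝ] relH Lᶜ Kᶜ n) := by
  have h := nonempty_equiv_excision_of_isOpen (hU.sdiff hL') hK'.isOpen_compl n
  have h1 : (U \ L) ∩ Kᶜ = U \ K := by
    ext x
    exact ⟨fun h => ⟨h.1.1, h.2⟩, fun h => ⟨⟨h.1, fun h' => h.2 (hLK h')⟩, h.2⟩⟩
  have h2 : (U \ L) ∪ Kᶜ = Lᶜ := by
    ext x
    constructor
    · rintro (h | h)
      · exact h.2
      · exact fun h' => h (hLK h')
    · intro h
      by_cases hx : x ∈ K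
      · exact Or.inl ⟨hK hx, h⟩
      · exact Or.inr hx
  rwa [h1, h2] at h

/-- The homology of complements of closed sets in the source of a chart. -/
lemma nonempty_equiv_chart (e : OpenPartialHomeomorph X Y) {L K : Set X} (hLK : L ⊆ K)
    (hK : K ⊆ e.source) (hL' : IsClosed L) (hK' : IsClosed K) (heL : IsClosed (e '' L))
    (heK : IsClosed (e '' K)) (n : ℕ) :
    Nonempty (relH Lᶜ Kᶜ n ≃ₗ[ℝ] relH (e '' L)ᶜ (e '' K)ᶜ n) := by
  obtain ⟨e1⟩ := nonempty_equiv_source e.open_source hLK hK hL' hK' n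
  obtain ⟨e2⟩ := nonempty_equiv_source e.open_target (Set.image_mono hLK)
    (by rintro _ ⟨x, hx, rfl⟩; exact e.map_source (hK hx)) heL heK n
  have key : ∀ T ⊆ K, Set.MapsTo e (e.source \ T) (e.target \ e '' T) := by
    rintro T hT x ⟨hx, hxT⟩
    refine ⟨e.map_source hx, ?_⟩
    rintro ⟨y, hy, hyx⟩
    exact hxT (e.injOn (hK (hT hy)) hx hyx ▸ hy)
  have key' : ∀ T ⊆ K, Set.MapsTo e.symm (e.target \ e '' T) (e.source \ T) := by
    rintro T hT y ⟨hy, hyT⟩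
    exact ⟨e.map_target hy, fun h => hyT ⟨_, h, e.right_inv hy⟩⟩
  obtain ⟨e3⟩ := nonempty_equiv_push (e.continuousOn.mono Set.sdiff_subset)
    (e.continuousOn_symm.mono Set.sdiff_subset) (Set.sdiff_subset_sdiff_right hLK)
    (Set.sdiff_subset_sdiff_right (Set.image_mono hLK)) (key L hLK) (key K subset_rfl)
    (key' L hLK) (key' K subset_rfl) (fun x hx => e.left_inv hx.1)
    (fun x hx => e.right_inv hx.1) n
  exact ⟨e1.symm.trans (e3.trans e2)⟩

lemma nonempty_equiv_chart_point [T1Space X] [T1Space Y] (e : OpenPartialHomeomorph X Y) {x : X}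
    (hx : x ∈ e.source) (n : ℕ) :
    Nonempty (relH Set.univ {x}ᶜ n ≃ₗ[ℝ] relH Set.univ {e x}ᶜ n) := by
  have := nonempty_equiv_chart e (Set.empty_subset {x}) (by simpa using hx) isClosed_empty
    isClosed_singleton (by simp) (by simp) n
  rwa [Set.image_empty, Set.image_singleton, Set.compl_empty, Set.compl_empty] at this

lemma nonempty_equiv_local [T1Space X] {m : ℕ}
    (e : OpenPartialHomeomorph X (EuclideanSpace ℝ (Fin m))) {x : X} (hx : x ∈ e.source) :
    Nonempty (relH Set.univ {x}ᶜ m ≃ₗ[ℝ] ℝ) := by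
  obtain ⟨e1⟩ := nonempty_equiv_chart_point e hx m
  obtain ⟨e2⟩ := nonempty_equiv_local_euclidean (e x)
  exact ⟨e1.trans e2⟩

lemma subsingleton_local [T1Space X] {m : ℕ}
    (e : OpenPartialHomeomorph X (EuclideanSpace ℝ (Fin m))) {x : X} (hx : x ∈ e.source) {n : ℕ}
    (hn : m < n) : Subsingleton (relH Set.univ {x}ᶜ n) := by
  obtain ⟨e1⟩ := nonempty_equiv_chart_point e hx n
  have := subsingleton_local_euclidean (e x) hn
  exact e1.toEquiv.subsingleton

/-- Push points radially away from `y`, increasing the distance to `y` by `s * R`. At time `1` the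
distance exceeds `R`, so the point has left `K`. Points outside `K` stay outside because `K` is
star-shaped about `y`. -/
lemma isAcyclicPair_compl_convex {E : Type v} [NormedAddCommGroup E] [NormedSpace ℝ E] {K : Set E}
    (hK : Convex ℝ K) {y : E} (hy : y ∈ K) {R : ℝ} (hR : 0 ≤ R)
    (hKR : K ⊆ Metric.closedBall y R) : IsAcyclicPair ({y}ᶜ : Set E) Kᶜ := by
  have hpos : ∀ s ∈ Set.Icc (0 : ℝ) 1, ∀ z : E, 1 ≤ 1 + s * R / ‖z - y‖ := fun s hs z =>
    le_add_of_nonneg_right (div_nonneg (mul_nonneg hs.1 hR) (norm_nonneg _))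
  refine isAcyclicPair_of_deformation (h := fun s z => y + (1 + s * R / ‖z - y‖) • (z - y))
    ?_ ?_ ?_ ?_ ?_ ?_
  · rintro z hz rfl
    exact hz hy
  · have h1 : ContinuousOn (fun p : ℝ × E => ‖p.2 - y‖) (Set.Icc 0 1 ×ˢ {y}ᶜ) := by fun_prop
    refine continuousOn_const.add ((continuousOn_const.add (ContinuousOn.div (by fun_prop) h1
      fun p hp => ?_)).smul (by fun_prop))
    exact norm_ne_zero_iff.mpr (sub_ne_zero.mpr hp.2)
  · intro s hs z hz h
    have h' : (1 + s * R / ‖z - y‖) • (z - y) = 0 := by simpa using h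
    rcases smul_eq_zero.mp h' with h' | h'
    · linarith [hpos s hs z]
    · exact hz (sub_eq_zero.mp h')
  · intro s hs z hz h
    apply hz
    have h1 := hpos s hs z
    set l := 1 + s * R / ‖z - y‖ with hl
    have h2 := hK.add_smul_sub_mem hy h (t := l⁻¹) ⟨by positivity, inv_le_one_of_one_le₀ h1⟩
    rw [add_sub_cancel_left, smul_smul, inv_mul_cancel₀ (by positivity), one_smul] at h2
    simpa using h2
  · intro z _
    simp
  · intro z hz h
    have hz' : 0 < ‖z - y‖ := norm_pos_iff.mpr (sub_ne_zero.mpr hz)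
    have h1 := hKR h
    rw [Metric.mem_closedBall, dist_eq_norm, add_sub_cancel_left, norm_smul,
      Real.norm_of_nonneg (zero_le_one.trans (hpos 1 ⟨zero_le_one, le_rfl⟩ z)), one_mul,
      add_mul, div_mul_cancel₀ _ hz'.ne'] at h1
    linarith

/-- Around each point of the source of a chart the local homology is locally constant. -/
lemma exists_isAcyclicPair_compl [T2Space X] {m : ℕ}
    (e : OpenPartialHomeomorph X (EuclideanSpace ℝ (Fin m))) {x : X} (hx : x ∈ e.source) :
    ∃ N K : Set X, IsOpen N ∧ x ∈ N ∧ IsPreconnected N ∧ N ⊆ K ∧ K ⊆ e.source ∧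
      ∀ y ∈ N, IsAcyclicPair {y}ᶜ Kᶜ := by
  obtain ⟨r, hr, hball⟩ := Metric.nhds_basis_closedBall.mem_iff.mp
    (e.open_target.mem_nhds (e.map_source hx))
  have hball' : Metric.ball (e x) r ⊆ e.target := Metric.ball_subset_closedBall.trans hball
  have hKs : e.symm '' Metric.closedBall (e x) r ⊆ e.source := by
    rintro _ ⟨z, hz, rfl⟩
    exact e.map_target (hball hz)
  have himage : e '' (e.symm '' Metric.closedBall (e x) r) = Metric.closedBall (e x) r := by
    rw [Set.image_image]
    exact (Set.image_congr fun z hz => e.right_inv (hball hz)).trans (Set.image_id _)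
  -- The image of the closed ball is compact, hence closed in the Hausdorff space `X`, as excision
  -- requires.
  have hKc : IsClosed (e.symm '' Metric.closedBall (e x) r) :=
    ((isCompact_closedBall (e x) r).image_of_continuousOn
      (e.continuousOn_symm.mono hball)).isClosed
  refine ⟨e.symm '' Metric.ball (e x) r, e.symm '' Metric.closedBall (e x) r,
    e.symm.isOpen_image_of_subset_source Metric.isOpen_ball hball',
    ⟨e x, Metric.mem_ball_self hr, e.left_inv hx⟩,
    (convex_ball (e x) r).isPreconnected.image _ (e.continuousOn_symm.mono hball'),
    Set.image_mono Metric.ball_subset_closedBall, hKs, ?_⟩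
  rintro _ ⟨z, hz, rfl⟩
  have hzK := Metric.ball_subset_closedBall hz
  have hsub : ({e.symm z} : Set X) ⊆ e.symm '' Metric.closedBall (e x) r :=
    Set.singleton_subset_iff.mpr ⟨z, hzK, rfl⟩
  have hez : e '' {e.symm z} = {z} := by rw [Set.image_singleton, e.right_inv (hball hzK)]
  refine ⟨Set.compl_subset_compl.mpr hsub, fun n => ?_⟩
  rw [← subsingleton_relH_iff]
  obtain ⟨e1⟩ := nonempty_equiv_chart e hsub hKs isClosed_singleton hKc
    (by rw [hez]; exact isClosed_singleton) (by rw [himage]; exact Metric.isClosed_closedBall) n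
  rw [hez, himage] at e1
  -- A closed ball of radius `r` lies within distance `2 * r` of each of its points.
  have hac := isAcyclicPair_compl_convex (convex_closedBall (e x) r) hzK (R := 2 * r)
    (by positivity) (fun w hw => by
      rw [Metric.mem_closedBall] at hw hzK ⊢
      linarith [dist_triangle_right w z (e x)])
  have := subsingleton_relH_iff.mpr (hac.le n)
  exact e1.toEquiv.subsingleton

/-- Locally around a manifold point, the vanishing of the restriction of a class to the local
homology does not depend on the point. -/
lemma exists_nhd_mem_bounds_iff [T2Space X] {d n : ℕ} {x : X} (hx : x ∈ manifoldPoints X d) :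
    ∃ N, IsOpen N ∧ x ∈ N ∧ IsPreconnected N ∧ N ⊆ manifoldPoints X d ∧ ∀ y ∈ N,
      ∀ c ∈ cycles Set.univ (singularPart X d) n,
        (c ∈ bounds Set.univ {y}ᶜ n ↔ c ∈ bounds Set.univ {x}ᶜ n) := by
  obtain ⟨e, hx⟩ := hx
  obtain ⟨N, K, hN, hxN, hNc, hNK, hK, h⟩ := exists_isAcyclicPair_compl e hx
  have hKm : K ⊆ manifoldPoints X d := fun z hz => ⟨e, hK hz⟩
  refine ⟨N, hN, hxN, hNc, hNK.trans hKm, fun y hy c hc => ?_⟩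
  have hc' : c ∈ cycles Set.univ Kᶜ n :=
    cycles_mono subset_rfl (Set.compl_subset_compl.mpr hKm) n hc
  -- Vanishing at `z` is equivalent to vanishing in `H_n(X, X ∖ K)`, a condition that does not
  -- involve `z`.
  have key : ∀ z ∈ N, c ∈ bounds Set.univ {z}ᶜ n ↔ c ∈ bounds Set.univ Kᶜ n := fun z hz =>
    ⟨(h z hz).mem_bounds_of_mem (Set.subset_univ _) hc',
      fun h' => bounds_mono subset_rfl (h z hz).subset n h'⟩
  rw [key y hy, key x hxN]

/-- By local constancy the manifold points where the class vanishes and those where it does not form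
two disjoint open sets, so a preconnected set meets at most one. -/
lemma mem_bounds_iff_of_isPreconnected [T2Space X] {d n : ℕ} {S : Set X} (hS : IsPreconnected S)
    (hSm : S ⊆ manifoldPoints X d) {x y : X} (hx : x ∈ S) (hy : y ∈ S) {c : Chain X n}
    (hc : c ∈ cycles Set.univ (singularPart X d) n) (h : c ∈ bounds Set.univ {x}ᶜ n) :
    c ∈ bounds Set.univ {y}ᶜ n := by
  have hopen : ∀ p : Prop, IsOpen {z | z ∈ manifoldPoints X d ∧
      (c ∈ bounds Set.univ {z}ᶜ n ↔ p)} := by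
    intro p
    rw [isOpen_iff_forall_mem_open]
    rintro z ⟨hz, hzp⟩
    obtain ⟨N, hN, hzN, -, hNm, h⟩ := exists_nhd_mem_bounds_iff (n := n) hz
    exact ⟨N, fun w hw => ⟨hNm hw, (h w hw c hc).trans hzp⟩, hN, hzN⟩
  have := hS.subset_left_of_subset_union (hopen True) (hopen False) ?_ ?_ ⟨x, hx, hSm hx, by simpa⟩
  · simpa using (this hy).2
  · rw [Set.disjoint_left]
    rintro z ⟨-, h1⟩ ⟨-, h2⟩
    simp_all
  · intro z hz
    by_cases hzc : c ∈ bounds Set.univ {z}ᶜ n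
    · exact Or.inl ⟨hSm hz, by simpa⟩
    · exact Or.inr ⟨hSm hz, by simpa⟩

/-! ### Strata and their hyperplanes. -/

variable {d : ℕ}

lemma Stratum.isPreconnected (S : Stratum X d) : IsPreconnected S.1 := by
  obtain ⟨S, y, _, rfl⟩ := S
  exact isPreconnected_connectedComponentIn

lemma Stratum.subset_manifoldPoints (S : Stratum X d) : S.1 ⊆ manifoldPoints X d := by
  obtain ⟨S, y, _, rfl⟩ := S
  exact connectedComponentIn_subset _ _

lemma Stratum.nonempty (S : Stratum X d) : S.1.Nonempty := by
  obtain ⟨S, y, hy, rfl⟩ := S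
  exact ⟨y, mem_connectedComponentIn hy⟩

lemma Stratum.subset_of_isPreconnected (S : Stratum X d) {T : Set X} (hT : IsPreconnected T)
    (hTm : T ⊆ manifoldPoints X d) {x : X} (hx : x ∈ S.1) (hxT : x ∈ T) : T ⊆ S.1 := by
  obtain ⟨S, y, hy, rfl⟩ := S
  exact (hT.subset_connectedComponentIn hxT hTm).trans_eq (connectedComponentIn_eq hx).symm

lemma Stratum.isOpen [T2Space X] (S : Stratum X d) : IsOpen S.1 := by
  rw [isOpen_iff_forall_mem_open]
  intro x hx
  obtain ⟨N, hN, hxN, hNc, hNm, -⟩ := exists_nhd_mem_bounds_iff (n := 0)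
    (S.subset_manifoldPoints hx)
  exact ⟨N, S.subset_of_isPreconnected hNc hNm hx hxN, hN, hxN⟩

lemma Stratum.eq_of_mem {S T : Stratum X d} {x : X} (hS : x ∈ S.1) (hT : x ∈ T.1) : S = T :=
  Subtype.ext (subset_antisymm
    (T.subset_of_isPreconnected S.isPreconnected S.subset_manifoldPoints hT hS)
    (S.subset_of_isPreconnected T.isPreconnected T.subset_manifoldPoints hS hT))

/-- The relative homology agrees with that of the concrete model. -/
lemma nonempty_relHomology_equiv (A B : Set X) (n : ℕ) :
    Nonempty (RelHomology A B n ≃ₗ[ℝ] relH A B n) := by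
  refine nonempty_quotient_equiv _ _ ((chainEquiv X n).toLinearMap.restrict
    (p := relCycles A B n) (q := cycles A B n) fun c hc => mem_relCycles_iff.mp hc) ?_ ?_
  · intro c
    exact mem_relBoundaries_iff
  · rintro ⟨c, hc⟩
    refine ⟨⟨(chainEquiv X n).symm c, mem_relCycles_iff.mpr (by simpa using hc)⟩, ?_⟩
    refine (Submodule.Quotient.eq _).mp (congrArg _ ?_)
    exact Subtype.ext ((chainEquiv X n).apply_symm_apply c).symm

/-- The class in `C_d` of a relative cycle. -/
def topClass (c : Chain X d) (hc : c ∈ cycles Set.univ (singularPart X d) d) : TopChains X d :=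
  Submodule.Quotient.mk ⟨(chainEquiv X d).symm c, mem_relCycles_iff.mpr (by simpa using hc)⟩

lemma topClass_surjective (a : TopChains X d) : ∃ c hc, a = topClass c hc := by
  obtain ⟨⟨c, hc⟩, rfl⟩ := Submodule.Quotient.mk_surjective _ a
  refine ⟨chainEquiv X d c, mem_relCycles_iff.mp hc, ?_⟩
  congr 1
  exact Subtype.ext ((chainEquiv X d).symm_apply_apply c).symm

lemma inclusionMap_topClass_eq_zero_iff {A B : Set X} (hA : Set.univ ⊆ A)
    (hB : singularPart X d ⊆ B) {c : Chain X d} (hc : c ∈ cycles Set.univ (singularPart X d) d) :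
    inclusionMap hA hB d (topClass c hc) = 0 ↔ c ∈ bounds A B d := by
  refine (Submodule.Quotient.mk_eq_zero _).trans ?_
  change (chainEquiv X d).symm c ∈ relBoundaries A B d ↔ _
  rw [mem_relBoundaries_iff, LinearEquiv.apply_symm_apply]

/-- One point of the stratum decides, and it may be chosen freely; `mem_map_cellularCycles_iff`
takes it inside an open `d`-cell. -/
lemma topClass_mem_hyperplane_iff [T2Space X] (S : Stratum X d) {c : Chain X d}
    (hc : c ∈ cycles Set.univ (singularPart X d) d) {x : X} (hx : x ∈ S.1) :
    topClass c hc ∈ S.hyperplane ↔ c ∈ bounds Set.univ {x}ᶜ d := by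
  rw [Stratum.hyperplane, Submodule.mem_iInf]
  simp only [LinearMap.mem_ker, inclusionMap_topClass_eq_zero_iff]
  exact ⟨fun h => h ⟨x, hx⟩, fun h y => mem_bounds_iff_of_isPreconnected S.isPreconnected
    S.subset_manifoldPoints hx y.2 hc h⟩

lemma Stratum.hyperplane_eq_ker [T2Space X] (S : Stratum X d) {x : X} (hx : x ∈ S.1) :
    S.hyperplane =
      LinearMap.ker (inclusionMap (subset_refl Set.univ) (S.singularPart_subset hx) d) := by
  ext a
  obtain ⟨c, hc, rfl⟩ := topClass_surjective a
  rw [topClass_mem_hyperplane_iff S hc hx, LinearMap.mem_ker, inclusionMap_topClass_eq_zero_iff]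

/-- The hyperplane of a stratum is the kernel of a linear functional. -/
lemma Stratum.exists_ker_eq_hyperplane [T2Space X] (S : Stratum X d) :
    ∃ φ : TopChains X d →ₗ[ℝ] ℝ, LinearMap.ker φ = S.hyperplane := by
  obtain ⟨x, hx⟩ := S.nonempty
  obtain ⟨e, he⟩ := S.subset_manifoldPoints hx
  obtain ⟨e1⟩ := nonempty_relHomology_equiv (Set.univ : Set X) {x}ᶜ d
  obtain ⟨e2⟩ := nonempty_equiv_local e he
  refine ⟨(e1.trans e2).toLinearMap ∘ₗ
    inclusionMap (subset_refl Set.univ) (S.singularPart_subset hx) d, ?_⟩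
  rw [S.hyperplane_eq_ker hx, LinearEquiv.ker_comp]

lemma exists_isCoordinateSystem [T2Space X] :
    ∃ φ : CoordStratum X d → (TopChains X d →ₗ[ℝ] ℝ), IsCoordinateSystem φ := by
  choose φ hφ using fun S : CoordStratum X d => S.1.exists_ker_eq_hyperplane
  exact ⟨φ, hφ⟩

end LocalHomology

/-! ## Regular cell complexes -/

section RegularComplex

open CWComplex

variable {X : Type u} [TopologicalSpace X] [T2Space X] [CWComplex (Set.univ : Set X)]

/-- The `(k-1)`-skeleton together with a set of `k`-cells. -/
def skelWith (k : ℕ) (s : Set (cell (Set.univ : Set X) k)) : Set X :=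
  skelLT X k ∪ ⋃ j ∈ s, closedCell k j

lemma disjoint_skelLT_openCell {k m : ℕ} (h : k ≤ m) (i : cell (Set.univ : Set X) m) :
    Disjoint (skelLT X k) (openCell m i) :=
  RelCWComplex.disjoint_skeletonLT_openCell (by exact_mod_cast h)

lemma disjoint_skelWith_openCell {k : ℕ} {s : Set (cell (Set.univ : Set X) k)}
    {i : cell (Set.univ : Set X) k} (hi : i ∉ s) : Disjoint (skelWith k s) (openCell k i) := by
  rw [skelWith, Set.disjoint_union_left]
  refine ⟨disjoint_skelLT_openCell le_rfl i, ?_⟩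
  simp only [Set.disjoint_iUnion_left]
  intro j hj
  rw [← RelCWComplex.cellFrontier_union_openCell_eq_closedCell, Set.disjoint_union_left]
  refine ⟨(disjoint_skelLT_openCell le_rfl i).mono_left
    (RelCWComplex.cellFrontier_subset_skeletonLT _ _), ?_⟩
  refine RelCWComplex.disjoint_openCell_of_ne fun h => hi ?_
  have : j = i := by simpa using h
  exact this ▸ hj

lemma skelWith_insert {k : ℕ} (s : Set (cell (Set.univ : Set X) k))
    (i : cell (Set.univ : Set X) k) : skelWith k (insert i s) = skelWith k s ∪ closedCell k i := by
  rw [skelWith, skelWith, Set.biUnion_insert, Set.union_assoc, Set.union_comm (closedCell k i)]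

lemma skelWith_empty (k : ℕ) : skelWith k (∅ : Set (cell (Set.univ : Set X) k)) = skelLT X k := by
  simp [skelWith]

lemma skelWith_univ (k : ℕ) :
    skelWith k (Set.univ : Set (cell (Set.univ : Set X) k)) = skelLT X (k + 1) := by
  have := RelCWComplex.skeletonLT_union_iUnion_closedCell_eq_skeletonLT_succ
    (C := (Set.univ : Set X)) k
  simp only [skelWith, Set.mem_univ, Set.iUnion_true]
  rw [this]
  simp [skelLT]

lemma cellFrontier_subset_skelWith {k : ℕ} (s : Set (cell (Set.univ : Set X) k))
    (i : cell (Set.univ : Set X) k) : cellFrontier k i ⊆ skelWith k s :=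
  (RelCWComplex.cellFrontier_subset_skeletonLT k i).trans Set.subset_union_left

lemma isClosed_skelWith (d : ℕ) [IsRegularComplex X d] {k : ℕ}
    (s : Set (cell (Set.univ : Set X) k)) : IsClosed (skelWith k s) := by
  have := IsRegularComplex.finite_cell (X := X) (d := d) k
  exact (skeletonLT (Set.univ : Set X) k).closed.union
    (s.toFinite.isClosed_biUnion fun j _ => RelCWComplex.isClosed_closedCell)

omit [T2Space X] in
lemma target_map {k : ℕ} (i : cell (Set.univ : Set X) k) :
    (map (C := (Set.univ : Set X)) k i).target = openCell k i := by
  have hs : (map (C := (Set.univ : Set X)) k i).source = Metric.ball 0 1 := source_eq k i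
  rw [← PartialEquiv.image_source_eq_target, hs]
  rfl

omit [T2Space X] in
lemma exists_mem_openCell (x : X) : ∃ (m : ℕ) (i : cell (Set.univ : Set X) m), x ∈ openCell m i := by
  have hx : x ∈ ⋃ (n : ℕ) (j : cell (Set.univ : Set X) n), openCell n j := by
    rw [CWComplex.iUnion_openCell_eq_complex]
    trivial
  simpa only [Set.mem_iUnion] using hx

omit [T2Space X] in
lemma dim_le (d : ℕ) [IsRegularComplex X d] {m : ℕ} (i : cell (Set.univ : Set X) m) : m ≤ d := by
  by_contra h
  exact (IsRegularComplex.isEmpty_cell (X := X) (d := d) m (not_le.mp h)).false i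

/-- An open set meeting no cells of dimension above `m` meets each open `m`-cell in an open set. -/
lemma isOpen_inter_openCell (d : ℕ) [IsRegularComplex X d] {U : Set X} (hU : IsOpen U) {m : ℕ}
    (h : ∀ k, m < k → ∀ j : cell (Set.univ : Set X) k, Disjoint U (openCell k j))
    (i : cell (Set.univ : Set X) m) : IsOpen (U ∩ openCell m i) := by
  -- The lower skeleton together with the other `m`-cells is closed, and inside `U` its complement
  -- is exactly the open cell `i`.
  convert hU.inter (isClosed_skelWith d {i}ᶜ).isOpen_compl using 1
  ext x
  refine and_congr_right fun hx =>
    ⟨fun hi h' => Set.disjoint_left.mp (disjoint_skelWith_openCell (by simp)) h' hi, fun hi => ?_⟩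
  obtain ⟨k, j, hj⟩ := exists_mem_openCell x
  rcases lt_trichotomy k m with hk | rfl | hk
  · exact absurd (Or.inl (CWComplex.mem_skeletonLT_iff.mpr ⟨k, by exact_mod_cast hk, j, hj⟩)) hi
  · by_cases hji : j = i
    · exact hji ▸ hj
    · exact absurd (Or.inr (Set.mem_biUnion (x := j) hji
        (RelCWComplex.openCell_subset_closedCell _ _ hj))) hi
  · exact absurd hj (Set.disjoint_left.mp (h k hk j) hx)

/-- Every nonempty open set contains a point of an open cell at which the space is a manifold of
the dimension of that cell. -/
lemma exists_openCell_inter (d : ℕ) [IsRegularComplex X d] {U : Set X} (hU : IsOpen U)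
    (hne : U.Nonempty) : ∃ (m : ℕ) (i : cell (Set.univ : Set X) m),
      (U ∩ openCell m i ∩ manifoldPoints X m).Nonempty := by
  classical
  let p : ℕ → Prop := fun m => ∃ i : cell (Set.univ : Set X) m, (U ∩ openCell m i).Nonempty
  obtain ⟨x, hx⟩ := hne
  obtain ⟨n, j, hj⟩ := exists_mem_openCell x
  have hn : p n := ⟨j, x, hx, hj⟩
  -- Take a cell of the largest dimension among those meeting `U`. Its trace on `U` is then open in
  -- `X`, and the characteristic map restricts to a chart there.
  obtain ⟨i, y, hyU, hy⟩ : p (Nat.findGreatest p d) := Nat.findGreatest_spec (dim_le d j) hn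
  have hmax : ∀ k, Nat.findGreatest p d < k → ∀ j : cell (Set.univ : Set X) k,
      Disjoint U (openCell k j) := by
    intro k hk j
    rw [Set.disjoint_iff_inter_eq_empty, ← Set.not_nonempty_iff_eq_empty]
    exact fun h => Nat.findGreatest_is_greatest hk (dim_le d j) ⟨j, h⟩
  refine ⟨_, i, y, ⟨hyU, hy⟩, ?_⟩
  generalize Nat.findGreatest p d = m at *
  let E := (map (C := (Set.univ : Set X)) m i).symm.restr U
  have hsrc : E.source = openCell m i ∩ U := by
    rw [← target_map]
    rfl
  have htgt : E.target = Metric.ball 0 1 ∩ map (C := (Set.univ : Set X)) m i ⁻¹' U := by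
    rw [← source_eq m i]
    rfl
  let e : OpenPartialHomeomorph X (Fin m → ℝ) :=
    { toPartialEquiv := E
      open_source := by
        rw [hsrc, Set.inter_comm]
        exact isOpen_inter_openCell d hU hmax i
      open_target := by
        rw [htgt]
        exact ((continuousOn m i).mono Metric.ball_subset_closedBall).isOpen_inter_preimage
          Metric.isOpen_ball hU
      continuousOn_toFun := (continuousOn_symm m i).mono (by
        rw [hsrc, ← target_map]
        exact Set.inter_subset_left)
      continuousOn_invFun := (continuousOn m i).mono (by
        rw [htgt]
        exact Set.inter_subset_left.trans Metric.ball_subset_closedBall) }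
  refine ⟨e.transHomeomorph (PiLp.homeomorph 2 (fun _ : Fin m => ℝ)).symm, ?_⟩
  change y ∈ E.source
  rw [hsrc]
  exact ⟨hy, hyU⟩

/-- Invariance of dimension: a `k`-chart makes the local homology in degree `k` equal to `ℝ`, while
an `m`-chart with `m < k` makes it vanish. -/
lemma le_of_mem_manifoldPoints {Z : Type u} [TopologicalSpace Z] [T1Space Z] {k m : ℕ} {x : Z}
    (hk : x ∈ manifoldPoints Z k) (hm : x ∈ manifoldPoints Z m) : k ≤ m := by
  obtain ⟨e, he⟩ := hk
  obtain ⟨e', he'⟩ := hm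
  by_contra! h
  obtain ⟨l⟩ := nonempty_equiv_local e he
  have := subsingleton_local e' he' h
  exact not_subsingleton ℝ l.symm.toEquiv.subsingleton

/-- A nonempty open set of `k`-manifold points meets an open `k`-cell. -/
lemma exists_openCell_inter_of_subset (d : ℕ) [IsRegularComplex X d] {U : Set X} (hU : IsOpen U)
    (hne : U.Nonempty) {k : ℕ} (hk : U ⊆ manifoldPoints X k) :
    ∃ i : cell (Set.univ : Set X) k, (U ∩ openCell k i).Nonempty := by
  obtain ⟨m, i, x, ⟨hxU, hxi⟩, hx⟩ := exists_openCell_inter d hU hne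
  obtain rfl := le_antisymm (le_of_mem_manifoldPoints (hk hxU) hx)
    (le_of_mem_manifoldPoints hx (hk hxU))
  exact ⟨i, x, hxU, hxi⟩

variable {d : ℕ} [IsRegularComplex X d]

lemma openCell_subset_manifoldPoints (i : cell (Set.univ : Set X) d) :
    openCell d i ⊆ manifoldPoints X d := by
  intro x hx
  by_contra h
  exact Set.disjoint_left.mp (disjoint_skelLT_openCell le_rfl i)
    (singularPart_subset_skelLT (d := d) h) hx

lemma Stratum.exists_mem_openCell (S : Stratum X d) :
    ∃ i : cell (Set.univ : Set X) d, (S.1 ∩ openCell d i).Nonempty :=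
  exists_openCell_inter_of_subset d S.isOpen S.nonempty S.subset_manifoldPoints

omit [T2Space X] in
lemma isPreconnected_openCell {k : ℕ} (i : cell (Set.univ : Set X) k) :
    IsPreconnected (openCell k i) :=
  (convex_ball (0 : Fin k → ℝ) 1).isPreconnected.image _
    ((continuousOn k i).mono Metric.ball_subset_closedBall)

variable (X d) in
-- An open `d`-cell is connected and consists of manifold points, so it lies in one stratum.
-- Choosing for each stratum a `d`-cell that it meets is therefore injective.
lemma finite_coordStratum : Finite (CoordStratum X d) := by
  have := IsRegularComplex.finite_cell (X := X) (d := d) d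
  have h : Finite (Stratum X d) := by
    choose i hi using fun S : Stratum X d => S.exists_mem_openCell
    refine Finite.of_injective i fun S T h => ?_
    obtain ⟨x, hxS, hx⟩ := hi S
    obtain ⟨y, hyT, hy⟩ := hi T
    rw [← h] at hy
    exact Stratum.eq_of_mem (S.subset_of_isPreconnected (isPreconnected_openCell _)
      (openCell_subset_manifoldPoints _) hxS hx hy) hyT
  exact Subtype.finite

lemma apply_mem_manifoldPoints {Z : Type v} {W : Type w} [TopologicalSpace Z] [TopologicalSpace W]
    (f : Z ≃ₜ W) {k : ℕ} {z : Z} (hz : z ∈ manifoldPoints Z k) : f z ∈ manifoldPoints W k := by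
  obtain ⟨e, he⟩ := hz
  exact ⟨f.symm.transOpenPartialHomeomorph e, by simpa using he⟩

lemma image_manifoldPoints {Z : Type v} {W : Type w} [TopologicalSpace Z] [TopologicalSpace W]
    (f : Z ≃ₜ W) (k : ℕ) : f '' manifoldPoints Z k = manifoldPoints W k := by
  refine subset_antisymm ?_ fun w hw =>
    ⟨f.symm w, apply_mem_manifoldPoints f.symm hw, f.apply_symm_apply w⟩
  rintro _ ⟨z, hz, rfl⟩
  exact apply_mem_manifoldPoints f hz

/-- The image of an open `d`-cell is a nonempty open set of `d`-manifold points of `Y`, so it meets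
an open `d`-cell of `Y`. -/
lemma dim_le_of_homeomorph {Y : Type v} [TopologicalSpace Y] [T2Space Y]
    [CWComplex (Set.univ : Set Y)] {d' : ℕ} [IsRegularComplex Y d'] (f : X ≃ₜ Y) : d ≤ d' := by
  obtain ⟨i⟩ := IsRegularComplex.nonempty_cell (X := X) (d := d)
  obtain ⟨j, -⟩ := exists_openCell_inter_of_subset (X := Y) d' (U := f '' openCell d i) (k := d)
    (f.isOpen_image.mpr (isOpen_openCell i))
    (Set.Nonempty.image _ ⟨_, RelCWComplex.map_zero_mem_openCell d i⟩)
    ((Set.image_mono (openCell_subset_manifoldPoints i)).trans_eq (image_manifoldPoints f d))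
  exact dim_le d' j

end RegularComplex

/-! ## Cellular cycles -/

section CellularCycles

open CWComplex

variable {X : Type u} [TopologicalSpace X] [T2Space X]

/-! ### Attaching a cell along an embedded closed ball. -/

/-- An injective continuous map on a compact set has a continuous inverse on its image. -/
lemma exists_continuousOn_leftInvOn {E : Type v} [TopologicalSpace E] [Nonempty E] {K : Set E}
    (hK : IsCompact K) {f : E → X} (hf : ContinuousOn f K) (hinj : Set.InjOn f K) :
    ∃ g : X → E, ContinuousOn g (f '' K) ∧ Set.LeftInvOn g f K := by
  refine ⟨Function.invFunOn f K, ?_, hinj.leftInvOn_invFunOn⟩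
  rw [continuousOn_iff_isClosed]
  intro t ht
  refine ⟨f '' (K ∩ t), (hK.inter_right ht |>.image_of_continuousOn
    (hf.mono Set.inter_subset_left)).isClosed, ?_⟩
  ext x
  constructor
  · rintro ⟨hx, w, hw, rfl⟩
    rw [Set.mem_preimage, hinj.leftInvOn_invFunOn hw] at hx
    exact ⟨⟨w, ⟨hw, hx⟩, rfl⟩, w, hw, rfl⟩
  · rintro ⟨⟨w, ⟨hw, hwt⟩, rfl⟩, hx⟩
    refine ⟨?_, hx⟩
    rwa [Set.mem_preimage, hinj.leftInvOn_invFunOn hw]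

/-- `A'` and `B'` witness that `A` and `B` are closed relative to `A ∪ B`, which is all that gluing
needs. A cell with its centre removed is closed only in this sense. -/
lemma continuousOn_union_of_isClosed {Z : Type v} {W : Type w} [TopologicalSpace Z]
    [TopologicalSpace W] {f : Z → W} {A B A' B' : Set Z} (hA : ContinuousOn f A)
    (hB : ContinuousOn f B) (hA' : IsClosed A') (hB' : IsClosed B') (hAA : A ⊆ A') (hBB : B ⊆ B')
    (h1 : A' ∩ (A ∪ B) ⊆ A) (h2 : B' ∩ (A ∪ B) ⊆ B) : ContinuousOn f (A ∪ B) := by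
  intro z hz
  refine ContinuousWithinAt.union ?_ ?_
  · by_cases h : z ∈ A'
    · exact hA z (h1 ⟨h, hz⟩)
    · exact continuousWithinAt_of_notMem_closure fun h' => h (closure_minimal hAA hA' h')
  · by_cases h : z ∈ B'
    · exact hB z (h2 ⟨h, hz⟩)
    · exact continuousWithinAt_of_notMem_closure fun h' => h (closure_minimal hBB hB' h')

/-- Radial expansion of the punctured closed unit ball onto the unit sphere. -/
def radial {E : Type v} [NormedAddCommGroup E] [NormedSpace ℝ E] (s : ℝ) (w : E) : E :=
  (1 - s + s * ‖w‖⁻¹) • w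

section Radial

variable {E : Type v} [NormedAddCommGroup E] [NormedSpace ℝ E] {s : ℝ} {w : E}

lemma norm_radial (hs : s ∈ Set.Icc (0 : ℝ) 1) (hw : w ≠ 0) :
    ‖radial s w‖ = (1 - s) * ‖w‖ + s := by
  have h0 : 0 < ‖w‖ := norm_pos_iff.mpr hw
  have h1 : 0 ≤ 1 - s + s * ‖w‖⁻¹ :=
    add_nonneg (sub_nonneg.mpr hs.2) (mul_nonneg hs.1 (inv_nonneg.mpr h0.le))
  rw [radial, norm_smul, Real.norm_of_nonneg h1, add_mul, mul_assoc, inv_mul_cancel₀ h0.ne',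
    mul_one]

lemma radial_ne_zero (hs : s ∈ Set.Icc (0 : ℝ) 1) (hw : w ≠ 0) : radial s w ≠ 0 := by
  rw [← norm_pos_iff, norm_radial hs hw]
  have h0 : 0 < ‖w‖ := norm_pos_iff.mpr hw
  rcases hs.1.eq_or_lt with rfl | h
  · simpa
  · exact add_pos_of_nonneg_of_pos (mul_nonneg (sub_nonneg.mpr hs.2) h0.le) h

lemma norm_radial_le (hs : s ∈ Set.Icc (0 : ℝ) 1) (hw : w ≠ 0) (h1 : ‖w‖ ≤ 1) :
    ‖radial s w‖ ≤ 1 := by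
  rw [norm_radial hs hw]
  nlinarith [hs.2]

lemma radial_eq_self (hw : ‖w‖ = 1) : radial s w = w := by
  simp [radial, hw]

lemma continuousOn_radial :
    ContinuousOn (fun p : ℝ × E => radial p.1 p.2) (Set.univ ×ˢ {0}ᶜ) := by
  unfold radial
  have : ContinuousOn (fun p : ℝ × E => ‖p.2‖⁻¹) (Set.univ ×ˢ {0}ᶜ) :=
    ContinuousOn.inv₀ (by fun_prop) fun p hp => norm_ne_zero_iff.mpr hp.2
  fun_prop

end Radial

variable {E : Type v} [NormedAddCommGroup E] [NormedSpace ℝ E] [ProperSpace E]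

/-- Attaching a cell: the pair of the punctured space and the old space is acyclic. -/
lemma isAcyclicPair_attach {f : E → X} {A : Set X} (hA : IsClosed A)
    (hf : ContinuousOn f (Metric.closedBall 0 1)) (hinj : Set.InjOn f (Metric.closedBall 0 1))
    (hfr : ∀ w ∈ Metric.closedBall (0 : E) 1, f w ∈ A ↔ ‖w‖ = 1) :
    IsAcyclicPair ((A ∪ f '' Metric.closedBall 0 1) \ {f 0}) A := by
  classical
  obtain ⟨g, hg, hgf⟩ := exists_continuousOn_leftInvOn (isCompact_closedBall 0 1) hf hinj
  have h0B : (0 : E) ∈ Metric.closedBall (0 : E) 1 := by simp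
  have hcA : f 0 ∉ A := fun h => by simpa using (hfr 0 h0B).mp h
  set D := f '' Metric.closedBall (0 : E) 1 with hD
  have hDc : IsClosed D := ((isCompact_closedBall 0 1).image_of_continuousOn hf).isClosed
  have hsplit : (A ∪ D) \ {f 0} = A ∪ D \ {f 0} := by
    ext x
    constructor
    · rintro ⟨h | h, h'⟩
      exacts [Or.inl h, Or.inr ⟨h, h'⟩]
    · rintro (h | h)
      · exact ⟨Or.inl h, by rintro rfl; exact hcA h⟩
      · exact ⟨Or.inr h.1, h.2⟩
  -- The radial expansion carried over by `f` on the closed cell, and the identity elsewhere. The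
  -- two agree on `A`, whose points in the cell come from the unit sphere.
  let H : ℝ → X → X := fun s x => if x ∈ D then f (radial s (g x)) else x
  have hHf : ∀ s, ∀ w ∈ Metric.closedBall (0 : E) 1, H s (f w) = f (radial s w) := by
    intro s w hw
    simp only [H, hD, if_pos (Set.mem_image_of_mem f hw), hgf hw]
  have hHA : ∀ s, ∀ x ∈ A, H s x = x := by
    intro s x hx
    by_cases h : x ∈ D
    · obtain ⟨w, hw, rfl⟩ := h
      rw [hHf s w hw, radial_eq_self ((hfr w hw).mp hx)]
    · exact if_neg h
  have hne : ∀ w, f w ∈ D \ {f 0} → w ≠ 0 := by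
    rintro w ⟨-, h⟩ rfl
    exact h rfl
  have hgne : ∀ x ∈ D \ {f 0}, g x ≠ 0 := by
    rintro _ ⟨⟨w, hw, rfl⟩, h⟩ h'
    rw [hgf hw] at h'
    exact h (h' ▸ rfl)
  rw [hsplit]
  refine isAcyclicPair_of_deformation (h := H) Set.subset_union_left ?_ ?_ ?_ ?_ ?_
  · rw [Set.prod_union]
    have c1 : ContinuousOn (fun p : ℝ × X => H p.1 p.2) (Set.Icc 0 1 ×ˢ A) :=
      continuousOn_snd.congr fun p hp => hHA _ _ hp.2
    have c2 : ContinuousOn (fun p : ℝ × X => H p.1 p.2) (Set.Icc 0 1 ×ˢ (D \ {f 0})) := by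
      have c3 : ContinuousOn (fun p : ℝ × X => (p.1, g p.2)) (Set.Icc (0 : ℝ) 1 ×ˢ (D \ {f 0})) :=
        continuousOn_fst.prodMk
          ((hg.mono Set.sdiff_subset).comp continuousOn_snd fun p hp => hp.2)
      have c4 := continuousOn_radial.comp c3 fun p hp => ⟨trivial, hgne p.2 hp.2⟩
      refine (hf.comp c4 fun p hp => ?_).congr fun p hp => if_pos hp.2.1
      obtain ⟨s, x⟩ := p
      obtain ⟨hs, ⟨w, hw, rfl⟩, hx⟩ := hp
      simp only [Function.comp_apply, hgf hw, mem_closedBall_zero_iff] at hw ⊢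
      exact norm_radial_le hs (by rintro rfl; exact hx rfl) hw
    refine continuousOn_union_of_isClosed c1 c2 (isClosed_Icc.prod hA) (isClosed_Icc.prod hDc) subset_rfl
      (Set.prod_mono_right Set.sdiff_subset) Set.inter_subset_left ?_
    rintro ⟨s, x⟩ ⟨⟨hs, hx⟩, h | h⟩
    · exact ⟨hs, hx, by rintro rfl; exact hcA h.2⟩
    · exact h
  · rintro s hs x (hx | hx)
    · rw [hHA s x hx]
      exact Or.inl hx
    · obtain ⟨⟨w, hw, rfl⟩, hx⟩ := hx
      have hw0 : w ≠ 0 := by rintro rfl; exact hx rfl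
      have hr : radial s w ∈ Metric.closedBall (0 : E) 1 :=
        mem_closedBall_zero_iff.mpr (norm_radial_le hs hw0 (mem_closedBall_zero_iff.mp hw))
      rw [hHf s w hw]
      exact Or.inr ⟨⟨_, hr, rfl⟩, fun h => radial_ne_zero hs hw0 (hinj hr h0B h)⟩
  · intro s hs x hx
    rwa [hHA s x hx]
  · rintro x (hx | ⟨⟨w, hw, rfl⟩, hx⟩)
    · exact hHA 0 x hx
    · rw [hHf 0 w hw]
      simp [radial]
  · rintro x (hx | ⟨⟨w, hw, rfl⟩, hx⟩)
    · rwa [hHA 1 x hx]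
    · have hw0 : w ≠ 0 := by rintro rfl; exact hx rfl
      have hn := norm_radial (s := 1) ⟨zero_le_one, le_rfl⟩ hw0
      rw [hHf 1 w hw, hfr]
      · simpa using hn
      · rw [mem_closedBall_zero_iff, hn]
        simp

/-- Attaching a cell: the relative homology is the local homology of the cell at its centre. -/
lemma nonempty_equiv_attach {f : E → X} {A : Set X} (hA : IsClosed A)
    (hf : ContinuousOn f (Metric.closedBall 0 1)) (hinj : Set.InjOn f (Metric.closedBall 0 1))
    (hfr : ∀ w ∈ Metric.closedBall (0 : E) 1, f w ∈ A ↔ ‖w‖ = 1) (n : ℕ) :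
    Nonempty (relH (Set.univ : Set E) {0}ᶜ n ≃ₗ[ℝ] relH (A ∪ f '' Metric.closedBall 0 1) A n) := by
  obtain ⟨g, hg, hgf⟩ := exists_continuousOn_leftInvOn (isCompact_closedBall 0 1) hf hinj
  obtain ⟨e1⟩ := (isAcyclicPair_attach hA hf hinj hfr).nonempty_equiv_right Set.sdiff_subset n
  have hball : Metric.ball (0 : E) 1 ⊆ Metric.closedBall 0 1 := Metric.ball_subset_closedBall
  have h0 : (0 : E) ∈ Metric.ball (0 : E) 1 := by simp
  have hcA : f 0 ∉ A := fun h => by simpa using (hfr 0 (hball h0)).mp h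
  set W := A ∪ f '' Metric.closedBall (0 : E) 1 with hW
  set U := f '' Metric.ball (0 : E) 1 with hU
  have hUW : U ⊆ W := (Set.image_mono hball).trans Set.subset_union_right
  -- The open cell is shown to be open relative to `W`; it need not be open in `X`, since other
  -- cells may be attached to it.
  have hUA : U = Aᶜ ∩ W := by
    ext x
    constructor
    · intro hx
      refine ⟨?_, hUW hx⟩
      obtain ⟨w, hw, rfl⟩ := hx
      intro h
      rw [hfr w (hball hw)] at h
      rw [mem_ball_zero_iff, h] at hw
      exact lt_irrefl _ hw
    · rintro ⟨hx, hx' | ⟨w, hw, rfl⟩⟩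
      · exact absurd hx' hx
      · refine ⟨w, mem_ball_zero_iff.mpr (lt_of_le_of_ne (mem_closedBall_zero_iff.mp hw) ?_), rfl⟩
        exact fun h => hx ((hfr w hw).mpr h)
  have hunion : U ∪ W \ {f 0} = W := by
    refine subset_antisymm (Set.union_subset hUW Set.sdiff_subset) fun x hx => ?_
    by_cases h : x = f 0
    · exact Or.inl ⟨0, h0, h.symm⟩
    · exact Or.inr ⟨hx, h⟩
  have hinter : U ∩ (W \ {f 0}) = U \ {f 0} := by
    rw [← Set.inter_sdiff_assoc, Set.inter_eq_left.mpr hUW]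
  obtain ⟨e2⟩ := nonempty_equiv_excision (U := U) (V := W \ {f 0}) hA.isOpen_compl
    (isClosed_singleton (x := f 0)).isOpen_compl (by rw [hunion, hUA])
    (by rw [hunion, Set.sdiff_eq, Set.inter_comm]) n
  rw [hunion, hinter] at e2
  obtain ⟨e3⟩ := nonempty_equiv_push (f := f) (g := g) (A := Metric.ball (0 : E) 1)
    (B := Metric.ball (0 : E) 1 \ {0}) (A' := U) (B' := U \ {f 0}) (hf.mono hball)
    (hg.mono (Set.image_mono hball)) Set.sdiff_subset Set.sdiff_subset
    (fun w hw => ⟨w, hw, rfl⟩)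
    (fun w hw => ⟨⟨w, hw.1, rfl⟩, fun h => hw.2 (hinj (hball hw.1) (hball h0) h)⟩)
    (by rintro _ ⟨w, hw, rfl⟩; rwa [hgf (hball hw)])
    (by
      rintro _ ⟨⟨w, hw, rfl⟩, h⟩
      rw [hgf (hball hw)]
      exact ⟨hw, by rintro rfl; exact h rfl⟩)
    (fun w hw => hgf (hball hw))
    (by rintro _ ⟨w, hw, rfl⟩; rw [hgf (hball hw)]) n
  obtain ⟨e4⟩ := nonempty_equiv_source (U := Metric.ball (0 : E) 1) (L := ∅) (K := {0})
    Metric.isOpen_ball (Set.empty_subset _) (by simp) isClosed_empty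
    isClosed_singleton n
  rw [Set.sdiff_empty, Set.compl_empty] at e4
  -- With `B` the open ball, this is `H(E, E ∖ 0) ≅ H(B, B ∖ 0) ≅ H(U, U ∖ f 0) ≅ H(W, W ∖ f 0) ≅
  -- H(W, A)`.
  exact ⟨e4.symm.trans (e3.trans (e2.trans e1.symm))⟩

/-! ### Homology of the skeleta and representation of cellular cycles. -/

variable [CWComplex (Set.univ : Set X)]

/-- The homology of the `(k-1)`-skeleton vanishes in degrees at least `k`. -/
lemma cycles_skelLT_le (d : ℕ) [IsRegularComplex X d] {k n : ℕ} (hn : k ≤ n) :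
    cycles (skelLT X k) ∅ n ≤ bounds (skelLT X k) ∅ n := by
  induction k generalizing n with
  | zero =>
    have h : skelLT X 0 = ∅ := by
      have := CWComplex.skeletonLT_zero_eq_empty (C := (Set.univ : Set X))
      simpa [skelLT] using this
    intro c hc
    rw [h] at hc ⊢
    exact Submodule.mem_sup_right hc.1
  | succ k ih =>
    have := IsRegularComplex.finite_cell (X := X) (d := d) k
    rw [← skelWith_univ]
    -- The `k`-cells are attached one at a time; each contributes only the local homology of `ℝᵏ`,
    -- which vanishes in degree `n > k`.
    refine Set.Finite.induction_on (motive := fun s _ =>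
      cycles (skelWith k s) ∅ n ≤ bounds (skelWith k s) ∅ n) _ Set.finite_univ ?_ ?_
    · rw [skelWith_empty]
      exact ih (k.le_succ.trans hn)
    · intro i s hi _ h c hc
      rw [skelWith_insert] at hc ⊢
      obtain ⟨l⟩ := nonempty_equiv_attach (f := map (C := (Set.univ : Set X)) k i)
        (isClosed_skelWith d s) (continuousOn k i) (IsRegularComplex.injOn_map d k i) (fun w hw => by
          constructor
          · intro hA
            by_contra hne
            refine Set.disjoint_left.mp (disjoint_skelWith_openCell hi) hA ⟨w, ?_, rfl⟩
            exact mem_ball_zero_iff.mpr (lt_of_le_of_ne (mem_closedBall_zero_iff.mp hw) hne)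
          · intro hw1
            exact cellFrontier_subset_skelWith s i ⟨w, by simpa using hw1, rfl⟩) n
      -- The balls of characteristic maps live in `Fin k → ℝ` with the sup norm; the identity to
      -- Euclidean space serves as a chart.
      have hs : Subsingleton (relH (Set.univ : Set (Fin k → ℝ)) {0}ᶜ n) :=
        subsingleton_local ((PiLp.homeomorph 2 (fun _ : Fin k => ℝ)).symm.toOpenPartialHomeomorph)
          (x := 0) (by simp) hn
      have hle := subsingleton_relH_iff.mp l.symm.toEquiv.subsingleton
      obtain ⟨x, hx, a, ha, rfl⟩ := mem_bounds.mp
        (hle (cycles_mono subset_rfl (Set.empty_subset _) n hc))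
      have ha' : a ∈ cycles (skelWith k s) ∅ n := mem_cycles.mpr
        ⟨ha, by simpa [bd_bds] using hc.2⟩
      exact add_mem (Submodule.mem_sup_left ⟨x, hx, rfl⟩)
        (bounds_mono Set.subset_union_left subset_rfl n (h ha'))

variable {d : ℕ} [IsRegularComplex X d]

lemma topClass_mem_cellularCycles_iff {c : Chain X d}
    (hc : c ∈ cycles Set.univ (singularPart X d) d) :
    topClass c hc ∈ cellularCycles X d ↔
      bd d c ∈ bounds (skelLT X d) (skelLT X (d - 1)) (d - 1) := by
  refine (Submodule.Quotient.mk_eq_zero _).trans ?_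
  change bdry d (d - 1) ((chainEquiv X d).symm c) ∈ relBoundaries _ _ _ ↔ _
  rw [mem_relBoundaries_iff, chainEquiv_bdry, LinearEquiv.apply_symm_apply]

/-- Every cellular cycle is represented, up to chains of the `(d-1)`-skeleton, by an absolute
cycle. -/
lemma exists_cycle_of_topClass_mem {c : Chain X d}
    {hc : c ∈ cycles Set.univ (singularPart X d) d} (h : topClass c hc ∈ cellularCycles X d) :
    ∃ z : Chain X d, bd d z = 0 ∧ c - z ∈ chainsOn (skelLT X d) d := by
  rw [topClass_mem_cellularCycles_iff] at h
  cases d with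
  | zero => exact ⟨c, by simp, by simp⟩
  | succ n =>
    obtain ⟨a, ha, b, hb, hab⟩ : ∃ a ∈ chainsOn (skelLT X (n + 1)) (n + 1),
      ∃ b ∈ chainsOn (skelLT X n) n, bds n a + b = bds n c := mem_bounds.mp h
    have hb0 : bd n b = 0 := by
      rw [eq_sub_of_add_eq' hab, map_sub, bd_bds, bd_bds, sub_zero]
    -- `b` is an absolute `n`-cycle of a skeleton with cells only in dimensions below `n`, so it
    -- bounds there.
    obtain ⟨b', hb', e, he, rfl⟩ := mem_bounds.mp
      (cycles_skelLT_le (n + 1) (le_refl n) (mem_cycles.mpr ⟨hb, by rw [hb0]; exact zero_mem _⟩))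
    rw [chainsOn_empty, Submodule.mem_bot] at he
    subst he
    refine ⟨c - (a + b'), ?_, ?_⟩
    · rw [bd_succ, map_sub, map_add, ← hab, add_zero, sub_self]
    · rw [sub_sub_cancel]
      refine add_mem ha (chainsOn_mono ?_ _ hb')
      exact RelCWComplex.skeletonLT_mono (by simp)

end CellularCycles

/-! ## The oriented matroid of a subspace of a coordinate space -/

section SubspaceMatroid

variable {E : Type u} {F : Type v}

/-- A vector of a subspace whose support is minimal among those of the nonzero vectors. -/
structure IsElementary (W : Submodule ℝ (E → ℝ)) (w : E → ℝ) : Prop where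
  mem : w ∈ W
  ne_zero : w ≠ 0
  minimal : ∀ z ∈ W, z ≠ 0 → (∀ e, w e = 0 → z e = 0) → ∀ e, z e = 0 → w e = 0

/-- The sign vectors of the elementary vectors of a subspace. -/
def elementarySigns (W : Submodule ℝ (E → ℝ)) : Set (E → SignType) :=
  {σ | ∃ w, IsElementary W w ∧ σ = fun e => SignType.sign (w e)}

lemma IsElementary.neg {W : Submodule ℝ (E → ℝ)} {w : E → ℝ} (h : IsElementary W w) :
    IsElementary W (-w) where
  mem := W.neg_mem h.mem
  ne_zero := neg_ne_zero.mpr h.ne_zero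
  minimal z hz hz0 hzw e he := by
    rw [Pi.neg_apply, h.minimal z hz hz0 (fun e he => hzw e (by simp [he])) e he, neg_zero]

/-- A vector supported in the support of an elementary vector is proportional to it. -/
lemma IsElementary.exists_eq_smul {W : Submodule ℝ (E → ℝ)} {w z : E → ℝ} (h : IsElementary W w)
    (hz : z ∈ W) (hzw : ∀ e, w e = 0 → z e = 0) : ∃ r : ℝ, z = r • w := by
  obtain ⟨e, he⟩ := Function.ne_iff.mp h.ne_zero
  refine ⟨z e / w e, ?_⟩
  by_contra hne
  refine he (h.minimal (z - (z e / w e) • w) (W.sub_mem hz (W.smul_mem _ h.mem))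
    (sub_ne_zero.mpr hne) (fun f hf => ?_) e ?_)
  · simp [hf, hzw f hf]
  · have : w e ≠ 0 := he
    simp [this]

/-- Every nonzero vector of a subspace has an elementary vector conforming to it. -/
lemma exists_isElementary_conformal [Finite E] {W : Submodule ℝ (E → ℝ)} {u : E → ℝ} (hu : u ∈ W)
    (hu0 : u ≠ 0) : ∃ w, IsElementary W w ∧ ∀ e, (0 < w e → 0 < u e) ∧ (w e < 0 → u e < 0) := by
  classical
  cases nonempty_fintype E
  induction h : (Finset.univ.filter fun e => u e ≠ 0).card using Nat.strong_induction_on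
    generalizing u with
  | _ n ih =>
    subst h
    by_cases hel : IsElementary W u
    · exact ⟨u, hel, fun e => ⟨id, id⟩⟩
    -- Failure of minimality gives a nonzero `z` whose support is strictly smaller than that of `u`.
    obtain ⟨z, hz, hz0, hzu, f, hzf, huf⟩ : ∃ z ∈ W, z ≠ 0 ∧ (∀ e, u e = 0 → z e = 0) ∧
        ∃ f, z f = 0 ∧ u f ≠ 0 := by
      by_contra hcon
      push Not at hcon
      exact hel ⟨hu, hu0, hcon⟩
    obtain ⟨z, hz, hzu, hzf, e, he⟩ : ∃ z ∈ W, (∀ e, u e = 0 → z e = 0) ∧ z f = 0 ∧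
        ∃ e, 0 < u e / z e := by
      obtain ⟨e, he⟩ := Function.ne_iff.mp hz0
      have he' : z e ≠ 0 := he
      have hue : u e ≠ 0 := fun h => he (hzu e h)
      rcases (div_ne_zero hue he').lt_or_gt with hlt | hgt
      · refine ⟨-z, W.neg_mem hz, fun e he => by simp [hzu e he], by simp [hzf], e, ?_⟩
        rw [Pi.neg_apply, div_neg]
        exact neg_pos.mpr hlt
      · exact ⟨z, hz, hzu, hzf, e, hgt⟩
    -- Subtract `z` times the least positive ratio `u e / z e`. No sign of `u` is reversed, the
    -- coordinate `a` becomes zero, and the coordinate `f` survives because `z f = 0`.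
    obtain ⟨a, ha, hmin⟩ := (Finset.univ.filter fun e => 0 < u e / z e).exists_min_image
      (fun e => u e / z e) ⟨e, by simpa⟩
    simp only [Finset.mem_filter, Finset.mem_univ, true_and] at ha hmin
    have hza : z a ≠ 0 := by
      intro h
      simp [h] at ha
    have hua : u a ≠ 0 := by
      intro h
      simp [h] at ha
    set t := u a / z a with ht
    have hconf : ∀ e, (0 < (u - t • z) e → 0 < u e) ∧ ((u - t • z) e < 0 → u e < 0) := by
      intro e
      simp only [Pi.sub_apply, Pi.smul_apply, smul_eq_mul]
      rcases lt_trichotomy (z e) 0 with h | h | h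
      · rcases le_or_gt (u e / z e) 0 with h' | h'
        · have h1 : 0 ≤ u e := by
            by_contra! h2
            exact absurd (div_pos_of_neg_of_neg h2 h) (not_lt.mpr h')
          have h2 : u e ≠ 0 := fun h2 => h.ne (hzu e h2)
          have h3 : t * z e < 0 := mul_neg_of_pos_of_neg ha h
          exact ⟨fun _ => lt_of_le_of_ne h1 h2.symm, fun h4 => by linarith⟩
        · have h1 := hmin e h'
          rw [le_div_iff_of_neg h] at h1
          have h2 : u e < 0 := by
            by_contra! h2
            exact absurd (div_nonpos_of_nonneg_of_nonpos h2 h.le) (not_le.mpr h')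
          exact ⟨fun h4 => by linarith, fun _ => h2⟩
      · simp [h]
      · rcases le_or_gt (u e / z e) 0 with h' | h'
        · have h1 : u e ≤ 0 := by
            by_contra! h2
            exact absurd (div_pos h2 h) (not_lt.mpr h')
          have h2 : u e ≠ 0 := fun h2 => h.ne' (hzu e h2)
          have h3 : 0 < t * z e := mul_pos ha h
          exact ⟨fun h4 => by linarith, fun _ => lt_of_le_of_ne h1 h2⟩
        · have h1 := hmin e h'
          rw [le_div_iff₀ h] at h1
          have h2 : 0 < u e := by
            by_contra! h2
            exact absurd (div_nonpos_of_nonpos_of_nonneg h2 h.le) (not_le.mpr h')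
          exact ⟨fun _ => h2, fun h4 => by linarith⟩
    have hss : (Finset.univ.filter fun e => (u - t • z) e ≠ 0) ⊂
        Finset.univ.filter fun e => u e ≠ 0 := by
      rw [Finset.ssubset_iff_of_subset]
      · refine ⟨a, by simpa using hua, ?_⟩
        simp [ht, div_mul_cancel₀ _ hza]
      · intro e
        simp only [Finset.mem_filter, Finset.mem_univ, true_and]
        intro h1 h2
        simp [h2, hzu e h2] at h1
    have hne : u - t • z ≠ 0 := Function.ne_iff.mpr ⟨f, by simpa [hzf] using huf⟩
    obtain ⟨w, hw, hwc⟩ := ih _ (Finset.card_lt_card hss) (W.sub_mem hu (W.smul_mem t hz)) hne rfl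
    exact ⟨w, hw, fun e => ⟨fun h => (hconf e).1 ((hwc e).1 h),
      fun h => (hconf e).2 ((hwc e).2 h)⟩⟩

/-- The oriented matroid of a subspace, with the signs of its elementary vectors as circuits. -/
def subspaceMatroid [Finite E] (W : Submodule ℝ (E → ℝ)) : OrientedMatroid E where
  circuits := elementarySigns W
  finite_ground := inferInstance
  zero_notMem := by
    rintro ⟨w, hw, h⟩
    refine hw.ne_zero (funext fun e => ?_)
    have := congrFun h e
    exact sign_eq_zero_iff.mp this.symm
  neg_mem := by
    rintro _ ⟨w, hw, rfl⟩
    exact ⟨-w, hw.neg, funext fun e => (Left.sign_neg (w e)).symm⟩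
  incomparable := by
    rintro _ ⟨w, hw, rfl⟩ _ ⟨z, hz, rfl⟩ h
    simp only [ne_eq, sign_eq_zero_iff] at h
    obtain ⟨r, rfl⟩ := hz.exists_eq_smul hw.mem fun e => not_imp_not.mp (h e)
    have hr : r ≠ 0 := by
      rintro rfl
      exact hw.ne_zero (zero_smul _ _)
    rcases hr.lt_or_gt with hr | hr
    · right
      ext e
      simp [sign_mul, sign_neg hr]
    · left
      ext e
      simp [sign_mul, sign_pos hr]
  elimination := by
    rintro _ ⟨w, hw, rfl⟩ _ ⟨z, hz, rfl⟩ hne e hwe hze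
    rw [sign_eq_one_iff] at hwe
    rw [sign_eq_neg_one_iff] at hze
    -- Both coefficients are positive and the combination cancels at `e`, so its signs come from `w`
    -- or `z`, and a conforming elementary vector inherits them. Were it zero, the two circuits
    -- would be opposite.
    obtain ⟨r, hr, hrc⟩ := exists_isElementary_conformal (u := (-z e) • w + w e • z)
      (W.add_mem (W.smul_mem _ hw.mem) (W.smul_mem _ hz.mem)) (by
        intro h
        refine hne (funext fun f => ?_)
        have hf : -z e * w f + w e * z f = 0 := by simpa using congrFun h f
        rw [← Left.sign_neg]
        have hp : 0 < w e / -z e := div_pos hwe (neg_pos.mpr hze)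
        have : w f = (w e / -z e) * -z f := by
          rw [div_neg, neg_mul_neg, div_mul_eq_mul_div, eq_div_iff hze.ne]
          linarith
        rw [this, sign_mul, sign_pos hp, one_mul])
    simp only [Pi.add_apply, Pi.smul_apply, smul_eq_mul] at hrc
    refine ⟨_, ⟨r, hr, rfl⟩, ?_, fun f hf => ?_, fun f hf => ?_⟩
    · have := hrc e
      rw [show -z e * w e + w e * z e = 0 by ring] at this
      rw [sign_eq_zero_iff]
      refine le_antisymm (not_lt.mp fun h => lt_irrefl _ (this.1 h))
        (not_lt.mp fun h => lt_irrefl _ (this.2 h))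
    · rw [sign_eq_one_iff] at hf ⊢
      rw [sign_eq_one_iff]
      by_contra! hcon
      nlinarith [(hrc f).1 hf]
    · rw [sign_eq_neg_one_iff] at hf ⊢
      rw [sign_eq_neg_one_iff]
      by_contra! hcon
      nlinarith [(hrc f).2 hf]

/-- `H` says that rescaling coordinates along `g` matches the subspaces. Since no factor is zero,
supports correspond and so does minimality. -/
lemma IsElementary.of_scaling {W : Submodule ℝ (E → ℝ)} {W' : Submodule ℝ (F → ℝ)} (g : E ≃ F)
    {l : E → ℝ} (hl : ∀ e, l e ≠ 0)
    (H : ∀ w w', (∀ e, w' (g e) = l e * w e) → (w ∈ W ↔ w' ∈ W')) {w : E → ℝ} {w' : F → ℝ}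
    (hw : ∀ e, w' (g e) = l e * w e) (h : IsElementary W w) : IsElementary W' w' where
  mem := (H w w' hw).mp h.mem
  ne_zero := by
    rintro rfl
    exact h.ne_zero (funext fun e => by simpa [hl e] using hw e)
  minimal z' hz' hz0 hzw f hf := by
    obtain ⟨e, rfl⟩ := g.surjective f
    have h1 : ∀ e, z' (g e) = l e * ((l e)⁻¹ * z' (g e)) := fun e => by
      rw [mul_inv_cancel_left₀ (hl e)]
    rw [hw, h.minimal (fun e => (l e)⁻¹ * z' (g e)) ((H _ z' h1).mpr hz') ?_ ?_ e ?_, mul_zero]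
    · intro h0
      refine hz0 (funext fun f => ?_)
      obtain ⟨e, rfl⟩ := g.surjective f
      simpa [hl e] using congrFun h0 e
    · intro e he
      rw [hzw (g e) (by rw [hw, he, mul_zero]), mul_zero]
    · rw [hf, mul_zero]

/-- Scaling the coordinates reorients the sign vectors of the elementary vectors. -/
lemma mem_elementarySigns_iff_of_scaling {W : Submodule ℝ (E → ℝ)} {W' : Submodule ℝ (F → ℝ)}
    (g : E ≃ F) {l : E → ℝ} (hl : ∀ e, l e ≠ 0)
    (H : ∀ w w', (∀ e, w' (g e) = l e * w e) → (w ∈ W ↔ w' ∈ W')) (τ : F → SignType) :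
    τ ∈ elementarySigns W' ↔ ∃ σ ∈ elementarySigns W,
      ∀ e, (e ∈ {e | l e < 0} → τ (g e) = -σ e) ∧ (e ∉ {e | l e < 0} → τ (g e) = σ e) := by
  have key : ∀ (w : E → ℝ) (w' : F → ℝ) (e : E), w' (g e) = l e * w e →
      (l e < 0 → SignType.sign (w' (g e)) = -SignType.sign (w e)) ∧
        (¬ l e < 0 → SignType.sign (w' (g e)) = SignType.sign (w e)) := by
    intro w w' e h
    rw [h, sign_mul]
    refine ⟨fun h => by rw [sign_neg h, neg_one_mul], fun h => ?_⟩
    rw [sign_pos (lt_of_le_of_ne (not_lt.mp h) (hl e).symm), one_mul]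
  constructor
  · rintro ⟨w', hw', rfl⟩
    have hw : ∀ e, w' (g e) = l e * ((l e)⁻¹ * w' (g e)) := fun e => by
      rw [mul_inv_cancel_left₀ (hl e)]
    refine ⟨_, ⟨fun e => (l e)⁻¹ * w' (g e), ?_, rfl⟩,
      fun e => key (fun e => (l e)⁻¹ * w' (g e)) w' e (hw e)⟩
    refine IsElementary.of_scaling g.symm (l := fun f => (l (g.symm f))⁻¹)
      (fun f => inv_ne_zero (hl _)) (fun z' z hz => (H z z' fun e => ?_).symm) (fun f => ?_) hw'
    · have := hz (g e)
      rw [g.symm_apply_apply] at this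
      rw [this, mul_inv_cancel_left₀ (hl e)]
    · rw [g.apply_symm_apply]
  · rintro ⟨_, ⟨w, hw, rfl⟩, hτ⟩
    have hw' : ∀ e, (fun f => l (g.symm f) * w (g.symm f)) (g e) = l e * w e := fun e => by
      simp
    refine ⟨_, hw.of_scaling (w' := fun f => l (g.symm f) * w (g.symm f)) g hl H hw',
      funext fun f => ?_⟩
    obtain ⟨e, rfl⟩ := g.surjective f
    have h1 := key w (fun f => l (g.symm f) * w (g.symm f)) e (hw' e)
    by_cases h : l e < 0
    · rw [(hτ e).1 h, h1.1 h]
    · rw [(hτ e).2 h, h1.2 h]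

end SubspaceMatroid

/-! ## The oriented matroid of a regular complex -/

section ComplexMatroid

variable {X : Type u} [TopologicalSpace X] {Y : Type v} [TopologicalSpace Y] {d : ℕ}

lemma mem_cycles_of_bd_eq_zero {c : Chain X d} (hc : bd d c = 0) (B : Set X) :
    c ∈ cycles Set.univ B d :=
  mem_cycles.mpr ⟨by simp, by rw [hc]; exact zero_mem _⟩

lemma topClass_sub {c e : Chain X d} (hc : c ∈ cycles Set.univ (singularPart X d) d)
    (he : e ∈ cycles Set.univ (singularPart X d) d) :
    topClass (c - e) (sub_mem hc he) = topClass c hc - topClass e he := by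
  refine Eq.trans ?_ (Submodule.Quotient.mk_sub _)
  exact congrArg _ (Subtype.ext (map_sub _ _ _))

variable (X d) in
/-- The map from the absolute cycles to `C_d`. -/
def cycleClass : LinearMap.ker (bd (X := X) d) →ₗ[ℝ] TopChains X d :=
  Submodule.mkQ _ ∘ₗ LinearMap.codRestrict (relCycles Set.univ (singularPart X d) d)
    ((chainEquiv X d).symm.toLinearMap ∘ₗ Submodule.subtype _) fun z =>
      mem_relCycles_iff.mpr (by simpa using mem_cycles_of_bd_eq_zero z.2 _)

lemma cycleClass_apply (z : LinearMap.ker (bd (X := X) d)) :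
    cycleClass X d z = topClass z.1 (mem_cycles_of_bd_eq_zero z.2 _) :=
  rfl

section Cells

variable [T2Space X] [Topology.CWComplex (Set.univ : Set X)] [IsRegularComplex X d]

/-- The right side involves only absolute singular cycles, so the coordinate image of the cellular
cycles does not depend on the cell structure. -/
lemma mem_map_cellularCycles_iff {φ : CoordStratum X d → (TopChains X d →ₗ[ℝ] ℝ)}
    (hφ : IsCoordinateSystem φ) {w : CoordStratum X d → ℝ} :
    w ∈ (cellularCycles X d).map (LinearMap.pi φ) ↔
      ∃ z, ∀ S, w S = φ S (cycleClass X d z) := by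
  constructor
  · rintro ⟨a, ha, rfl⟩
    obtain ⟨c, hc, rfl⟩ := topClass_surjective a
    obtain ⟨z, hz, hcz⟩ := exists_cycle_of_topClass_mem ha
    refine ⟨⟨z, hz⟩, fun S => ?_⟩
    have hz' := mem_cycles_of_bd_eq_zero hz (singularPart X d)
    rw [cycleClass_apply, LinearMap.pi_apply, ← sub_eq_zero, ← map_sub, ← topClass_sub hc hz',
      ← LinearMap.mem_ker, hφ S]
    -- At a point of `S` in an open `d`-cell the difference `c - z`, a chain of the
    -- `(d-1)`-skeleton, has zero restriction.
    obtain ⟨i, x, hxS, hxi⟩ := S.1.exists_mem_openCell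
    rw [topClass_mem_hyperplane_iff S.1 _ hxS]
    refine Submodule.mem_sup_right (chainsOn_mono ?_ _ hcz)
    rintro y hy rfl
    exact Set.disjoint_left.mp (disjoint_skelLT_openCell le_rfl i) hy hxi
  · rintro ⟨z, hz⟩
    refine ⟨cycleClass X d z, ?_, funext fun S => (hz S).symm⟩
    rw [cycleClass_apply]
    refine (topClass_mem_cellularCycles_iff _).mpr ?_
    rw [LinearMap.mem_ker.mp z.2]
    exact zero_mem _

/-- Because `ker φ_S = H_S`, the support of a class is that of its coordinate vector. Injectivity of
the coordinate map is not needed. -/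
lemma signedCircuits_eq_elementarySigns {φ : CoordStratum X d → (TopChains X d →ₗ[ℝ] ℝ)}
    (hφ : IsCoordinateSystem φ) :
    signedCircuits φ = elementarySigns ((cellularCycles X d).map (LinearMap.pi φ)) := by
  have hsupp : ∀ c S, S ∈ support c ↔ φ S c ≠ 0 := fun c S => by
    rw [support, Set.mem_ofPred_eq, ← hφ S, LinearMap.mem_ker]
  have hne : ∀ c, (support c).Nonempty ↔ LinearMap.pi φ c ≠ 0 := fun c => by
    rw [Function.ne_iff]
    exact exists_congr fun S => hsupp c S
  have hsub : ∀ c e, support e ⊆ support c ↔ ∀ S, φ S c = 0 → φ S e = 0 := fun c e =>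
    forall_congr' fun S => by rw [hsupp, hsupp, not_imp_not]
  have key : ∀ c, IsMinimalCycle c ↔ c ∈ cellularCycles X d ∧
      IsElementary ((cellularCycles X d).map (LinearMap.pi φ)) (LinearMap.pi φ c) := by
    intro c
    constructor
    · rintro ⟨h1, h2, h3⟩
      refine ⟨h1, ⟨c, h1, rfl⟩, (hne c).mp h2, ?_⟩
      rintro _ ⟨e, he, rfl⟩ he0 hle
      exact (hsub e c).mp (h3 e he ((hne e).mpr he0) ((hsub c e).mpr hle)).ge
    · rintro ⟨h1, h2⟩
      refine ⟨h1, (hne c).mpr h2.ne_zero, fun e he he0 hle => subset_antisymm hle ?_⟩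
      exact (hsub e c).mpr
        (h2.minimal _ ⟨e, he, rfl⟩ ((hne e).mp he0) ((hsub c e).mp hle))
  ext σ
  constructor
  · rintro ⟨c, hc, rfl⟩
    exact ⟨_, ((key c).mp hc).2, rfl⟩
  · rintro ⟨w, hw, rfl⟩
    obtain ⟨c, hc, rfl⟩ := hw.mem
    exact ⟨c, (key c).mpr ⟨hc, hw⟩, rfl⟩

end Cells

/-! ### Homeomorphisms -/

lemma push_homeomorph_mem_bounds (f : X ≃ₜ Y) {n : ℕ} {c : Chain X n} {x : X}
    (hc : c ∈ bounds Set.univ {x}ᶜ n) : push f n c ∈ bounds Set.univ {f x}ᶜ n := by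
  have h : Set.MapsTo f {x}ᶜ {f x}ᶜ := fun _ hy h => hy (f.injective h)
  exact push_mem_bounds f.continuous.continuousOn (Set.subset_univ _) (Set.mapsTo_univ _ _) h hc

lemma push_symm_push (f : X ≃ₜ Y) {n : ℕ} (c : Chain X n) : push f.symm n (push f n c) = c :=
  push_push (A := Set.univ) (A' := Set.univ) f.continuous.continuousOn
    f.symm.continuous.continuousOn (Set.mapsTo_univ _ _) (fun x _ => f.symm_apply_apply x) (by simp)

lemma push_homeomorph_mem_bounds_iff (f : X ≃ₜ Y) {n : ℕ} {c : Chain X n} {x : X} :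
    push f n c ∈ bounds Set.univ {f x}ᶜ n ↔ c ∈ bounds Set.univ {x}ᶜ n := by
  refine ⟨fun h => ?_, push_homeomorph_mem_bounds f⟩
  have := push_homeomorph_mem_bounds f.symm h
  rwa [push_symm_push, f.symm_apply_apply] at this

lemma push_mem_cycles_singularPart (f : X ≃ₜ Y) {c : Chain X d}
    (hc : c ∈ cycles Set.univ (singularPart X d) d) :
    push f d c ∈ cycles Set.univ (singularPart Y d) d := by
  have h : Set.MapsTo f (singularPart X d) (singularPart Y d) := fun x hx h =>
    hx (by simpa using apply_mem_manifoldPoints f.symm h)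
  exact push_mem_cycles f.continuous.continuousOn (Set.subset_univ _) (Set.mapsTo_univ _ _) h hc

lemma bd_push_homeomorph (f : X ≃ₜ Y) (c : Chain X d) :
    bd d (push f d c) = push f (d - 1) (bd d c) :=
  bd_push (A := Set.univ) f.continuous.continuousOn (by simp)

/-- The image of a stratum under a homeomorphism. -/
def Stratum.image (f : X ≃ₜ Y) (S : Stratum X d) : Stratum Y d :=
  ⟨f '' S.1, by
    obtain ⟨S, x, hx, rfl⟩ := S
    refine ⟨f x, apply_mem_manifoldPoints f hx, ?_⟩
    rw [f.image_connectedComponentIn hx, image_manifoldPoints]⟩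

lemma Stratum.hyperplane_ne_top_iff [T2Space X] (S : Stratum X d) {x : X} (hx : x ∈ S.1) :
    S.hyperplane ≠ ⊤ ↔
      ∃ c ∈ cycles Set.univ (singularPart X d) d, c ∉ bounds Set.univ {x}ᶜ d := by
  rw [Ne, Submodule.eq_top_iff']
  push Not
  constructor
  · rintro ⟨a, ha⟩
    obtain ⟨c, hc, rfl⟩ := topClass_surjective a
    exact ⟨c, hc, fun h => ha ((topClass_mem_hyperplane_iff S hc hx).mpr h)⟩
  · rintro ⟨c, hc, h⟩
    exact ⟨topClass c hc, fun h' => h ((topClass_mem_hyperplane_iff S hc hx).mp h')⟩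

lemma Stratum.hyperplane_image_ne_top [T2Space X] [T2Space Y] (f : X ≃ₜ Y) {S : Stratum X d}
    (h : S.hyperplane ≠ ⊤) : (S.image f).hyperplane ≠ ⊤ := by
  obtain ⟨x, hx⟩ := S.nonempty
  obtain ⟨c, hc, hcx⟩ := (S.hyperplane_ne_top_iff hx).mp h
  exact ((S.image f).hyperplane_ne_top_iff ⟨x, hx, rfl⟩).mpr ⟨push f d c,
    push_mem_cycles_singularPart f hc, fun h => hcx ((push_homeomorph_mem_bounds_iff f).mp h)⟩

/-- The bijection of the coordinate strata induced by a homeomorphism. -/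
def coordStratumEquiv [T2Space X] [T2Space Y] (f : X ≃ₜ Y) :
    CoordStratum X d ≃ CoordStratum Y d where
  toFun S := ⟨S.1.image f, Stratum.hyperplane_image_ne_top f S.2⟩
  invFun S := ⟨S.1.image f.symm, Stratum.hyperplane_image_ne_top f.symm S.2⟩
  left_inv S := Subtype.ext (Subtype.ext (f.toEquiv.symm_image_image S.1.1))
  right_inv S := Subtype.ext (Subtype.ext (f.toEquiv.image_symm_image S.1.1))

lemma exists_ne_zero_smul_of_ker_eq {M : Type*} [AddCommGroup M] [Module ℝ M] {a b : M →ₗ[ℝ] ℝ}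
    (h : LinearMap.ker a = LinearMap.ker b) : ∃ l : ℝ, l ≠ 0 ∧ b = l • a := by
  have hk : ∀ m, a m = 0 ↔ b m = 0 := fun m => by
    rw [← LinearMap.mem_ker, h, LinearMap.mem_ker]
  -- This case does occur: a functional nonzero on `C_d` may vanish on all absolute cycles.
  by_cases ha : a = 0
  · refine ⟨1, one_ne_zero, LinearMap.ext fun m => ?_⟩
    have : a m = 0 := by simp [ha]
    simp [(hk m).mp this, this]
  · obtain ⟨m, hm⟩ : ∃ m, a m ≠ 0 := by
      by_contra! hcon
      exact ha (LinearMap.ext hcon)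
    refine ⟨b m / a m, div_ne_zero (fun h' => hm ((hk m).mpr h')) hm, LinearMap.ext fun n => ?_⟩
    have := (hk (n - (a n / a m) • m)).mp (by simp [hm])
    rw [map_sub, map_smul, sub_eq_zero] at this
    rw [this, LinearMap.smul_apply, smul_eq_mul, smul_eq_mul]
    ring

variable (d) in
/-- The map on absolute cycles induced by a homeomorphism. -/
def pushCycles (f : X ≃ₜ Y) : LinearMap.ker (bd (X := X) d) →ₗ[ℝ] LinearMap.ker (bd (X := Y) d) :=
  (push f d).restrict fun c hc => by
    rw [LinearMap.mem_ker] at hc ⊢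
    rw [bd_push_homeomorph, hc, map_zero]

/-- On absolute cycles both functionals have as kernel the cycles with zero restriction at one
point, `x` for `φ S` and `f x` for its counterpart, and `f` matches these conditions. -/
lemma exists_smul_eq_pushCycles [T2Space X] [T2Space Y] (f : X ≃ₜ Y)
    {φ : CoordStratum X d → (TopChains X d →ₗ[ℝ] ℝ)}
    {ψ : CoordStratum Y d → (TopChains Y d →ₗ[ℝ] ℝ)} (hφ : IsCoordinateSystem φ)
    (hψ : IsCoordinateSystem ψ) (S : CoordStratum X d) : ∃ l : ℝ, l ≠ 0 ∧
      ∀ z, ψ (coordStratumEquiv f S) (cycleClass Y d (pushCycles d f z)) =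
        l * φ S (cycleClass X d z) := by
  obtain ⟨x, hx⟩ := S.1.nonempty
  have hfx : f x ∈ (coordStratumEquiv f S).1.1 := ⟨x, hx, rfl⟩
  obtain ⟨l, hl, h⟩ := exists_ne_zero_smul_of_ker_eq (a := φ S ∘ₗ cycleClass X d)
    (b := ψ (coordStratumEquiv f S) ∘ₗ cycleClass Y d ∘ₗ pushCycles d f) (by
      ext z
      simp only [LinearMap.mem_ker, LinearMap.comp_apply]
      rw [← LinearMap.mem_ker, hφ S, ← LinearMap.mem_ker, hψ (coordStratumEquiv f S),
        cycleClass_apply, cycleClass_apply, topClass_mem_hyperplane_iff _ _ hx,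
        topClass_mem_hyperplane_iff _ _ hfx]
      exact (push_homeomorph_mem_bounds_iff f).symm)
  exact ⟨l, hl, fun z => LinearMap.congr_fun h z⟩

lemma isReorientationAlong_coordStratumEquiv [T2Space X] [Topology.CWComplex (Set.univ : Set X)]
    [IsRegularComplex X d] [T2Space Y] [Topology.CWComplex (Set.univ : Set Y)]
    [IsRegularComplex Y d] (f : X ≃ₜ Y) {φ : CoordStratum X d → (TopChains X d →ₗ[ℝ] ℝ)}
    {ψ : CoordStratum Y d → (TopChains Y d →ₗ[ℝ] ℝ)} (hφ : IsCoordinateSystem φ)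
    (hψ : IsCoordinateSystem ψ) {M : OrientedMatroid (CoordStratum X d)}
    {N : OrientedMatroid (CoordStratum Y d)} (hM : M.circuits = signedCircuits φ)
    (hN : N.circuits = signedCircuits ψ) :
    IsReorientationAlong (coordStratumEquiv f) M N := by
  choose l hl h using exists_smul_eq_pushCycles f hφ hψ
  refine ⟨{S | l S < 0}, fun τ => ?_⟩
  rw [hM, hN, signedCircuits_eq_elementarySigns hφ, signedCircuits_eq_elementarySigns hψ]
  refine mem_elementarySigns_iff_of_scaling (coordStratumEquiv f) hl (fun w w' hw => ?_) τ
  rw [mem_map_cellularCycles_iff hφ, mem_map_cellularCycles_iff hψ]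
  constructor
  · rintro ⟨z, hz⟩
    refine ⟨pushCycles d f z, fun T => ?_⟩
    obtain ⟨S, rfl⟩ := (coordStratumEquiv f).surjective T
    rw [hw, hz, h]
  · rintro ⟨z, hz⟩
    have hpz : pushCycles d f (pushCycles d f.symm z) = z := Subtype.ext (push_symm_push f.symm z.1)
    refine ⟨pushCycles d f.symm z, fun S => mul_left_cancel₀ (hl S) ?_⟩
    rw [← hw, hz, ← h, hpz]

end ComplexMatroid

end ReidMatroid

end

theorem mainTheorem4
    (X : Type*) [TopologicalSpace X] [T2Space X] [Topology.CWComplex (Set.univ : Set X)]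
    (d : ℕ) [ReidMatroid.IsRegularComplex X d] :
    -- coordinates exist, that is, the coordinate hyperplanes have codimension one
    (∃ φ : ReidMatroid.CoordStratum X d → (ReidMatroid.TopChains X d →ₗ[ℝ] ℝ),
      ReidMatroid.IsCoordinateSystem φ) ∧
    -- the cycles of minimal support are the circuits of an oriented matroid
    (∀ φ : ReidMatroid.CoordStratum X d → (ReidMatroid.TopChains X d →ₗ[ℝ] ℝ),
      ReidMatroid.IsCoordinateSystem φ →
      ∃ M : ReidMatroid.OrientedMatroid (ReidMatroid.CoordStratum X d),
        M.circuits = ReidMatroid.signedCircuits φ) ∧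
    -- the oriented matroid depends, up to reorientation, only on the topological space
    (∀ (Y : Type*) [TopologicalSpace Y] [T2Space Y] [Topology.CWComplex (Set.univ : Set Y)]
      (d' : ℕ) [ReidMatroid.IsRegularComplex Y d'] (f : X ≃ₜ Y),
      ∃ g : ReidMatroid.CoordStratum X d ≃ ReidMatroid.CoordStratum Y d',
        (∀ S, (g S).1.1 = f '' S.1.1) ∧
        ∀ (φ : ReidMatroid.CoordStratum X d → (ReidMatroid.TopChains X d →ₗ[ℝ] ℝ))
          (ψ : ReidMatroid.CoordStratum Y d' → (ReidMatroid.TopChains Y d' →ₗ[ℝ] ℝ)),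
          ReidMatroid.IsCoordinateSystem φ → ReidMatroid.IsCoordinateSystem ψ →
          ∀ (M : ReidMatroid.OrientedMatroid (ReidMatroid.CoordStratum X d))
            (N : ReidMatroid.OrientedMatroid (ReidMatroid.CoordStratum Y d')),
            M.circuits = ReidMatroid.signedCircuits φ →
            N.circuits = ReidMatroid.signedCircuits ψ →
            ReidMatroid.IsReorientationAlong g M N) := by
  refine ⟨ReidMatroid.exists_isCoordinateSystem, fun φ hφ => ?_, ?_⟩
  · have := ReidMatroid.finite_coordStratum X d
    exact ⟨ReidMatroid.subspaceMatroid _,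
      (ReidMatroid.signedCircuits_eq_elementarySigns hφ).symm⟩
  · intro Y _ _ _ d' _ f
    -- The dimensions are identified first, since the strata and chain groups of `Y` are formed with
    -- `d'`.
    obtain rfl : d = d' := le_antisymm (ReidMatroid.dim_le_of_homeomorph f)
      (ReidMatroid.dim_le_of_homeomorph f.symm)
    exact ⟨ReidMatroid.coordStratumEquiv f, fun S => rfl, fun φ ψ hφ hψ M N hM hN =>
      ReidMatroid.isReorientationAlong_coordStratumEquiv f hφ hψ hM hN⟩
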